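/- Let $K$ be an algebraically closed field with a nontrivial valuation $\operatorname{val}:K^*\to\mathbb R$ and value group $\Gamma_{\operatorname{val}}$. Write $\mathbb R^{m}/\mathbb R$ for the quotient of $\mathbb R^m$ by the line spanned by $(1,\dots,1)$, with the lattice given by the image of $\mathbb Z^m$. A *tropical curve* in $\mathbb R^4/\mathbb R$ is a finite polyhedral complex of pure dimension one that is $\Gamma_{\operatorname{val}}$-rational, with weights in $\mathbb Q$ on its one-dimensional cells, satisfying the balancing condition at every vertex. The support of a weighted polyhedral complex is the union of its maximal cells of nonzero weight. Weighted polyhedral complexes are identified up to the choice of polyhedral structure: two of them are equal if they have the same support and any two maximal cells (one of each) whose relative interiors meet have the same weight. Let $\varphi:\mathbb R^4/\mathbb R\to\mathbb R^6/\mathbb R$ be the linear map $(a_i)_i\mapsto(a_i+a_j)_{\{i,j\}}$, where the coordinates of $\mathbb R^6$ are indexed by the two-element subsets of $\{0,1,2,3\}$. Let $\mathscr G_u\subset \operatorname{Gr}(1,3)\subset\mathbb P^5$ be the variety of lines in $\mathbb P^3$ through $u=[1:1:1:1]$, in Plücker coordinates, and let $\Gamma_0=\operatorname{Trop}(\mathscr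 G_u)\subset\mathbb R^6/\mathbb R$ be the tropicalization (minimum convention, with multiplicities) of its intersection with the torus; it has pure dimension two. For a tropical curve $\Sigma\subset\mathbb R^4/\mathbb R$, its tropical Chow hypersurface is the weighted polyhedral complex of pure dimension three $$Z_\Sigma=\varphi(\Sigma)+\Gamma_0\subset\operatorname{TrGr}(1,3)\subset\mathbb R^6/\mathbb R .$$ Here $+$ is the Minkowski sum of weighted polyhedral complexes: for maximal cells $\sigma$ of $\varphi(\Sigma)$ (with the weights of $\Sigma$) and $\gamma$ of $\Gamma_0$, the polyhedron $\sigma+\gamma$ has weight $m_{\sigma+\gamma}=m_\sigma m_\gamma\,[N_{\sigma+\gamma}:N_\sigma+N_\gamma]$ if $\dim(\sigma+\gamma)=\dim\sigma+\dim\gamma$, and $m_{\sigma+\gamma}=0$ otherwise, where $N_\sigma$ is the lattice of integer points in the linear space parallel to $\sigma$; for a polyhedral structure such that each $\sigma+\gamma$ of dimension $\dim\sigma+\dim\gamma$ is a union of cells, a maximal cell $\tau$ has weight $\sum_{\sigma+\gamma\supseteq\tau}m_{\sigma+\gamma}$. **Theorem.** Let $\Sigma,\Sigma'\subset\mathbb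 R^4/\mathbb R$ be tropical curves whose supports are (supports of) fans, i.e. finite unions of cones with apex at the origin forming a polyhedral complex. If $Z_\Sigma=Z_{\Sigma'}$ as weighted polyhedral complexes, then $\Sigma=\Sigma'$. -/

import Mathlib

open scoped Pointwise

noncomputable section

namespace TropicalChow

/-! ## Polyhedra and weighted polyhedral complexes in a real vector space with a lattice -/

section Polyhedra

variable {V : Type*} [AddCommGroup V] [Module ℝ V]

/-- A polyhedron: a finite intersection of closed half-spaces. -/
def IsPolyhedron (P : Set V) : Prop :=
  ∃ H : Finset ((V →ₗ[ℝ] ℝ) × ℝ), P = {x | ∀ h ∈ H, h.1 x ≤ h.2}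

/-- A `G`-rational polyhedron with respect to the lattice `N`: the half-spaces can be chosen of the
form `ℓ x ≤ c` with `ℓ` integral on `N` and `c ∈ G`. -/
def IsRationalPolyhedron (N : AddSubgroup V) (G : Set ℝ) (P : Set V) : Prop :=
  ∃ H : Finset ((V →ₗ[ℝ] ℝ) × ℝ),
    (∀ h ∈ H, (∀ x ∈ N, ∃ z : ℤ, h.1 x = z) ∧ h.2 ∈ G) ∧ P = {x | ∀ h ∈ H, h.1 x ≤ h.2}

/-- `F` is a (nonempty) face of `P`: the locus in `P` where some linear functional attains its
minimum on `P`. The zero functional gives `P` itself. -/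
def IsFace (F P : Set V) : Prop :=
  F.Nonempty ∧ ∃ l : V →ₗ[ℝ] ℝ, F = {x | x ∈ P ∧ ∀ y ∈ P, l x ≤ l y}

/-- The dimension of a (nonempty) polyhedron. -/
def polyDim (P : Set V) : ℕ := Module.finrank ℝ (vectorSpan ℝ P)

/-- The lattice `N_P` of a rational polyhedron `P`: the points of `N` in the linear space parallel
to `P`. For a rational cone this is the group generated by its lattice points. -/
def cellLattice (N : AddSubgroup V) (P : Set V) : AddSubgroup V :=
  N ⊓ (vectorSpan ℝ P).toAddSubgroup

variable (V) in
/-- A (finite) polyhedral complex. -/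
structure PolyhedralComplex where
  /-- The cells. -/
  cells : Finset (Set V)
  isPolyhedron : ∀ P ∈ cells, IsPolyhedron P
  nonempty : ∀ P ∈ cells, P.Nonempty
  face_mem : ∀ P ∈ cells, ∀ F, IsFace F P → F ∈ cells
  inter_face : ∀ P ∈ cells, ∀ Q ∈ cells, (P ∩ Q).Nonempty → IsFace (P ∩ Q) P

/-- A polyhedral complex all of whose cells are cones with apex at the origin. -/
def PolyhedralComplex.IsFan (F : PolyhedralComplex V) : Prop :=
  ∀ P ∈ F.cells, ∀ x ∈ P, ∀ t : ℝ, 0 ≤ t → t • x ∈ P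

variable (V) in
/-- A polyhedral complex of pure dimension `d` with rational weights on its `d`-dimensional cells.
The values of `weight` on other sets are irrelevant: they are never used. -/
structure WeightedComplex (d : ℕ) extends PolyhedralComplex V where
  pure_dim : ∀ P ∈ cells, (∀ Q ∈ cells, P ⊆ Q → Q = P) → polyDim P = d
  weight : Set V → ℚ

variable {d : ℕ}

open Classical in
/-- The cells of top dimension. -/
def WeightedComplex.maxCells (C : WeightedComplex V d) : Finset (Set V) :=
  {P ∈ C.cells | polyDim P = d}

/-- The support: the union of the maximal cells of nonzero weight. -/
def WeightedComplex.support (C : WeightedComplex V d) : Set V :=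
  {x | ∃ P ∈ C.maxCells, C.weight P ≠ 0 ∧ x ∈ P}

/-- The support is (the support of) a fan. -/
def WeightedComplex.SupportIsFan (C : WeightedComplex V d) : Prop :=
  ∃ F : PolyhedralComplex V, F.IsFan ∧ C.support = {x | ∃ P ∈ F.cells, x ∈ P}

/-- Equality of weighted polyhedral complexes, up to the choice of the polyhedral structure: the
supports agree, and maximal cells whose relative interiors meet have the same weight. -/
def WeightedComplex.Same [TopologicalSpace V] (C D : WeightedComplex V d) : Prop :=
  C.support = D.support ∧
    ∀ P ∈ C.maxCells, ∀ Q ∈ D.maxCells,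
      (intrinsicInterior ℝ P ∩ intrinsicInterior ℝ Q).Nonempty → C.weight P = D.weight Q

/-- All cells are `G`-rational with respect to the lattice `N`. -/
def WeightedComplex.IsRational (N : AddSubgroup V) (G : Set ℝ) (C : WeightedComplex V d) : Prop :=
  ∀ P ∈ C.cells, IsRationalPolyhedron N G P

/-- For a facet `τ` of `σ`: the vector `u` generates `N_σ` modulo `N_τ` and points from `τ`
into `σ`. -/
def IsLatticeNormal (N : AddSubgroup V) (τ σ : Set V) (u : V) : Prop :=
  cellLattice N σ = cellLattice N τ ⊔ AddSubgroup.zmultiples u ∧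
    ∃ x ∈ τ, ∃ ε : ℝ, 0 < ε ∧ x + ε • u ∈ σ

open Classical in
/-- The balancing condition: around each cell `τ` of codimension one, the weighted sum of the
lattice normal vectors of the maximal cells containing `τ` is parallel to `τ`. -/
def WeightedComplex.IsBalanced (N : AddSubgroup V) (C : WeightedComplex V d) : Prop :=
  ∀ τ ∈ C.cells, polyDim τ + 1 = d →
    ∃ u : Set V → V,
      (∀ σ ∈ C.maxCells, τ ⊆ σ → IsLatticeNormal N τ σ (u σ)) ∧
      ∑ σ ∈ C.maxCells with τ ⊆ σ, (C.weight σ : ℝ) • u σ ∈ vectorSpan ℝ τ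

/-- A tropical variety of pure dimension `d`: a balanced weighted `G`-rational polyhedral complex
of pure dimension `d`. -/
structure WeightedComplex.IsTropicalVariety (N : AddSubgroup V) (G : Set ℝ)
    (C : WeightedComplex V d) : Prop where
  rational : C.IsRational N G
  balanced : C.IsBalanced N

end Polyhedra

/-! ## Minkowski sums -/

section Minkowski

variable {V W : Type*} [AddCommGroup V] [Module ℝ V] [AddCommGroup W] [Module ℝ W] {d e : ℕ}

/-- The weight `m_{L(σ) + γ}` of the Minkowski sum of `L(σ)` and `γ`, where `σ` has dimension `d` and
weight `m`, and `γ` has dimension `e` and weight `m'`; here `L` is an injective linear map and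
`L(σ)` carries the weight of `σ`. -/
def minkowskiWeight (N : AddSubgroup W) (L : V →ₗ[ℝ] W) (d e : ℕ) (σ : Set V) (m : ℚ) (γ : Set W)
    (m' : ℚ) : ℚ :=
  if polyDim (L '' σ + γ) = d + e then
    m * m' * ((cellLattice N (L '' σ) ⊔ cellLattice N γ).relIndex
      (cellLattice N (L '' σ + γ)) : ℚ)
  else 0

open Classical in
/-- `C` is a weighted polyhedral complex of pure dimension `d + e` representing the Minkowski sum
`L(A) + B`: each sum `L(σ) + γ` of maximal cells that has the right dimension is a union of cells
of `C`, and the weight of a maximal cell `τ` of `C` is the sum of the weights `m_{L(σ) + γ}` of all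
`L(σ) + γ` that contain `τ`. (Sums `L(σ) + γ` of smaller dimension have weight zero, and cells of `C`
outside all sums get weight zero, so neither plays a role.) -/
def IsMinkowskiSum (N : AddSubgroup W) (L : V →ₗ[ℝ] W)
    (A : WeightedComplex V d) (B : WeightedComplex W e) (C : WeightedComplex W (d + e)) : Prop :=
  (∀ σ ∈ A.maxCells, ∀ γ ∈ B.maxCells, polyDim (L '' σ + γ) = d + e →
    L '' σ + γ = {x | ∃ τ ∈ C.cells, τ ⊆ L '' σ + γ ∧ x ∈ τ}) ∧
  ∀ τ ∈ C.maxCells, C.weight τ =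
    ∑ σ ∈ A.maxCells, ∑ γ ∈ B.maxCells,
      if τ ⊆ L '' σ + γ then
        minkowskiWeight N L d e σ (A.weight σ) γ (B.weight γ) else 0

end Minkowski

/-! ## The tropical projective torus -/

section Torus

/-- `ℝ^ι / ℝ (1, …, 1)`. -/
abbrev TropTorus (ι : Type*) : Type _ := (ι → ℝ) ⧸ Submodule.span ℝ {(1 : ι → ℝ)}

/-- The quotient map `ℝ^ι → ℝ^ι / ℝ (1, …, 1)`. -/
def toTorus (ι : Type*) : (ι → ℝ) →ₗ[ℝ] TropTorus ι := Submodule.mkQ _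

/-- The lattice of integer points of `ℝ^ι / ℝ (1, …, 1)`: the image of `ℤ^ι`. -/
def intLattice (ι : Type*) : AddSubgroup (TropTorus ι) :=
  ((toTorus ι).toAddMonoidHom.comp ((Int.castAddHom ℝ).compLeft ι)).range

/-- The index set of the Plücker coordinates on the Grassmannian of `k`-dimensional linear
subspaces of `ℙ^n`. -/
abbrev PluckerIndex (k n : ℕ) : Type := {I : Finset (Fin (n + 1)) // I.card = k + 1}

/-- The linear map `(a_i)_i ↦ (∑_{i ∈ I} a_i)_I`, before passing to the quotients. -/
def phiLift (k n : ℕ) : (Fin (n + 1) → ℝ) →ₗ[ℝ] (PluckerIndex k n → ℝ) :=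
  LinearMap.pi fun I => ∑ i ∈ I.1, LinearMap.proj i

theorem span_one_le_comap_phiLift (k n : ℕ) :
    Submodule.span ℝ {(1 : Fin (n + 1) → ℝ)} ≤
      (Submodule.span ℝ {(1 : PluckerIndex k n → ℝ)}).comap (phiLift k n) := by
  rw [Submodule.span_le, Set.singleton_subset_iff]
  refine Submodule.mem_span_singleton.2 ⟨(k + 1 : ℝ), ?_⟩
  funext I
  simp [phiLift, I.2]

/-- The linear map `φ : ℝ^{n+1}/ℝ → ℝ^N/ℝ`, `(a_i)_i ↦ (∑_{i ∈ I} a_i)_I`. -/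
def phi (k n : ℕ) : TropTorus (Fin (n + 1)) →ₗ[ℝ] TropTorus (PluckerIndex k n) :=
  Submodule.mapQ _ _ (phiLift k n) (span_one_le_comap_phiLift k n)

end Torus

/-! ## Tropicalization -/

section Tropicalization

variable {K : Type*} [Field K] (v : AddValuation K (WithTop ℝ)) {ι : Type*} [Fintype ι]

/-- The valuation of a nonzero element as a real number. -/
def realVal (x : K) : ℝ := (v x).untopD 0

/-- The value group `Γ_val`. -/
def valueGroup : Set ℝ := {c | ∃ x : K, v x = (c : WithTop ℝ)}

/-- The valuation ring `{x | 0 ≤ v x}`. -/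
def valRing : ValuationSubring K := (AddValuation.toValuation v).valuationSubring

/-- The residue field of the valuation. -/
abbrev ResField : Type _ := IsLocalRing.ResidueField (valRing v)

/-- `w` lies on the tropical hypersurface of `f`: the minimum of `val(c_u) + ⟨u, w⟩` over the terms
`c_u x^u` of `f` is attained at least twice. -/
def OnTropHypersurface (f : MvPolynomial ι K) (w : ι → ℝ) : Prop :=
  ∀ u ∈ f.support,
    (∀ u' ∈ f.support, realVal v (f.coeff u) + ∑ i, (u i : ℝ) * w i ≤
      realVal v (f.coeff u') + ∑ i, (u' i : ℝ) * w i) →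
    ∃ u' ∈ f.support, u' ≠ u ∧
      realVal v (f.coeff u') + ∑ i, (u' i : ℝ) * w i =
        realVal v (f.coeff u) + ∑ i, (u i : ℝ) * w i

/-- The support of the tropicalization, in `ℝ^ι/ℝ`, of a subvariety of the torus of projective
space, given by the cone `X ⊆ (K^*)^ι` over it: the intersection of the tropical hypersurfaces of
all polynomials vanishing on `X`. -/
def tropSet (X : Set (ι → K)) : Set (TropTorus ι) :=
  toTorus ι '' {w | ∀ f ∈ MvPolynomial.vanishingIdeal K X, OnTropHypersurface v f w}

/-- The ideal of the initial degeneration of `X` at the point `val(y)`, for `y ∈ (K^*)^ι`: the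
reductions, modulo the maximal ideal, of the polynomials with coefficients in the valuation ring that
vanish on `y⁻¹ X`. -/
def initialIdeal (X : Set (ι → K)) (y : ι → Kˣ) : Ideal (MvPolynomial ι (ResField v)) :=
  ((MvPolynomial.vanishingIdeal K {x : ι → K | (fun i => (y i : K) * x i) ∈ X}).comap
    (MvPolynomial.map (algebraMap (valRing v) K))).map
      (MvPolynomial.map (IsLocalRing.residue (valRing v)))

/-- The number of irreducible components, counted with multiplicity, of the part in the torus of the
scheme defined by `J`: the sum of the lengths of the local rings of `A ⧸ J`, where `A` is the polynomial
ring, at those minimal primes of `J` that contain no variable. -/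
def torusMultiplicity {k : Type*} [Field k] (J : Ideal (MvPolynomial ι k)) : ℕ :=
  ENat.toNat <| ∑ᶠ (P : PrimeSpectrum (MvPolynomial ι k))
    (_ : P.asIdeal ∈ J.minimalPrimes ∧ ∀ i, MvPolynomial.X i ∉ P.asIdeal),
    Module.length (Localization.AtPrime P.asIdeal)
      (Localization.AtPrime P.asIdeal ⧸
        J.map (algebraMap (MvPolynomial ι k) (Localization.AtPrime P.asIdeal)))

/-- `C` is the tropicalization of `X`, as a weighted polyhedral complex of pure dimension `d`: the
union of its cells is the tropicalization as a set, and the weight of a maximal cell is the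
multiplicity of the initial degenerations at the points of its relative interior with coordinates in
the value group. -/
def IsTropicalization (X : Set (ι → K)) {d : ℕ} (C : WeightedComplex (TropTorus ι) d) : Prop :=
  {w | ∃ P ∈ C.cells, w ∈ P} = tropSet v X ∧
    ∀ P ∈ C.maxCells, ∀ y : ι → Kˣ,
      toTorus ι (fun i => realVal v (y i : K)) ∈ intrinsicInterior ℝ P →
        C.weight P = torusMultiplicity (initialIdeal v X y)

end Tropicalization

/-! ## The tropical Chow hypersurface -/

section Chow

/-- The cone over the torus part of the variety `𝒢_u` of `k`-dimensional linear subspaces of `ℙ^n`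
through `u = [1 : … : 1]`: all Plücker vectors, with nonzero coordinates, of bases (the rows of `A`) of
linear subspaces containing `(1, …, 1)`. -/
def linearSpacesThroughUnit (K : Type*) [Field K] (k n : ℕ) : Set (PluckerIndex k n → K) :=
  {p | (∀ I, p I ≠ 0) ∧ ∃ A : Matrix (Fin (k + 1)) (Fin (n + 1)) K,
    LinearIndependent K A.row ∧ (1 : Fin (n + 1) → K) ∈ Submodule.span K (Set.range A.row) ∧
      ∀ I, p I = (A.submatrix id (I.1.orderEmbOfFin I.2)).det}

/-- `Z` is the tropical Chow hypersurface `Z_C = φ(C) + Γ_0` of `C`, where `Γ_0` is the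
tropicalization of `𝒢_u`, a variety of dimension `k (n - k)`. -/
def IsTropicalChowHypersurface {K : Type*} [Field K] (v : AddValuation K (WithTop ℝ)) {k n d : ℕ}
    (C : WeightedComplex (TropTorus (Fin (n + 1))) d)
    (Z : WeightedComplex (TropTorus (PluckerIndex k n)) (d + k * (n - k))) : Prop :=
  ∃ Γ₀ : WeightedComplex (TropTorus (PluckerIndex k n)) (k * (n - k)),
    IsTropicalization v (linearSpacesThroughUnit K k n) Γ₀ ∧
      IsMinkowskiSum (intLattice (PluckerIndex k n)) (phi k n) C Γ₀ Z

end Chow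

end TropicalChow

end

/-!
A tropical curve supported on a fan is determined by the weights of its rays, and the weights can be
read off from the tropical Chow hypersurface `Z = φ(Σ) + Γ₀` as follows.

**The summand `Γ₀`.** A Plücker vector of a line through `[1 : 1 : 1 : 1]` has the form
`p_ij = a_j - a_i`, so these vectors are cut out by the relations `p_ij - p_ik + p_jk = 0`. Hence
`Γ₀` is the space of ultrametrics on four points for the minimum convention: the points `w` such
that, in each triangle `i, j, k`, the minimum of `w_ij`, `w_ik`, `w_jk` is attained at least twice
(`toTorus_mem_tropSet`, in terms of `IsUltra`). Every initial degeneration at a relative interior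
point of a maximal cell is a linear space, and so all multiplicities are one
(`IsTropicalization.weight_eq_one`). The linear space parallel to `Γ₀` at such a point is determined
by the ties of the ultrametric (`tieSpace`, `vectorSpan_eq_tieSpace`).

**The crossing relation.** Suppose that `Σ` and `Σ'` have the same Chow hypersurface, and let `D` be
the difference of their weights, as a function of the points of `ℝ⁴/ℝ`. For almost every point `x` of
a three-dimensional linear space `T`, every cell of the polyhedral complexes involved that contains
`x` is parallel to `T`, if it has dimension three, and has `x` in its relative interior. The weights
of the two hypersurfaces at `x` are then sums over the points `p` of the two curves such that
`x - φ(p)` is an ultrametric, and their equality becomes `∑ D(p) ξ(p) = 0` with nonzero lattice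
indices `ξ(p)` (`CrossingRelation`, `ae_crossingRelation`). The lattice index is nonzero by
rationality, and depends only on `p` and on the ties of `x - φ(p)`.

**Isolating a weight.** Let `p₀ ≠ 0` have distinct coordinates `k` and `l`, and let `i, j` be the other
two indices. Take for `T` the space spanned by `φ(p₀)`, `φ(e_i)` and the basis vector `E_kl`. If
`φ(q) + s E_kl`, with `s > 0` and `q` in the plane of `p₀` and `e_i`, is an ultrametric with ties
parallel to `T`, then `q` is a nonpositive multiple of `e_i` (`ultra_walls`): otherwise the tie space
contains `E_ij`, which does not lie in `T`. Hence the points `p` in the crossing relation at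
`x = φ(α p₀ + β e_i) + s E_kl` are the points `α p₀ + β' e_i` with `D(p) ≠ 0` and `β' ≥ β`. When `β`
passes from a small negative number to a small positive one, exactly the term of `α p₀` disappears, so
`D(p₀) = 0` (`eq_zero_of_crossingRelation`). Equality of the weights at generic points gives equality of
the weighted complexes (`WeightedComplex.same_of_localWeight_eq`).
-/

open scoped Pointwise

noncomputable section

namespace TropicalChow

/-! ### Relative interiors of polyhedra and generic points -/

section RelCore

variable {V W : Type*} [AddCommGroup V] [Module ℝ V] [AddCommGroup W] [Module ℝ W]

/-- The relative interior of `P` in algebraic terms: the points of `P` from which one can move a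
little, inside `P`, along every direction of the affine span of `P`. -/
def relCore (P : Set V) : Set V :=
  {x | x ∈ P ∧ ∀ d ∈ vectorSpan ℝ P, ∃ ε > 0, ∀ t : ℝ, |t| ≤ ε → x + t • d ∈ P}

theorem IsPolyhedron.convex {P : Set V} (h : IsPolyhedron P) : Convex ℝ P := by
  obtain ⟨H, rfl⟩ := h
  have : {x : V | ∀ h ∈ H, h.1 x ≤ h.2} = ⋂ h ∈ H, {x | h.1 x ≤ h.2} := by
    ext; simp
  rw [this]
  exact convex_iInter₂ fun h _ => convex_halfSpace_le h.1.isLinear h.2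

theorem IsPolyhedron.isClosed_line {P : Set V} (h : IsPolyhedron P) (x d : V) :
    IsClosed {t : ℝ | x + t • d ∈ P} := by
  obtain ⟨H, rfl⟩ := h
  have : {t : ℝ | x + t • d ∈ {x : V | ∀ h ∈ H, h.1 x ≤ h.2}} =
      ⋂ h ∈ H, {t : ℝ | h.1 x + t * h.1 d ≤ h.2} := by
    ext; simp
  rw [this]
  exact isClosed_biInter fun h _ => isClosed_le (by fun_prop) continuous_const

theorem IsFace.subset {F P : Set V} (h : IsFace F P) : F ⊆ P := by
  obtain ⟨-, l, rfl⟩ := h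
  exact fun x hx => hx.1

theorem IsFace.eq_of_mem_relCore {F P : Set V} (h : IsFace F P) {x : V} (hx : x ∈ F)
    (hc : x ∈ relCore P) : F = P := by
  refine h.subset.antisymm fun y hy => ?_
  obtain ⟨-, l, rfl⟩ := h
  refine ⟨hy, fun z hz => ?_⟩
  have hd : y - x ∈ vectorSpan ℝ P := vsub_mem_vectorSpan ℝ hy hc.1
  obtain ⟨ε, hε, hP⟩ := hc.2 _ hd
  have h1 := hx.2 _ (hP (-ε) (by simp [abs_of_pos hε]))
  have h2 := hx.2 _ hz
  simp only [map_add, map_smul, map_sub, smul_eq_mul] at h1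
  nlinarith

theorem IsFace.eq_of_finrank_eq [FiniteDimensional ℝ V] {F P : Set V} (h : IsFace F P)
    (hd : polyDim F = polyDim P) : F = P := by
  have hs : vectorSpan ℝ F = vectorSpan ℝ P :=
    Submodule.eq_of_le_of_finrank_eq (vectorSpan_mono ℝ h.subset) hd
  refine h.subset.antisymm fun y hy => ?_
  obtain ⟨⟨x, hx⟩, l, rfl⟩ := h
  have hle : vectorSpan ℝ {x | x ∈ P ∧ ∀ y ∈ P, l x ≤ l y} ≤ LinearMap.ker l := by
    rw [vectorSpan_def, Submodule.span_le]
    rintro _ ⟨a, ha, b, hb, rfl⟩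
    have := ha.2 _ hb.1
    have := hb.2 _ ha.1
    simp only [vsub_eq_sub, SetLike.mem_coe, LinearMap.mem_ker, map_sub]
    linarith
  have : y - x ∈ LinearMap.ker l := hle (hs ▸ vsub_mem_vectorSpan ℝ hy hx.1)
  rw [LinearMap.mem_ker, map_sub] at this
  refine ⟨hy, fun z hz => ?_⟩
  have := hx.2 z hz
  linarith

theorem PolyhedralComplex.subset_of_mem_relCore (C : PolyhedralComplex V) {P Q : Set V}
    (hP : P ∈ C.cells) (hQ : Q ∈ C.cells) {x : V} (hx : x ∈ relCore P) (hxQ : x ∈ Q) : P ⊆ Q := by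
  have := (C.inter_face P hP Q hQ ⟨x, hx.1, hxQ⟩).eq_of_mem_relCore ⟨hx.1, hxQ⟩ hx
  exact Set.inter_eq_left.1 this

/-- Two cells of the same dimension are equal if one contains a relative interior point of the
other. -/
theorem PolyhedralComplex.eq_of_mem_relCore [FiniteDimensional ℝ V] (C : PolyhedralComplex V)
    {P Q : Set V} (hP : P ∈ C.cells) (hQ : Q ∈ C.cells) (hd : polyDim P = polyDim Q) {x : V}
    (hx : x ∈ relCore P) (hxQ : x ∈ Q) : P = Q := by
  have hsub := C.subset_of_mem_relCore hP hQ hx hxQ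
  have hf := C.inter_face Q hQ P hP ⟨x, hxQ, hx.1⟩
  rw [Set.inter_eq_right.2 hsub] at hf
  exact hf.eq_of_finrank_eq hd

theorem PolyhedralComplex.exists_maximal (C : PolyhedralComplex V) {P : Set V}
    (hP : P ∈ C.cells) : ∃ Q ∈ C.cells, P ⊆ Q ∧ ∀ R ∈ C.cells, Q ⊆ R → R = Q := by
  obtain ⟨Q, hPQ, hQ⟩ := C.cells.exists_le_maximal hP
  exact ⟨Q, hQ.1, hPQ, fun R hR hQR => (hQ.2 hR hQR).antisymm hQR⟩

theorem WeightedComplex.mem_maxCells {d : ℕ} {C : WeightedComplex V d} {P : Set V} :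
    P ∈ C.maxCells ↔ P ∈ C.cells ∧ polyDim P = d := by
  simp [WeightedComplex.maxCells]

theorem WeightedComplex.exists_maxCell {d : ℕ} (C : WeightedComplex V d) {P : Set V}
    (hP : P ∈ C.cells) : ∃ Q ∈ C.maxCells, P ⊆ Q := by
  obtain ⟨Q, hQ, hPQ, hm⟩ := C.exists_maximal hP
  exact ⟨Q, mem_maxCells.2 ⟨hQ, C.pure_dim Q hQ fun R hR h => hm R hR h⟩, hPQ⟩

theorem intrinsicInterior_subset_relCore [TopologicalSpace V] [IsTopologicalAddGroup V]
    [ContinuousSMul ℝ V] (P : Set V) : intrinsicInterior ℝ P ⊆ relCore P := by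
  rintro _ ⟨⟨x, hxs⟩, hx, rfl⟩
  have hx' : x ∈ P := interior_subset (s := (Subtype.val ⁻¹' P : Set (affineSpan ℝ P))) hx
  refine ⟨hx', fun d hd => ?_⟩
  have hm : ∀ t : ℝ, x + t • d ∈ affineSpan ℝ P := fun t => by
    rw [add_comm]
    exact AffineSubspace.vadd_mem_of_mem_direction
      (by rw [direction_affineSpan]; exact Submodule.smul_mem _ _ hd) hxs
  have hc : Continuous fun t : ℝ => (⟨x + t • d, hm t⟩ : affineSpan ℝ P) := by fun_prop
  have h0 : (⟨x + (0 : ℝ) • d, hm 0⟩ : affineSpan ℝ P) ∈ interior (Subtype.val ⁻¹' P) := by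
    simpa using hx
  have := hc.continuousAt.preimage_mem_nhds (isOpen_interior.mem_nhds h0)
  obtain ⟨ε, hε, hb⟩ := Metric.mem_nhds_iff.1 this
  refine ⟨ε / 2, by positivity, fun t ht => ?_⟩
  have : t ∈ Metric.ball (0 : ℝ) ε := by
    rw [Metric.mem_ball, Real.dist_eq, sub_zero]; linarith
  exact interior_subset (s := (Subtype.val ⁻¹' P : Set (affineSpan ℝ P))) (hb this)

theorem IsPolyhedron.relCore_subset_intrinsicInterior [TopologicalSpace V]
    (hcont : ∀ l : V →ₗ[ℝ] ℝ, Continuous l) {P : Set V} (hP : IsPolyhedron P) :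
    relCore P ⊆ intrinsicInterior ℝ P := by
  intro x hx
  obtain ⟨H, hH⟩ := hP
  refine ⟨⟨x, mem_affineSpan ℝ hx.1⟩, ?_, rfl⟩
  rw [mem_interior_iff_mem_nhds]
  have key : ∀ h ∈ H, ∀ᶠ y : affineSpan ℝ P in nhds ⟨x, mem_affineSpan ℝ hx.1⟩,
      h.1 (y : V) ≤ h.2 := by
    intro h hh
    have hle : ∀ y ∈ P, h.1 y ≤ h.2 := fun y hy => by rw [hH] at hy; exact hy h hh
    rcases (hle x hx.1).lt_or_eq with hlt | heq
    · have hc : Continuous fun y : affineSpan ℝ P => h.1 (y : V) :=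
        (hcont h.1).comp continuous_subtype_val
      filter_upwards [hc.continuousAt.eventually_lt continuousAt_const hlt] with y hy using hy.le
    · refine Filter.Eventually.of_forall fun y => ?_
      have hd : (y : V) - x ∈ vectorSpan ℝ P := by
        rw [← direction_affineSpan]
        exact AffineSubspace.vsub_mem_direction y.2 (mem_affineSpan ℝ hx.1)
      obtain ⟨ε, hε, hb⟩ := hx.2 _ hd
      have h1 := hle _ (hb ε (abs_of_pos hε).le)
      simp only [map_add, map_smul, map_sub, smul_eq_mul] at h1
      nlinarith
  filter_upwards [(Filter.eventually_all_finset H).2 key] with y hy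
  change (y : V) ∈ P
  exact hH.symm.subset hy

theorem relCore_eq_of_finrank_le [FiniteDimensional ℝ V] {P : Set V} {T : Submodule ℝ V} {x : V}
    (hx : x ∈ P) (hT : ∀ d ∈ T, ∃ ε > 0, ∀ t : ℝ, |t| ≤ ε → x + t • d ∈ P)
    (hle : Module.finrank ℝ (vectorSpan ℝ P) ≤ Module.finrank ℝ T) :
    vectorSpan ℝ P = T ∧ x ∈ relCore P := by
  have h : T ≤ vectorSpan ℝ P := by
    intro d hd
    obtain ⟨ε, hε, hb⟩ := hT d hd
    have := vsub_mem_vectorSpan ℝ (hb ε (abs_of_pos hε).le) hx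
    simp only [vsub_eq_sub, add_sub_cancel_left] at this
    exact (Submodule.smul_mem_iff _ hε.ne').1 this
  have he := Submodule.eq_of_le_of_finrank_le h hle
  exact ⟨he.symm, hx, fun d hd => hT d (he ▸ hd)⟩

theorem vectorSpan_add_eq_sup {A B : Set V} (hA : A.Nonempty) (hB : B.Nonempty) :
    vectorSpan ℝ (A + B) = vectorSpan ℝ A ⊔ vectorSpan ℝ B := by
  obtain ⟨a, ha⟩ := hA
  obtain ⟨b, hb⟩ := hB
  apply le_antisymm
  · rw [vectorSpan_def, Submodule.span_le]
    rintro _ ⟨_, ⟨a₁, h₁, b₁, h₂, rfl⟩, _, ⟨a₂, h₃, b₂, h₄, rfl⟩, rfl⟩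
    have : (a₁ + b₁) -ᵥ (a₂ + b₂) = (a₁ -ᵥ a₂) + (b₁ -ᵥ b₂) := by
      simp only [vsub_eq_sub]; abel
    change (a₁ + b₁) -ᵥ (a₂ + b₂) ∈ _
    rw [this]
    exact Submodule.add_mem_sup (vsub_mem_vectorSpan ℝ h₁ h₃) (vsub_mem_vectorSpan ℝ h₂ h₄)
  · refine sup_le ?_ ?_
    · rw [vectorSpan_def, Submodule.span_le]
      rintro _ ⟨a₁, h₁, a₂, h₂, rfl⟩
      have := vsub_mem_vectorSpan ℝ (Set.add_mem_add h₁ hb) (Set.add_mem_add h₂ hb)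
      simpa using this
    · rw [vectorSpan_def, Submodule.span_le]
      rintro _ ⟨b₁, h₁, b₂, h₂, rfl⟩
      have := vsub_mem_vectorSpan ℝ (Set.add_mem_add ha h₁) (Set.add_mem_add ha h₂)
      simpa using this

theorem vectorSpan_image_linearMap (L : V →ₗ[ℝ] W) (A : Set V) :
    vectorSpan ℝ (L '' A) = (vectorSpan ℝ A).map L :=
  L.toAffineMap.map_vectorSpan.symm

/-- Since the frontier of a convex set is a null set, almost every point of a parametrized affine
space that lies in a convex set `P` can be moved inside `P` in all directions of that space. -/
theorem ae_forall_convex_movable {E : Type*} [NormedAddCommGroup E] [NormedSpace ℝ E]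
    [MeasurableSpace E] [BorelSpace E] [FiniteDimensional ℝ E] (μ : MeasureTheory.Measure E)
    [μ.IsAddHaarMeasure] (x₀ : V) (Ψ : E →ₗ[ℝ] V) {𝓕 : Set (Set V)} (hfin : 𝓕.Finite)
    (hconv : ∀ P ∈ 𝓕, Convex ℝ P) :
    ∀ᵐ z ∂μ, ∀ P ∈ 𝓕, x₀ + Ψ z ∈ P →
      ∀ d : E, ∃ ε > 0, ∀ t : ℝ, |t| ≤ ε → x₀ + Ψ z + t • Ψ d ∈ P := by
  rw [MeasureTheory.ae_ball_iff hfin.countable]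
  intro P hP
  set A : Set E := {z | x₀ + Ψ z ∈ P}
  have hA : Convex ℝ A := ((hconv P hP).translate_preimage_right x₀).linear_preimage Ψ
  have h0 : ∀ᵐ z ∂μ, z ∉ frontier A := by
    rw [MeasureTheory.ae_iff]
    simpa using hA.addHaar_frontier μ
  filter_upwards [h0] with z hz hzP d
  have hi : z ∈ interior A := by
    by_contra hi
    exact hz ⟨subset_closure hzP, hi⟩
  have hc : Continuous fun t : ℝ => z + t • d := by fun_prop
  have : (fun t : ℝ => z + t • d) ⁻¹' interior A ∈ nhds (0 : ℝ) :=
    hc.continuousAt.preimage_mem_nhds (isOpen_interior.mem_nhds (by simpa using hi))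
  obtain ⟨ε, hε, hb⟩ := Metric.mem_nhds_iff.1 this
  refine ⟨ε / 2, by positivity, fun t ht => ?_⟩
  have : t ∈ Metric.ball (0 : ℝ) ε := by
    rw [Metric.mem_ball, Real.dist_eq, sub_zero]; linarith
  have := interior_subset (hb this)
  simpa [A, add_assoc] using this

end RelCore

/-! ### Coordinates on the tropical tori -/

section Coordinates

variable {ι : Type*}

/-- The difference of two coordinates, as a functional on `ℝ^ι / ℝ`. -/
def coordDiff (i j : ι) : TropTorus ι →ₗ[ℝ] ℝ :=
  Submodule.liftQ _ ((LinearMap.proj i : (ι → ℝ) →ₗ[ℝ] ℝ) - LinearMap.proj j) <| by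
    rw [Submodule.span_le, Set.singleton_subset_iff, SetLike.mem_coe, LinearMap.mem_ker,
      LinearMap.sub_apply]
    simp

@[simp]
theorem coordDiff_toTorus (i j : ι) (w : ι → ℝ) : coordDiff i j (toTorus ι w) = w i - w j := by
  rfl

theorem toTorus_surjective : Function.Surjective (toTorus ι) := Submodule.mkQ_surjective _

theorem toTorus_eq_toTorus_iff {w w' : ι → ℝ} :
    toTorus ι w = toTorus ι w' ↔ ∃ c : ℝ, ∀ i, w i = w' i + c := by
  rw [toTorus, Submodule.mkQ_apply, Submodule.mkQ_apply, Submodule.Quotient.eq,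
    Submodule.mem_span_singleton]
  refine exists_congr fun c => ⟨fun h i => ?_, fun h => ?_⟩
  · have := congrFun h i
    simp at this
    linarith
  · funext i
    have := h i
    simp
    linarith

theorem toTorus_eq_zero_iff [Nonempty ι] {w : ι → ℝ} :
    toTorus ι w = 0 ↔ ∀ i j, w i = w j := by
  rw [← map_zero (toTorus ι), toTorus_eq_toTorus_iff]
  constructor
  · rintro ⟨c, h⟩ i j
    rw [h, h]; rfl
  · intro h
    exact ⟨w (Classical.arbitrary ι), fun i => by simp [h i (Classical.arbitrary ι)]⟩

theorem eq_zero_of_coordDiff [Nonempty ι] {x : TropTorus ι} (h : ∀ i j, coordDiff i j x = 0) :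
    x = 0 := by
  obtain ⟨w, rfl⟩ := toTorus_surjective x
  rw [toTorus_eq_zero_iff]
  intro i j
  have := h i j
  rw [coordDiff_toTorus] at this
  linarith

theorem coordDiff_mem_intLattice (i j : ι) {x : TropTorus ι} (hx : x ∈ intLattice ι) :
    ∃ z : ℤ, coordDiff i j x = z := by
  obtain ⟨w, rfl⟩ := hx
  exact ⟨w i - w j, by
    change coordDiff i j (toTorus ι fun i => (w i : ℝ)) = _
    simp⟩

theorem toTorus_mem_intLattice (w : ι → ℤ) : toTorus ι (fun i => (w i : ℝ)) ∈ intLattice ι :=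
  ⟨w, rfl⟩

theorem continuous_linearMap_torus [Fintype ι] (l : TropTorus ι →ₗ[ℝ] ℝ) : Continuous l := by
  have h : Continuous (l ∘ₗ toTorus ι) := LinearMap.continuous_of_finiteDimensional _
  exact (Submodule.isQuotientMap_mkQ _).continuous_iff.2 h

end Coordinates

section Pairs

/-- The Plücker index `{i, j}`; only used for `i ≠ j`. -/
def pair (i j : Fin 4) : PluckerIndex 1 3 :=
  if h : i ≠ j then ⟨{i, j}, Finset.card_pair h⟩ else ⟨{0, 1}, rfl⟩

theorem pair_val {i j : Fin 4} (h : i ≠ j) : (pair i j).1 = {i, j} := by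
  simp [pair, h]

theorem pair_comm (i j : Fin 4) : pair i j = pair j i := by
  by_cases h : i = j
  · rw [h]
  · exact Subtype.ext (by rw [pair_val h, pair_val (Ne.symm h), Finset.pair_comm])

theorem exists_eq_pair (e : PluckerIndex 1 3) : ∃ i j, i ≠ j ∧ e = pair i j := by
  obtain ⟨i, j, h, he⟩ := Finset.card_eq_two.1 e.2
  exact ⟨i, j, h, Subtype.ext (by rw [pair_val h, he])⟩

theorem pair_inj {i j k l : Fin 4} (h : i ≠ j) (h' : k ≠ l) :
    pair i j = pair k l ↔ i = k ∧ j = l ∨ i = l ∧ j = k := by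
  rw [Subtype.ext_iff, pair_val h, pair_val h', ← Finset.coe_inj, Finset.coe_pair, Finset.coe_pair,
    Set.pair_eq_pair_iff]

theorem phi_toTorus (k n : ℕ) (a : Fin (n + 1) → ℝ) :
    phi k n (toTorus _ a) = toTorus _ (phiLift k n a) := rfl

theorem phiLift_pair (a : Fin 4 → ℝ) {i j : Fin 4} (h : i ≠ j) :
    phiLift 1 3 a (pair i j) = a i + a j := by
  simp [phiLift, pair_val h, Finset.sum_pair h]

/-- Every Plücker index is one of the six pairs listed with respect to a given ordering `π` of the
four indices. -/
theorem forall_pair_iff (π : Equiv.Perm (Fin 4)) {p : PluckerIndex 1 3 → Prop} :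
    (∀ e, p e) ↔ p (pair (π 0) (π 1)) ∧ p (pair (π 0) (π 2)) ∧ p (pair (π 0) (π 3)) ∧
      p (pair (π 1) (π 2)) ∧ p (pair (π 1) (π 3)) ∧ p (pair (π 2) (π 3)) := by
  refine ⟨fun h => by simp [h], fun ⟨h01, h02, h03, h12, h13, h23⟩ e => ?_⟩
  obtain ⟨i, j, hij, rfl⟩ := exists_eq_pair e
  obtain ⟨i, rfl⟩ := π.surjective i
  obtain ⟨j, rfl⟩ := π.surjective j
  fin_cases i <;> fin_cases j <;>
    first
    | assumption
    | exact absurd rfl hij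
    | (rw [pair_comm]; assumption)

theorem phi_injective : Function.Injective (phi 1 3) := by
  rw [injective_iff_map_eq_zero]
  intro x hx
  obtain ⟨a, rfl⟩ := toTorus_surjective x
  have : Nonempty (PluckerIndex 1 3) := ⟨pair 0 1⟩
  rw [phi_toTorus, toTorus_eq_zero_iff] at hx
  rw [toTorus_eq_zero_iff]
  have key : ∀ i j k : Fin 4, i ≠ j → i ≠ k → j ≠ k → a j = a k := fun i j k h1 h2 h3 => by
    have := hx (pair i j) (pair i k)
    rw [phiLift_pair _ h1, phiLift_pair _ h2] at this
    linarith
  intro j k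
  rcases eq_or_ne j k with rfl | h
  · rfl
  · obtain ⟨i, h1, h2⟩ : ∃ i : Fin 4, i ≠ j ∧ i ≠ k := by
      revert h; revert j k; decide
    exact key i j k h1 h2 h

end Pairs

/-! ### Ultrametrics on four points -/

section Ultrametric

/-- The smallest of three real numbers is attained at least twice. -/
def MinTwice (x y z : ℝ) : Prop :=
  (y ≤ x ∨ z ≤ x) ∧ (x ≤ y ∨ z ≤ y) ∧ (x ≤ z ∨ y ≤ z)

/-- `w` is an ultrametric (for the minimum convention) on the four indices: in each triangle, the
minimum is attained at least twice. -/
def IsUltra (w : PluckerIndex 1 3 → ℝ) : Prop :=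
  ∀ i j k : Fin 4, i ≠ j → i ≠ k → j ≠ k → MinTwice (w (pair i j)) (w (pair i k)) (w (pair j k))

theorem minTwice_of_triangles {f : Fin 4 → Fin 4 → ℝ} (hs : ∀ i j, f i j = f j i)
    (h1 : MinTwice (f 0 1) (f 0 2) (f 1 2)) (h2 : MinTwice (f 0 1) (f 0 3) (f 1 3))
    (h3 : MinTwice (f 0 2) (f 0 3) (f 2 3)) (h4 : MinTwice (f 1 2) (f 1 3) (f 2 3)) (i j k : Fin 4)
    (hij : i ≠ j) (hik : i ≠ k) (hjk : j ≠ k) : MinTwice (f i j) (f i k) (f j k) := by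
  have key : ∀ i j k : Fin 4, i < j → j < k → MinTwice (f i j) (f i k) (f j k) := by
    intro i j k hij hjk
    fin_cases i <;> fin_cases j <;> fin_cases k <;>
      first
      | exact absurd hij (by decide)
      | exact absurd hjk (by decide)
      | assumption
  have sw : ∀ {x y z}, MinTwice x y z → MinTwice y x z := fun ⟨a, b, c⟩ => ⟨b, a, c.symm⟩
  have sw' : ∀ {x y z}, MinTwice x y z → MinTwice x z y := fun ⟨a, b, c⟩ => ⟨a.symm, c, b⟩
  rcases lt_or_gt_of_ne hij with a | a <;> rcases lt_or_gt_of_ne hik with b | b <;>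
    rcases lt_or_gt_of_ne hjk with c | c
  · exact key i j k a c
  · rw [hs j k]; exact sw (key i k j b c)
  · omega
  · rw [hs i k, hs j k]; exact sw (sw' (key k i j b a))
  · rw [hs i j]; exact sw' (key j i k a b)
  · omega
  · rw [hs i j, hs i k]; exact sw' (sw (key j k i c b))
  · rw [hs i j, hs i k, hs j k]; exact sw' (sw (sw' (key k j i c a)))

/-- The inductive step of the ordering of an ultrametric space: the distances `x01`, `x02`, ... on four
points, where the first two points are at the largest distance and the first point is not closer to
the last one than to the third. -/
theorem ultra_order_aux {x01 x02 x03 x12 x13 x23 : ℝ} (m02 : x02 ≤ x01) (m03 : x03 ≤ x01)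
    (m12 : x12 ≤ x01) (m13 : x13 ≤ x01) (h1 : MinTwice x01 x02 x12) (h2 : MinTwice x01 x03 x13)
    (h3 : MinTwice x02 x03 x23) (hc : x03 ≤ x02) :
    x02 = min x01 x12 ∧ x13 = min x12 x23 ∧ x03 = min x01 x13 := by
  obtain ⟨-, h1b, h1c⟩ := h1
  obtain ⟨-, h2b, h2c⟩ := h2
  obtain ⟨-, h3b, h3c⟩ := h3
  have e1 : x02 = x12 := le_antisymm (h1c.elim (m02.trans ·) id) (h1b.elim (m12.trans ·) id)
  have e2 : x03 = x13 := le_antisymm (h2c.elim (m03.trans ·) id) (h2b.elim (m13.trans ·) id)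
  subst e1 e2
  rw [min_eq_right m02, min_eq_right m03]
  refine ⟨rfl, ?_, rfl⟩
  rcases h3b with h | h
  · have : x02 = x03 := le_antisymm h hc
    subst this
    exact (min_eq_left (h3c.elim id id)).symm
  · have : x03 = x23 := le_antisymm (h3c.elim (hc.trans ·) id) h
    rw [← this, min_eq_right hc]

theorem isUltra_iff (π : Equiv.Perm (Fin 4)) {w : PluckerIndex 1 3 → ℝ} :
    IsUltra w ↔
      MinTwice (w (pair (π 0) (π 1))) (w (pair (π 0) (π 2))) (w (pair (π 1) (π 2))) ∧
      MinTwice (w (pair (π 0) (π 1))) (w (pair (π 0) (π 3))) (w (pair (π 1) (π 3))) ∧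
      MinTwice (w (pair (π 0) (π 2))) (w (pair (π 0) (π 3))) (w (pair (π 2) (π 3))) ∧
      MinTwice (w (pair (π 1) (π 2))) (w (pair (π 1) (π 3))) (w (pair (π 2) (π 3))) := by
  constructor
  · intro h
    refine ⟨h _ _ _ ?_ ?_ ?_, h _ _ _ ?_ ?_ ?_, h _ _ _ ?_ ?_ ?_, h _ _ _ ?_ ?_ ?_⟩ <;>
      exact π.injective.ne (by decide)
  · rintro ⟨h1, h2, h3, h4⟩ i j k hij hik hjk
    obtain ⟨i, rfl⟩ := π.surjective i
    obtain ⟨j, rfl⟩ := π.surjective j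
    obtain ⟨k, rfl⟩ := π.surjective k
    exact minTwice_of_triangles (f := fun a b => w (pair (π a) (π b)))
      (fun a b => congrArg w (pair_comm _ _)) h1 h2 h3 h4 i j k (π.injective.ne_iff.1 hij)
      (π.injective.ne_iff.1 hik) (π.injective.ne_iff.1 hjk)

/-- The tie space of `x`: the vectors that keep all equalities `x_{ij} = x_{ik}`. At a generic
point of the space of ultrametrics it is the tangent space. -/
def tieSpace (x : TropTorus (PluckerIndex 1 3)) : Submodule ℝ (TropTorus (PluckerIndex 1 3)) :=
  ⨅ (i : Fin 4) (j : Fin 4) (k : Fin 4) (_ : i ≠ j ∧ i ≠ k ∧ j ≠ k)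
    (_ : coordDiff (pair i j) (pair i k) x = 0), LinearMap.ker (coordDiff (pair i j) (pair i k))

theorem mem_tieSpace {x h : TropTorus (PluckerIndex 1 3)} :
    h ∈ tieSpace x ↔ ∀ i j k : Fin 4, i ≠ j → i ≠ k → j ≠ k →
      coordDiff (pair i j) (pair i k) x = 0 → coordDiff (pair i j) (pair i k) h = 0 := by
  simp [tieSpace, Submodule.mem_iInf]

theorem toTorus_mem_tieSpace {w h : PluckerIndex 1 3 → ℝ} :
    toTorus _ h ∈ tieSpace (toTorus _ w) ↔ ∀ i j k : Fin 4, i ≠ j → i ≠ k → j ≠ k →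
      w (pair i j) = w (pair i k) → h (pair i j) = h (pair i k) := by
  simp [mem_tieSpace, sub_eq_zero]

/-- The four points of an ultrametric space can be ordered in such a way that every distance is the
minimum of the distances of consecutive points in between. -/
theorem IsUltra.exists_order {w : PluckerIndex 1 3 → ℝ} (h : IsUltra w) :
    ∃ π : Equiv.Perm (Fin 4),
      w (pair (π 0) (π 2)) = min (w (pair (π 0) (π 1))) (w (pair (π 1) (π 2))) ∧
      w (pair (π 1) (π 3)) = min (w (pair (π 1) (π 2))) (w (pair (π 2) (π 3))) ∧
      w (pair (π 0) (π 3)) = min (w (pair (π 0) (π 1))) (w (pair (π 1) (π 3))) := by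
  obtain ⟨e, -, he⟩ := Finset.exists_max_image (Finset.univ : Finset (PluckerIndex 1 3)) w
    ⟨pair 0 1, Finset.mem_univ _⟩
  obtain ⟨i, j, hij, rfl⟩ := exists_eq_pair e
  obtain ⟨π, hi, hj⟩ : ∃ π : Equiv.Perm (Fin 4), π 0 = i ∧ π 1 = j := by
    clear he; revert hij; revert i j; decide
  subst hi hj
  have hm := (forall_pair_iff π).1 fun e => he e (Finset.mem_univ e)
  obtain ⟨-, m02, m03, m12, m13, m23⟩ := hm
  obtain ⟨h1, h2, h3, h4⟩ := (isUltra_iff π).1 h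
  -- The two points at the largest distance come first; the order of the others depends on which of
  -- them is closer to that pair.
  by_cases hc : w (pair (π 0) (π 3)) ≤ w (pair (π 0) (π 2))
  · exact ⟨π, ultra_order_aux m02 m03 m12 m13 h1 h2 h3 hc⟩
  · refine ⟨(Equiv.swap 2 3).trans π, ultra_order_aux m03 m02 m13 m12 h2 h1 ?_ (not_le.1 hc).le⟩
    exact pair_comm (π 2) (π 3) ▸ ⟨h3.2.1, h3.1, h3.2.2.symm⟩

/-- The space of ultrametrics has dimension two. -/
theorem finrank_tieSpace_le {w : PluckerIndex 1 3 → ℝ} (h : IsUltra w) :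
    Module.finrank ℝ (tieSpace (toTorus _ w)) ≤ 2 := by
  obtain ⟨π, h02, h13, h03⟩ := h.exists_order
  let f : TropTorus (PluckerIndex 1 3) →ₗ[ℝ] ℝ × ℝ :=
    (coordDiff (pair (π 0) (π 1)) (pair (π 1) (π 2))).prod
      (coordDiff (pair (π 1) (π 2)) (pair (π 2) (π 3)))
  have hf : Function.Injective (f.domRestrict (tieSpace (toTorus _ w))) := by
    rw [injective_iff_map_eq_zero]
    rintro ⟨x, hx⟩ hfx
    obtain ⟨v, rfl⟩ := toTorus_surjective x
    rw [toTorus_mem_tieSpace] at hx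
    have hf1 : v (pair (π 0) (π 1)) = v (pair (π 1) (π 2)) :=
      sub_eq_zero.1 (congrArg Prod.fst hfx)
    have hf2 : v (pair (π 1) (π 2)) = v (pair (π 2) (π 3)) :=
      sub_eq_zero.1 (congrArg Prod.snd hfx)
    have n : ∀ a b : Fin 4, a ≠ b → π a ≠ π b := fun a b hab => π.injective.ne hab
    have c := fun a b => pair_comm (π a) (π b)
    have t := fun a b d (h1 : a ≠ b) (h2 : a ≠ d) (h3 : b ≠ d) =>
      hx (π a) (π b) (π d) (n _ _ h1) (n _ _ h2) (n _ _ h3)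
    have v02 : v (pair (π 0) (π 2)) = v (pair (π 0) (π 1)) := by
      rcases min_choice (w (pair (π 0) (π 1))) (w (pair (π 1) (π 2))) with hm | hm
      · exact t 0 2 1 (by decide) (by decide) (by decide) (h02.trans hm)
      · rw [hf1, c 0 2, c 1 2]
        refine t 2 0 1 (by decide) (by decide) (by decide) ?_
        rw [c 2 0, c 2 1, h02, hm]
    have v13 : v (pair (π 1) (π 3)) = v (pair (π 1) (π 2)) := by
      rcases min_choice (w (pair (π 1) (π 2))) (w (pair (π 2) (π 3))) with hm | hm
      · exact t 1 3 2 (by decide) (by decide) (by decide) (h13.trans hm)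
      · rw [hf2, c 1 3, c 2 3]
        refine t 3 1 2 (by decide) (by decide) (by decide) ?_
        rw [c 3 1, c 3 2, h13, hm]
    have v03 : v (pair (π 0) (π 3)) = v (pair (π 0) (π 1)) := by
      rcases min_choice (w (pair (π 0) (π 1))) (w (pair (π 1) (π 3))) with hm | hm
      · exact t 0 3 1 (by decide) (by decide) (by decide) (h03.trans hm)
      · rw [hf1, ← v13, c 0 3, c 1 3]
        refine t 3 0 1 (by decide) (by decide) (by decide) ?_
        rw [c 3 0, c 3 1, h03, hm]
    have hall : ∀ e, v e = v (pair (π 0) (π 1)) := by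
      rw [forall_pair_iff π]
      exact ⟨rfl, v02, v03, hf1.symm, v13.trans hf1.symm, (hf1.trans hf2).symm⟩
    ext
    have : Nonempty (PluckerIndex 1 3) := ⟨pair 0 1⟩
    exact toTorus_eq_zero_iff.2 fun e e' => (hall e).trans (hall e').symm
  have := LinearMap.finrank_le_finrank_of_injective hf
  simpa using this

theorem eq_of_minTwice_line {x y z a b c ε : ℝ} (hε : 0 < ε)
    (h : ∀ t : ℝ, |t| ≤ ε → MinTwice (x + t * a) (y + t * b) (z + t * c)) (hxy : x = y) :
    a = b := by
  subst hxy
  by_contra hab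
  have h0 := h 0 (by simp [hε.le])
  have hxz : x ≤ z := by
    unfold MinTwice at h0; simp at h0; tauto
  -- If `x < z`, then the first two terms differ for small `t > 0` and are smaller than the third.
  obtain ⟨t, ht, htε, hlt⟩ : ∃ t : ℝ, 0 < t ∧ t ≤ ε ∧
      (x = z ∨ x + t * a < z + t * c ∧ x + t * b < z + t * c) := by
    rcases hxz.eq_or_lt with h' | h'
    · exact ⟨ε, hε, le_rfl, Or.inl h'⟩
    · have hM : 0 < |a| + |b| + |c| + 1 := by positivity
      refine ⟨min ε ((z - x) / (2 * (|a| + |b| + |c| + 1))), ?_, min_le_left _ _, Or.inr ?_⟩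
      · have : 0 < z - x := by linarith
        positivity
      · set t := min ε ((z - x) / (2 * (|a| + |b| + |c| + 1)))
        have ht0 : 0 < t := by
          have : 0 < z - x := by linarith
          positivity
        have h1 : t * (|a| + |b| + |c| + 1) ≤ (z - x) / 2 := by
          have := min_le_right ε ((z - x) / (2 * (|a| + |b| + |c| + 1)))
          calc _ ≤ ((z - x) / (2 * (|a| + |b| + |c| + 1))) * (|a| + |b| + |c| + 1) := by gcongr
            _ = _ := by field_simp
        have h2 : t * (a - c) ≤ t * (|a| + |b| + |c| + 1) := by
          gcongr
          linarith [le_abs_self a, neg_abs_le c, abs_nonneg b]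
        have h3 : t * (b - c) ≤ t * (|a| + |b| + |c| + 1) := by
          gcongr
          linarith [le_abs_self b, neg_abs_le c, abs_nonneg a]
        constructor <;> linarith
  have h1 := h t (by rw [abs_of_pos ht]; exact htε)
  have h2 := h (-t) (by rw [abs_neg, abs_of_pos ht]; exact htε)
  have e1 : t * a ≤ t * b ↔ a ≤ b := mul_le_mul_iff_right₀ ht
  have e2 : t * b ≤ t * a ↔ b ≤ a := mul_le_mul_iff_right₀ ht
  have e3 : t * a ≤ t * c ↔ a ≤ c := mul_le_mul_iff_right₀ ht
  have e4 : t * c ≤ t * a ↔ c ≤ a := mul_le_mul_iff_right₀ ht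
  have e5 : t * c ≤ t * b ↔ c ≤ b := mul_le_mul_iff_right₀ ht
  have e6 : t * b ≤ t * c ↔ b ≤ c := mul_le_mul_iff_right₀ ht
  rcases hlt with rfl | ⟨hl1, hl2⟩
  · simp only [MinTwice, add_le_add_iff_left, neg_mul, neg_le_neg_iff, e1, e2, e3, e4, e5, e6]
      at h1 h2
    grind
  · unfold MinTwice at h1
    have : t * a ≠ t * b := fun h => hab (mul_left_cancel₀ ht.ne' h)
    grind

/-- A two-dimensional convex set of ultrametrics is tangent to the tie space at each of its relative
interior points. -/
theorem vectorSpan_eq_tieSpace {P : Set (TropTorus (PluckerIndex 1 3))}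
    (hP : ∀ w, toTorus _ w ∈ P → IsUltra w) (hdim : polyDim P = 2)
    {x : TropTorus (PluckerIndex 1 3)} (hx : x ∈ relCore P) : vectorSpan ℝ P = tieSpace x := by
  obtain ⟨w, rfl⟩ := toTorus_surjective x
  refine Submodule.eq_of_le_of_finrank_le (fun h hh => ?_) ?_
  · obtain ⟨ε, hε, hb⟩ := hx.2 h hh
    obtain ⟨v, rfl⟩ := toTorus_surjective h
    rw [toTorus_mem_tieSpace]
    intro i j k hij hik hjk hw
    refine eq_of_minTwice_line hε (fun t ht => ?_) hw (z := w (pair j k)) (c := v (pair j k))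
    have := hP (w + t • v) (by rw [map_add, map_smul]; exact hb t ht) i j k hij hik hjk
    simpa using this
  · change polyDim P = 2 at hdim
    rw [polyDim] at hdim
    rw [hdim]
    exact finrank_tieSpace_le (hP w hx.1)

end Ultrametric

/-! ### The value group and the variety of lines through the unit point -/

section Valuation

variable {K : Type*} [Field K] (v : AddValuation K (WithTop ℝ))

theorem coe_realVal {x : K} (hx : x ≠ 0) : ((realVal v x : ℝ) : WithTop ℝ) = v x := by
  have h : v x ≠ ⊤ := (AddValuation.ne_top_iff v).2 hx
  lift v x to ℝ using h with r hr
  simp [realVal, ← hr]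

theorem realVal_eq_of_eq {x : K} {c : ℝ} (h : v x = c) : realVal v x = c := by
  simp [realVal, h]

theorem realVal_mul {x y : K} (hx : x ≠ 0) (hy : y ≠ 0) :
    realVal v (x * y) = realVal v x + realVal v y := by
  apply realVal_eq_of_eq
  rw [AddValuation.map_mul, ← coe_realVal v hx, ← coe_realVal v hy, WithTop.coe_add]

theorem realVal_one : realVal v (1 : K) = 0 := realVal_eq_of_eq v (by simp)

theorem realVal_neg (x : K) : realVal v (-x) = realVal v x := by
  rw [realVal, AddValuation.map_neg, realVal]

theorem realVal_pow {x : K} (hx : x ≠ 0) (n : ℕ) : realVal v (x ^ n) = n * realVal v x := by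
  induction n with
  | zero => simp [realVal_one]
  | succ n ih => rw [pow_succ, realVal_mul v (pow_ne_zero _ hx) hx, ih]; push_cast; ring

theorem realVal_inv {x : K} (hx : x ≠ 0) : realVal v x⁻¹ = -realVal v x := by
  have := realVal_mul v hx (inv_ne_zero hx)
  rw [mul_inv_cancel₀ hx, realVal_one] at this
  linarith

theorem realVal_zpow {x : K} (hx : x ≠ 0) (n : ℤ) : realVal v (x ^ n) = n * realVal v x := by
  cases n with
  | ofNat n => simpa using realVal_pow v hx n
  | negSucc n =>
    rw [zpow_negSucc, realVal_inv v (pow_ne_zero _ hx), realVal_pow v hx]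
    push_cast; ring

theorem realVal_prod {α : Type*} (s : Finset α) (f : α → K) (hf : ∀ i ∈ s, f i ≠ 0) :
    realVal v (∏ i ∈ s, f i) = ∑ i ∈ s, realVal v (f i) := by
  classical
  induction s using Finset.induction_on with
  | empty => simp [realVal_one]
  | insert a s ha ih =>
    rw [Finset.prod_insert ha, Finset.sum_insert ha, realVal_mul v (hf a (by simp))
      (Finset.prod_ne_zero_iff.2 fun i hi => hf i (by simp [hi])),
      ih fun i hi => hf i (by simp [hi])]

theorem realVal_add_of_ne {x y : K} (hx : x ≠ 0) (hy : y ≠ 0) (h : realVal v x ≠ realVal v y) :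
    x + y ≠ 0 ∧ realVal v (x + y) = min (realVal v x) (realVal v y) := by
  have h' : v x ≠ v y := by
    rw [← coe_realVal v hx, ← coe_realVal v hy]
    exact fun e => h (WithTop.coe_injective e)
  have e : v (x + y) = ((min (realVal v x) (realVal v y) : ℝ) : WithTop ℝ) := by
    rw [AddValuation.map_add_of_distinct_val v h', ← coe_realVal v hx, ← coe_realVal v hy,
      WithTop.coe_min]
  refine ⟨fun h0 => ?_, realVal_eq_of_eq v e⟩
  rw [h0, AddValuation.map_zero] at e
  exact WithTop.top_ne_coe e

/-- The value group of a nontrivially valued algebraically closed field is dense, since it is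
divisible. -/
theorem dense_realVal [IsAlgClosed K] (hv : ∃ x : K, x ≠ 0 ∧ v x ≠ 0) :
    Dense (Set.range fun y : Kˣ => realVal v (y : K)) := by
  obtain ⟨x, hx, hvx⟩ := hv
  have hr : realVal v x ≠ 0 := fun h => hvx (by rw [← coe_realVal v hx, h]; rfl)
  have hq : Dense (Set.range fun q : ℚ => (q : ℝ) * realVal v x) := by
    have : Dense (Set.range ((↑) : ℚ → ℝ)) := Rat.denseRange_cast
    have h2 := (Homeomorph.mulRight₀ (realVal v x) hr).surjective.denseRange.dense_image
      (Homeomorph.mulRight₀ (realVal v x) hr).continuous this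
    rwa [← Set.range_comp] at h2
  refine hq.mono ?_
  rintro _ ⟨q, rfl⟩
  obtain ⟨z, hz⟩ := IsAlgClosed.exists_pow_nat_eq x q.den_pos
  have hz0 : z ≠ 0 := by
    rintro rfl
    rw [zero_pow q.den_ne_zero] at hz
    exact hx hz.symm
  refine ⟨Units.mk0 (z ^ q.num) (zpow_ne_zero _ hz0), ?_⟩
  have h1 := realVal_pow v hz0 q.den
  rw [hz] at h1
  simp only [Units.val_mk0, realVal_zpow v hz0, h1]
  rw [← mul_assoc]
  congr 1
  have := Rat.num_div_den q
  have h3 : (q : ℝ) = (q.num : ℝ) / (q.den : ℝ) := by exact_mod_cast this.symm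
  rw [h3, div_mul_cancel₀ _ (by exact_mod_cast q.den_ne_zero)]

end Valuation

section Lines

variable {K : Type*} [Field K]

theorem det_submatrix_pair (A : Matrix (Fin 2) (Fin 4) K) {i j : Fin 4} (h : i < j) :
    (A.submatrix id ((pair i j).1.orderEmbOfFin (pair i j).2)).det =
      A 0 i * A 1 j - A 0 j * A 1 i := by
  have hf : ![i, j] = ((pair i j).1.orderEmbOfFin (pair i j).2) := by
    refine Finset.orderEmbOfFin_unique _ (fun x => ?_) (fun a b hab => ?_)
    · rw [pair_val h.ne]
      fin_cases x <;> simp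
    · fin_cases a <;> fin_cases b <;> first | exact absurd hab (by decide) | exact h
  rw [← hf, Matrix.det_fin_two]
  simp

/-- The Plücker vectors of the lines through `[1 : 1 : 1 : 1]` and `[a₀ : a₁ : a₂ : a₃]` are the
vectors of differences `a_j - a_i`. -/
theorem mem_linearSpacesThroughUnit {p : PluckerIndex 1 3 → K} :
    p ∈ linearSpacesThroughUnit K 1 3 ↔
      (∀ e, p e ≠ 0) ∧ ∃ a : Fin 4 → K, ∀ i j, i < j → p (pair i j) = a j - a i := by
  constructor
  · rintro ⟨h0, A, -, h1, hA⟩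
    refine ⟨h0, ?_⟩
    have hrow : Set.range A.row = {A 0, A 1} := by
      ext x
      rw [Set.mem_range, Fin.exists_fin_two, Set.mem_insert_iff, Set.mem_singleton_iff]
      exact or_congr eq_comm eq_comm
    rw [hrow, Submodule.mem_span_pair] at h1
    obtain ⟨c, d, hcd⟩ := h1
    have hcd' : ∀ i, c * A 0 i + d * A 1 i = 1 := fun i => by simpa using congrFun hcd i
    have hp : ∀ i j, i < j → p (pair i j) = A 0 i * A 1 j - A 0 j * A 1 i := fun i j hij =>
      (hA _).trans (det_submatrix_pair A hij)
    by_cases hc : c = 0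
    · have hd : d ≠ 0 := by
        rintro rfl
        simpa [hc] using hcd' 0
      refine ⟨fun i => -(A 0 i / d), fun i j hij => ?_⟩
      have ei := hcd' i
      have ej := hcd' j
      rw [hp i j hij]
      field_simp
      rw [hc] at ei ej
      linear_combination A 0 i * ej - A 0 j * ei
    · refine ⟨fun i => A 1 i / c, fun i j hij => ?_⟩
      have ei := hcd' i
      have ej := hcd' j
      rw [hp i j hij]
      field_simp
      linear_combination A 1 j * ei - A 1 i * ej
  · rintro ⟨h0, a, ha⟩
    refine ⟨h0, Matrix.of ![1, a], ?_, ?_, ?_⟩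
    · have hr : (Matrix.of ![(1 : Fin 4 → K), a]).row = ![1, a] := rfl
      rw [hr, LinearIndependent.pair_iff]
      intro s t hst
      have e0 := congrFun hst 0
      have e1 := congrFun hst 1
      simp at e0 e1
      have hne : a 1 - a 0 ≠ 0 := ha 0 1 (by decide) ▸ h0 _
      have ht : t = 0 := by
        have : t * (a 1 - a 0) = 0 := by linear_combination e1 - e0
        exact (mul_eq_zero.1 this).resolve_right hne
      subst ht
      exact ⟨by simpa using e0, rfl⟩
    · exact Submodule.subset_span ⟨0, rfl⟩
    · intro e
      obtain ⟨i, j, hij, rfl⟩ := exists_eq_pair e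
      rcases lt_or_gt_of_ne hij with h | h
      · rw [det_submatrix_pair _ h, ha i j h]
        simp
      · rw [pair_comm, det_submatrix_pair _ h, ha j i h]
        simp

/-- The sign of the Plücker coordinate with index set `{i, j}` when read in the order `i, j`. -/
def pairSign (K : Type*) [Field K] (i j : Fin 4) : K := if i < j then 1 else -1

theorem pairSign_mul_self (i j : Fin 4) : pairSign K i j * pairSign K i j = 1 := by
  unfold pairSign; split <;> simp

theorem pairSign_ne_zero (i j : Fin 4) : pairSign K i j ≠ 0 := by
  unfold pairSign; split <;> simp

theorem apply_pair_eq_pairSign_mul {p : PluckerIndex 1 3 → K} {a : Fin 4 → K}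
    (ha : ∀ i j, i < j → p (pair i j) = a j - a i) {i j : Fin 4} (h : i ≠ j) :
    p (pair i j) = pairSign K i j * (a j - a i) := by
  rcases lt_or_gt_of_ne h with h' | h'
  · simp [pairSign, h', ha i j h']
  · rw [pair_comm, ha j i h']
    simp [pairSign, h'.not_gt]

end Lines

/-! ### The tropicalization consists of the ultrametrics -/

section Tropicalization

variable {K : Type*} [Field K] (v : AddValuation K (WithTop ℝ))

/-- On the tropical hypersurface of a linear form with coefficients of valuation zero, the minimum of
the coordinates that occur is attained twice. -/
theorem OnTropHypersurface.linear {ι : Type*} [Fintype ι] {s : Finset ι} {c : ι → K}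
    (hc : ∀ e ∈ s, c e ≠ 0 ∧ realVal v (c e) = 0) {w : ι → ℝ}
    (h : OnTropHypersurface v (∑ e ∈ s, MvPolynomial.C (c e) * MvPolynomial.X e) w) {e : ι}
    (he : e ∈ s) : ∃ e' ∈ s, e' ≠ e ∧ w e' ≤ w e := by
  classical
  set f := ∑ e ∈ s, MvPolynomial.C (c e) * (MvPolynomial.X e : MvPolynomial ι K)
  have hcoeff : ∀ u : ι →₀ ℕ, f.coeff u = ∑ e ∈ s, if Finsupp.single e 1 = u then c e else 0 := by
    intro u
    simp [f, MvPolynomial.coeff_sum, MvPolynomial.coeff_C_mul, MvPolynomial.coeff_X]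
  have hsingle : ∀ e ∈ s, f.coeff (Finsupp.single e 1) = c e := by
    intro e he
    rw [hcoeff, Finset.sum_eq_single e]
    · simp
    · intro b _ hb
      rw [if_neg]
      exact fun h => hb (Finsupp.single_left_injective one_ne_zero h)
    · exact fun h => absurd he h
  have hsupp : ∀ u, u ∈ f.support ↔ ∃ e ∈ s, u = Finsupp.single e 1 := by
    intro u
    constructor
    · intro hu
      rw [MvPolynomial.mem_support_iff, hcoeff] at hu
      obtain ⟨e, he, h0⟩ := Finset.exists_ne_zero_of_sum_ne_zero hu
      refine ⟨e, he, ?_⟩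
      by_contra hne
      exact h0 (if_neg fun h => hne h.symm)
    · rintro ⟨e, he, rfl⟩
      rw [MvPolynomial.mem_support_iff, hsingle e he]
      exact (hc e he).1
  have hval : ∀ e ∈ s, realVal v (f.coeff (Finsupp.single e 1)) +
      ∑ i, ((Finsupp.single e 1 : ι →₀ ℕ) i : ℝ) * w i = w e := by
    intro e he
    rw [hsingle e he, (hc e he).2, zero_add, Finset.sum_eq_single e]
    · simp
    · intro b _ hb
      simp [Finsupp.single_eq_of_ne hb]
    · simp
  by_contra! hcon
  obtain ⟨u', hu', hne, heq⟩ := h (Finsupp.single e 1) ((hsupp _).2 ⟨e, he, rfl⟩) (by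
    intro u' hu'
    obtain ⟨e', he', rfl⟩ := (hsupp _).1 hu'
    rw [hval e he, hval e' he']
    by_cases h' : e' = e
    · rw [h']
    · exact (hcon e' he' h').le)
  obtain ⟨e', he', rfl⟩ := (hsupp _).1 hu'
  rw [hval e he, hval e' he'] at heq
  have : e' ≠ e := fun h => hne (by rw [h])
  exact absurd heq (hcon e' he' this).ne'

theorem isUltra_of_forall_onTropHypersurface {w : PluckerIndex 1 3 → ℝ}
    (h : ∀ f ∈ MvPolynomial.vanishingIdeal K (linearSpacesThroughUnit K 1 3),
      OnTropHypersurface v f w) : IsUltra w := by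
  have key : ∀ i j k : Fin 4, i < j → j < k →
      MinTwice (w (pair i j)) (w (pair i k)) (w (pair j k)) := by
    intro i j k hij hjk
    have hik := hij.trans hjk
    have n1 : pair i j ≠ pair i k := fun e => by
      rcases (pair_inj hij.ne hik.ne).1 e with ⟨-, h⟩ | ⟨h, -⟩
      · exact hjk.ne h
      · exact hik.ne h
    have n2 : pair i j ≠ pair j k := fun e => by
      rcases (pair_inj hij.ne hjk.ne).1 e with ⟨h, -⟩ | ⟨h, -⟩
      · exact hij.ne h
      · exact hik.ne h
    have n3 : pair i k ≠ pair j k := fun e => by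
      rcases (pair_inj hik.ne hjk.ne).1 e with ⟨h, -⟩ | ⟨h, -⟩
      · exact hij.ne h
      · exact hik.ne h
    let s : Finset (PluckerIndex 1 3) := {pair i j, pair i k, pair j k}
    let c : PluckerIndex 1 3 → K := fun e => if e = pair i k then -1 else 1
    have hc : ∀ e ∈ s, c e ≠ 0 ∧ realVal v (c e) = 0 := by
      intro e _
      by_cases he : e = pair i k
      · simp [c, he, realVal_neg, realVal_one]
      · simp [c, he, realVal_one]
    have hf := h (∑ e ∈ s, MvPolynomial.C (c e) * MvPolynomial.X e) (by
      rw [MvPolynomial.mem_vanishingIdeal_iff]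
      intro p hp
      obtain ⟨-, a, ha⟩ := mem_linearSpacesThroughUnit.1 hp
      have hs : s = {pair i j, pair i k, pair j k} := rfl
      rw [hs, Finset.sum_insert (by simp [n1, n2]), Finset.sum_insert (by simp [n3]),
        Finset.sum_singleton]
      simp [c, n1, n3.symm, ha i j hij, ha i k hik, ha j k hjk])
    have h1 := hf.linear v hc (e := pair i j) (by simp [s])
    have h2 := hf.linear v hc (e := pair i k) (by simp [s])
    have h3 := hf.linear v hc (e := pair j k) (by simp [s])
    simp only [s, Finset.mem_insert, Finset.mem_singleton, exists_eq_or_imp, ne_eq, not_true,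
      false_and, false_or, exists_eq_left, n1, n2, n3, n1.symm, n2.symm, n3.symm, not_false_eq_true,
      true_and, or_false] at h1 h2 h3
    exact ⟨h1, h2, h3⟩
  have key' := (isUltra_iff (Equiv.refl (Fin 4)) (w := w)).2
  exact key' ⟨key 0 1 2 (by decide) (by decide), key 0 1 3 (by decide) (by decide),
    key 0 2 3 (by decide) (by decide), key 1 2 3 (by decide) (by decide)⟩

/-- Every ultrametric is approximated by valuations of points of the variety of lines through the
unit point: one chooses the differences of consecutive coordinates, in a suitable order, with
distinct valuations. -/
theorem IsUltra.exists_point_near [IsAlgClosed K] (hv : ∃ x : K, x ≠ 0 ∧ v x ≠ 0)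
    {w : PluckerIndex 1 3 → ℝ} (hw : IsUltra w) {ε : ℝ} (hε : 0 < ε) :
    ∃ p ∈ linearSpacesThroughUnit K 1 3, ∀ e, |realVal v (p e) - w e| < ε := by
  obtain ⟨π, h02, h13, h03⟩ := hw.exists_order
  have hd := dense_realVal v hv
  have approx : ∀ (c : ℝ) (s : Finset ℝ), ∃ t : Kˣ, |realVal v (t : K) - c| < ε ∧
      realVal v (t : K) ∉ s := by
    intro c s
    obtain ⟨r, hr, ⟨⟨t, rfl⟩, hts⟩⟩ := (hd.sdiff_finset s).exists_mem_open Metric.isOpen_ball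
      ⟨c, Metric.mem_ball_self (x := c) hε⟩ |>.imp fun r h => And.symm h
    exact ⟨t, by simpa [Real.dist_eq] using hr, hts⟩
  obtain ⟨t0, ht0, -⟩ := approx (w (pair (π 0) (π 1))) ∅
  obtain ⟨t1, ht1, hn1⟩ := approx (w (pair (π 1) (π 2))) {realVal v (t0 : K)}
  obtain ⟨t2, ht2, hn2⟩ := approx (w (pair (π 2) (π 3))) {realVal v (t0 : K), realVal v (t1 : K)}
  simp only [Finset.mem_insert, Finset.mem_singleton, not_or] at hn1 hn2
  obtain ⟨n01, e01⟩ := realVal_add_of_ne v t0.ne_zero t1.ne_zero (Ne.symm hn1)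
  obtain ⟨n12, e12⟩ := realVal_add_of_ne v t1.ne_zero t2.ne_zero (Ne.symm hn2.2)
  obtain ⟨n02, e02⟩ := realVal_add_of_ne v t0.ne_zero n12 (by
    rw [e12]
    rcases min_choice (realVal v (t1 : K)) (realVal v (t2 : K)) with h | h <;> rw [h]
    · exact Ne.symm hn1
    · exact Ne.symm hn2.1)
  let b : Fin 4 → K := ![0, t0, t0 + t1, t0 + t1 + t2]
  let a : Fin 4 → K := b ∘ π.symm
  let p : PluckerIndex 1 3 → K := fun e =>
    a (e.1.orderEmbOfFin e.2 1) - a (e.1.orderEmbOfFin e.2 0)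
  have hp : ∀ i j, i < j → p (pair i j) = a j - a i := by
    intro i j hij
    have := det_submatrix_pair (Matrix.of ![1, a]) hij
    rw [Matrix.det_fin_two] at this
    simpa using this
  have hpv : ∀ i j : Fin 4, i ≠ j → b j - b i ≠ 0 → p (pair (π i) (π j)) ≠ 0 ∧
      realVal v (p (pair (π i) (π j))) = realVal v (b j - b i) := by
    intro i j hij hb
    rw [apply_pair_eq_pairSign_mul hp (π.injective.ne hij)]
    simp only [a, Function.comp, Equiv.symm_apply_apply]
    unfold pairSign
    split
    · simpa using hb
    · rw [neg_one_mul, realVal_neg]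
      exact ⟨neg_ne_zero.2 hb, rfl⟩
  have c01 : b 1 - b 0 = t0 := by simp [b]
  have c12 : b 2 - b 1 = t1 := by simp [b]
  have c23 : b 3 - b 2 = t2 := by simp [b]
  have c02 : b 2 - b 0 = t0 + t1 := by simp [b]
  have c13 : b 3 - b 1 = t1 + t2 := by simp [b]; ring
  have c03 : b 3 - b 0 = t0 + (t1 + t2) := by simp [b]; ring
  obtain ⟨p01, q01⟩ := hpv 0 1 (by decide) (c01 ▸ t0.ne_zero)
  obtain ⟨p12, q12⟩ := hpv 1 2 (by decide) (c12 ▸ t1.ne_zero)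
  obtain ⟨p23, q23⟩ := hpv 2 3 (by decide) (c23 ▸ t2.ne_zero)
  obtain ⟨p02, q02⟩ := hpv 0 2 (by decide) (c02 ▸ n01)
  obtain ⟨p13, q13⟩ := hpv 1 3 (by decide) (c13 ▸ n12)
  obtain ⟨p03, q03⟩ := hpv 0 3 (by decide) (c03 ▸ n02)
  rw [c01] at q01
  rw [c12] at q12
  rw [c23] at q23
  rw [c02, e01] at q02
  rw [c13, e12] at q13
  rw [c03, e02, e12] at q03
  refine ⟨p, mem_linearSpacesThroughUnit.2
    ⟨(forall_pair_iff π).2 ⟨p01, p02, p03, p12, p13, p23⟩, a, hp⟩, ?_⟩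
  rw [forall_pair_iff π, q01, q02, q03, q12, q13, q23, h02, h03, h13]
  have hmin : ∀ {x y x' y' : ℝ}, |x - x'| < ε → |y - y'| < ε → |min x y - min x' y'| < ε :=
    fun h h' => (abs_min_sub_min_le_max _ _ _ _).trans_lt (max_lt h h')
  exact ⟨ht0, hmin ht0 ht1, hmin ht0 (hmin ht1 ht2), ht1, hmin ht1 ht2, ht2⟩

theorem IsUltra.onTropHypersurface [IsAlgClosed K] (hv : ∃ x : K, x ≠ 0 ∧ v x ≠ 0)
    {w : PluckerIndex 1 3 → ℝ} (hw : IsUltra w) {f : MvPolynomial (PluckerIndex 1 3) K}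
    (hf : f ∈ MvPolynomial.vanishingIdeal K (linearSpacesThroughUnit K 1 3)) :
    OnTropHypersurface v f w := by
  intro u hu hmin
  by_contra! hcon
  let F : (PluckerIndex 1 3 →₀ ℕ) → (PluckerIndex 1 3 → ℝ) → ℝ := fun u w =>
    realVal v (f.coeff u) + ∑ i, (u i : ℝ) * w i
  have hFc : ∀ u, Continuous (F u) := fun u => by fun_prop
  -- If only one term is minimal at `w`, the same holds near `w`, also at valuations of points.
  have hev : ∀ᶠ w' in nhds w, ∀ u' ∈ f.support.erase u, F u w' < F u' w' := by
    rw [Filter.eventually_all_finset]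
    intro u' hu'
    rw [Finset.mem_erase] at hu'
    refine (hFc u).continuousAt.eventually_lt (hFc u').continuousAt ?_
    exact lt_of_le_of_ne (hmin u' hu'.2) (Ne.symm (hcon u' hu'.2 hu'.1))
  obtain ⟨ε, hε, hball⟩ := Metric.eventually_nhds_iff.1 hev
  obtain ⟨p, hp, hpw⟩ := hw.exists_point_near v hv hε
  have hlt := hball (y := fun e => realVal v (p e)) (by
    rw [dist_pi_lt_iff hε]
    intro e
    rw [Real.dist_eq]
    exact hpw e)
  have hp0 := (mem_linearSpacesThroughUnit.1 hp).1
  let term : (PluckerIndex 1 3 →₀ ℕ) → K := fun u' => f.coeff u' * ∏ i, p i ^ u' i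
  have hterm : ∀ u' ∈ f.support, v (term u') = ((F u' fun e => realVal v (p e) : ℝ) : WithTop ℝ) := by
    intro u' hu'
    have h1 : f.coeff u' ≠ 0 := MvPolynomial.mem_support_iff.1 hu'
    have h2 : ∀ i ∈ Finset.univ, p i ^ u' i ≠ 0 := fun i _ => pow_ne_zero _ (hp0 i)
    have h3 : ∏ i, p i ^ u' i ≠ 0 := Finset.prod_ne_zero_iff.2 h2
    rw [← coe_realVal v (mul_ne_zero h1 h3), realVal_mul v h1 h3, realVal_prod v _ _ h2]
    simp only [realVal_pow v (hp0 _)]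
    rfl
  have hsum : term u + ∑ u' ∈ f.support.erase u, term u' = 0 := by
    rw [Finset.add_sum_erase _ _ hu]
    have := MvPolynomial.mem_vanishingIdeal_iff.1 hf p hp
    rwa [MvPolynomial.aeval_eq_eval, MvPolynomial.eval_eq'] at this
  have hbig : v (term u) < v (∑ u' ∈ f.support.erase u, term u') := by
    refine AddValuation.map_lt_sum v (by rw [hterm u hu]; exact WithTop.coe_ne_top) ?_
    intro u' hu'
    rw [hterm u hu, hterm u' (Finset.mem_of_mem_erase hu'), WithTop.coe_lt_coe]
    exact hlt u' hu'
  rw [eq_neg_of_add_eq_zero_left hsum, AddValuation.map_neg] at hbig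
  exact lt_irrefl _ hbig

/-- The tropicalization of the variety of lines through the unit point is the space of
ultrametrics. -/
theorem toTorus_mem_tropSet [IsAlgClosed K] (hv : ∃ x : K, x ≠ 0 ∧ v x ≠ 0)
    {w : PluckerIndex 1 3 → ℝ} :
    toTorus _ w ∈ tropSet v (linearSpacesThroughUnit K 1 3) ↔ IsUltra w := by
  constructor
  · rintro ⟨w', hw', heq⟩
    have hu := isUltra_of_forall_onTropHypersurface v hw'
    obtain ⟨c, hc⟩ := toTorus_eq_toTorus_iff.1 heq
    intro i j k hij hik hjk
    have := hu i j k hij hik hjk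
    simpa [MinTwice, hc] using this
  · exact fun h => ⟨w, fun f hf => h.onTropHypersurface v hv hf, rfl⟩

end Tropicalization

/-! ### The tropicalization has multiplicity one -/

section Multiplicity

/-- A prime ideal that contains no variable defines one component of the torus, of multiplicity
one. -/
theorem torusMultiplicity_eq_one {ι k : Type*} [Field k] (J : Ideal (MvPolynomial ι k))
    [hJ : J.IsPrime] (hX : ∀ i, MvPolynomial.X i ∉ J) : torusMultiplicity J = 1 := by
  have hlen : Module.length (Localization.AtPrime J) (Localization.AtPrime J ⧸
      J.map (algebraMap (MvPolynomial ι k) (Localization.AtPrime J))) = 1 := by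
    rw [Localization.AtPrime.map_eq_maximalIdeal]
    have : IsSimpleModule (Localization.AtPrime J) (Localization.AtPrime J ⧸
        IsLocalRing.maximalIdeal (Localization J.primeCompl)) :=
      isSimpleModule_iff_isCoatom.2 (Ideal.isMaximal_def.1 (IsLocalRing.maximalIdeal.isMaximal _))
    exact Module.length_eq_one _ _
  have hmin : J.minimalPrimes = {J} := Ideal.minimalPrimes_eq_subsingleton_self
  classical
  unfold torusMultiplicity
  rw [finsum_eq_single _ (⟨J, hJ⟩ : PrimeSpectrum (MvPolynomial ι k))]
  · rw [finsum_eq_if, if_pos ⟨by simp [hmin], hX⟩, hlen]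
    rfl
  · intro P hP
    rw [finsum_eq_if, if_neg]
    rintro ⟨h, -⟩
    rw [hmin] at h
    exact hP (PrimeSpectrum.ext h)

theorem aeval_map_map {ι κ O A : Type*} [CommRing O] [CommRing A] (j : O →+* A)
    (M : ι → MvPolynomial κ O) (g : MvPolynomial ι O) :
    MvPolynomial.aeval (fun e => MvPolynomial.map j (M e)) (MvPolynomial.map j g) =
      MvPolynomial.map j (MvPolynomial.aeval M g) := by
  induction g using MvPolynomial.induction_on with
  | C a => simp
  | add p q hp hq => simp only [map_add, hp, hq]
  | mul_X p e hp => simp only [map_mul, MvPolynomial.map_X, MvPolynomial.aeval_X, hp]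

/-- Let `X` be parametrized by a polynomial map with integral coefficients that has a coordinate
projection as a left inverse. Then the reduction of its ideal is the kernel of the reduced
parametrization: a polynomial in that kernel is the reduction of some `g`, and subtracting from `g`
its pullback under the parametrization, viewed in the chosen coordinates, gives a lift that vanishes
on `X`. -/
theorem map_comap_ker_aeval {ι κ O K k : Type*} [CommRing O] [CommRing K] [CommRing k]
    (i : O →+* K) (hi : Function.Injective i) (r : O →+* k) (hr : Function.Surjective r)
    (M : ι → MvPolynomial κ O) (f : κ → ι) (hf : ∀ c, M (f c) = MvPolynomial.X c) :
    ((RingHom.ker (MvPolynomial.aeval fun e => MvPolynomial.map i (M e) :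
        MvPolynomial ι K →ₐ[K] MvPolynomial κ K)).comap (MvPolynomial.map i)).map
        (MvPolynomial.map r) =
      RingHom.ker (MvPolynomial.aeval fun e => MvPolynomial.map r (M e) :
        MvPolynomial ι k →ₐ[k] MvPolynomial κ k) := by
  apply le_antisymm
  · rw [Ideal.map_le_iff_le_comap]
    intro g hg
    rw [Ideal.mem_comap, RingHom.mem_ker] at hg
    rw [Ideal.mem_comap, RingHom.mem_ker]
    have h0 : MvPolynomial.aeval M g = 0 := by
      apply MvPolynomial.map_injective i hi
      rw [map_zero, ← aeval_map_map]
      exact hg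
    exact (aeval_map_map r M g).trans (by rw [h0, map_zero])
  · intro h hh
    obtain ⟨g, rfl⟩ := MvPolynomial.map_surjective r hr h
    have hh0 : MvPolynomial.map r (MvPolynomial.aeval M g) = 0 := (aeval_map_map r M g).symm.trans hh
    set g' := g - MvPolynomial.rename f (MvPolynomial.aeval M g)
    have hsec : ∀ q : MvPolynomial κ O, MvPolynomial.aeval M (MvPolynomial.rename f q) = q := by
      intro q
      rw [MvPolynomial.aeval_rename]
      have : M ∘ f = MvPolynomial.X := funext hf
      rw [this, MvPolynomial.aeval_X_left, AlgHom.id_apply]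
    have hg' : MvPolynomial.aeval M g' = 0 := by
      rw [map_sub, hsec, sub_self]
    have hmem : g' ∈ (RingHom.ker (MvPolynomial.aeval fun e => MvPolynomial.map i (M e) :
        MvPolynomial ι K →ₐ[K] MvPolynomial κ K)).comap (MvPolynomial.map i) := by
      rw [Ideal.mem_comap, RingHom.mem_ker]
      exact (aeval_map_map i M g').trans (by rw [hg', map_zero])
    have := Ideal.mem_map_of_mem (MvPolynomial.map r) hmem
    rwa [map_sub, MvPolynomial.map_rename, hh0, map_zero, sub_zero] at this

variable {K : Type*} [Field K]

/-- The vector of differences `a_j - a_i`, for `i < j`. -/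
def diffVec (a : Fin 4 → K) (e : PluckerIndex 1 3) : K :=
  a (e.1.orderEmbOfFin e.2 1) - a (e.1.orderEmbOfFin e.2 0)

theorem diffVec_pair_of_lt (a : Fin 4 → K) {i j : Fin 4} (h : i < j) :
    diffVec a (pair i j) = a j - a i := by
  have := det_submatrix_pair (Matrix.of ![1, a]) h
  rw [Matrix.det_fin_two] at this
  simpa [diffVec] using this

theorem diffVec_pair (a : Fin 4 → K) {i j : Fin 4} (h : i ≠ j) :
    diffVec a (pair i j) = pairSign K i j * (a j - a i) :=
  apply_pair_eq_pairSign_mul (fun _ _ => diffVec_pair_of_lt a) h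

theorem mem_linearSpacesThroughUnit' {p : PluckerIndex 1 3 → K} :
    p ∈ linearSpacesThroughUnit K 1 3 ↔ (∀ e, p e ≠ 0) ∧ ∃ a : Fin 4 → K, p = diffVec a := by
  rw [mem_linearSpacesThroughUnit]
  refine and_congr_right fun _ => exists_congr fun a => ⟨fun h => ?_, fun h => ?_⟩
  · funext e
    obtain ⟨i, j, hij, rfl⟩ := exists_eq_pair e
    rw [apply_pair_eq_pairSign_mul h hij, diffVec_pair a hij]
  · subst h
    exact fun i j => diffVec_pair_of_lt a

/-- The three Plücker indices formed by consecutive indices in the ordering `π`. -/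
def pathEdge (π : Equiv.Perm (Fin 4)) (c : Fin 3) : PluckerIndex 1 3 :=
  pair (π c.castSucc) (π c.succ)

/-- The indicator function of the indices that come after the step `c` in the ordering `π`. -/
def afterStep (K : Type*) [Field K] (π : Equiv.Perm (Fin 4)) (c : Fin 3) (i : Fin 4) : K :=
  if c.castSucc < π.symm i then 1 else 0

/-- The coefficients of the parametrization of the variety of lines through the unit point, scaled
by `y⁻¹`, by its coordinates at the three consecutive pairs of the ordering `π`. -/
def pathCoeff (π : Equiv.Perm (Fin 4)) (y : PluckerIndex 1 3 → Kˣ) (e : PluckerIndex 1 3)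
    (c : Fin 3) : K :=
  (y e : K)⁻¹ * diffVec (afterStep K π c) e *
    (pairSign K (π c.castSucc) (π c.succ) * y (pathEdge π c))

variable (π : Equiv.Perm (Fin 4)) (y : PluckerIndex 1 3 → Kˣ)

theorem diffVec_afterStep (c : Fin 3) {i j : Fin 4} (h : i ≠ j) :
    diffVec (afterStep K π c) (pair (π i) (π j)) =
      pairSign K (π i) (π j) *
        ((if c.castSucc < j then 1 else 0) - (if c.castSucc < i then 1 else 0)) := by
  rw [diffVec_pair _ (π.injective.ne h)]
  simp [afterStep]

theorem pathCoeff_pathEdge (c c' : Fin 3) :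
    pathCoeff π y (pathEdge π c') c = if c' = c then 1 else 0 := by
  have hne : c'.castSucc ≠ c'.succ := (Fin.castSucc_lt_succ (i := c')).ne
  have key : ((if c.castSucc < c'.succ then 1 else 0) - (if c.castSucc < c'.castSucc then 1 else 0)
      : K) = if c' = c then 1 else 0 := by
    fin_cases c <;> fin_cases c' <;> simp [Fin.lt_def]
  have h1 : diffVec (afterStep K π c) (pathEdge π c') =
      pairSign K (π c'.castSucc) (π c'.succ) * if c' = c then 1 else 0 := by
    rw [pathEdge, diffVec_afterStep _ _ hne, key]
  rw [pathCoeff, h1]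
  split
  · next h =>
    subst h
    have h2 := pairSign_mul_self (K := K) (π c'.castSucc) (π c'.succ)
    have h3 := (y (pathEdge π c')).ne_zero
    field_simp
    linear_combination h2
  · simp

theorem diffVec_eq_sum (a : Fin 4 → K) (e : PluckerIndex 1 3) :
    diffVec a e = ∑ c : Fin 3, diffVec (afterStep K π c) e *
      (pairSign K (π c.castSucc) (π c.succ) * diffVec a (pathEdge π c)) := by
  have ha : ∀ i, a i = a (π 0) + ∑ c : Fin 3,
      afterStep K π c i * (a (π c.succ) - a (π c.castSucc)) := by
    intro i
    obtain ⟨j, rfl⟩ := π.surjective i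
    simp only [afterStep, Equiv.symm_apply_apply, Fin.sum_univ_three]
    fin_cases j <;> simp [Fin.lt_def]
  have hs : ∀ c : Fin 3, pairSign K (π c.castSucc) (π c.succ) * diffVec a (pathEdge π c) =
      a (π c.succ) - a (π c.castSucc) := by
    intro c
    rw [pathEdge, diffVec_pair _ (π.injective.ne (Fin.castSucc_lt_succ (i := c)).ne), ← mul_assoc,
      pairSign_mul_self, one_mul]
  simp only [hs]
  rw [diffVec, ha (e.1.orderEmbOfFin e.2 1), ha (e.1.orderEmbOfFin e.2 0)]
  simp only [diffVec, Fin.sum_univ_three]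
  ring

/-- The linear forms of the parametrization. -/
def pathForm {R : Type*} [CommRing R] (m : PluckerIndex 1 3 → Fin 3 → R) (e : PluckerIndex 1 3) :
    MvPolynomial (Fin 3) R :=
  ∑ c, MvPolynomial.C (m e c) * MvPolynomial.X c

theorem pathForm_ne_zero {R : Type*} [CommRing R] {m : PluckerIndex 1 3 → Fin 3 → R}
    {e : PluckerIndex 1 3} {c : Fin 3} (h : m e c ≠ 0) : pathForm m e ≠ 0 := by
  intro h0
  apply h
  have h1 := congrArg (MvPolynomial.eval (Pi.single c 1)) h0
  simpa [pathForm, Pi.single_apply] using h1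

theorem vanishingIdeal_scaled_eq_ker [Infinite K]
    (hne : ∀ e, ∃ c, pathCoeff π y e c ≠ 0) :
    MvPolynomial.vanishingIdeal K
        {x : PluckerIndex 1 3 → K | (fun i => (y i : K) * x i) ∈ linearSpacesThroughUnit K 1 3} =
      RingHom.ker (MvPolynomial.aeval (pathForm (pathCoeff π y)) :
        MvPolynomial (PluckerIndex 1 3) K →ₐ[K] MvPolynomial (Fin 3) K) := by
  have heval : ∀ (t : Fin 3 → K) (f : MvPolynomial (PluckerIndex 1 3) K),
      MvPolynomial.eval t (MvPolynomial.aeval (pathForm (pathCoeff π y)) f) =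
        MvPolynomial.eval (fun e => ∑ c, pathCoeff π y e c * t c) f := by
    intro t f
    induction f using MvPolynomial.induction_on with
    | C a => simp
    | add p q hp hq => simp only [map_add, hp, hq]
    | mul_X p e hp =>
      simp only [map_mul, MvPolynomial.aeval_X, MvPolynomial.eval_X, hp, pathForm, map_sum,
        MvPolynomial.eval_C]
  ext f
  rw [MvPolynomial.mem_vanishingIdeal_iff, RingHom.mem_ker]
  constructor
  · intro h
    have hprod : (MvPolynomial.aeval (pathForm (pathCoeff π y)) f) *
        ∏ e, pathForm (pathCoeff π y) e = 0 := by
      apply MvPolynomial.funext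
      intro t
      rw [map_mul, map_zero, map_prod, heval]
      by_cases h0 : ∀ e, MvPolynomial.eval t (pathForm (pathCoeff π y) e) ≠ 0
      · have he : ∀ e, MvPolynomial.eval t (pathForm (pathCoeff π y) e) =
            ∑ c, pathCoeff π y e c * t c := fun e => by simp [pathForm]
        have := h (fun e => ∑ c, pathCoeff π y e c * t c) (by
          refine mem_linearSpacesThroughUnit'.2
            ⟨fun e => mul_ne_zero (y e).ne_zero ((he e).symm.trans_ne (h0 e)),
              fun i => ∑ c, afterStep K π c i *
                (pairSign K (π c.castSucc) (π c.succ) * y (pathEdge π c) * t c), ?_⟩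
          funext e
          have hy := (y e).ne_zero
          simp only [diffVec, pathCoeff, Fin.sum_univ_three]
          field_simp
          ring)
        rw [MvPolynomial.aeval_eq_eval] at this
        exact mul_eq_zero_of_left this _
      · push Not at h0
        obtain ⟨e, he⟩ := h0
        rw [Finset.prod_eq_zero (Finset.mem_univ e) he, mul_zero]
    refine (mul_eq_zero.1 hprod).resolve_right (Finset.prod_ne_zero_iff.2 fun e _ => ?_)
    exact pathForm_ne_zero (hne e).choose_spec
  · intro h x hx
    obtain ⟨-, a, ha⟩ := mem_linearSpacesThroughUnit'.1 hx
    have hxe : x = fun e => ∑ c, pathCoeff π y e c * x (pathEdge π c) := by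
      funext e
      have hy := (y e).ne_zero
      have h1 : (y e : K) * x e = diffVec a e := congrFun ha e
      have h2 : ∀ c, diffVec a (pathEdge π c) = y (pathEdge π c) * x (pathEdge π c) :=
        fun c => (congrFun ha _).symm
      rw [diffVec_eq_sum π a e] at h1
      simp only [h2] at h1
      apply mul_left_cancel₀ hy
      rw [h1, Finset.mul_sum]
      refine Finset.sum_congr rfl fun c _ => ?_
      rw [pathCoeff]
      field_simp
    rw [hxe, MvPolynomial.aeval_eq_eval]
    exact (heval _ f).symm.trans (by rw [h, map_zero])

variable (v : AddValuation K (WithTop ℝ))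

theorem mem_valRing_of_realVal {x : K} (h : x = 0 ∨ 0 ≤ realVal v x) : x ∈ valRing v := by
  change (0 : WithTop ℝ) ≤ v x
  rcases h with rfl | h
  · simp
  · by_cases hx : x = 0
    · simp [hx]
    · rw [← coe_realVal v hx]
      exact_mod_cast h

theorem realVal_mul_pairSign (x : K) (i j : Fin 4) :
    realVal v (x * pairSign K i j) = realVal v x := by
  unfold pairSign
  split <;> simp [realVal_neg]

/-- The coefficients of the parametrization at consecutive pairs of the ordering of an ultrametric
are integral, and each coordinate has a coefficient of valuation zero. -/
theorem pathCoeff_integral {π : Equiv.Perm (Fin 4)} {y : PluckerIndex 1 3 → Kˣ}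
    {w : PluckerIndex 1 3 → ℝ} (hwy : ∀ e, w e = realVal v (y e : K))
    (h02 : w (pair (π 0) (π 2)) = min (w (pair (π 0) (π 1))) (w (pair (π 1) (π 2))))
    (h13 : w (pair (π 1) (π 3)) = min (w (pair (π 1) (π 2))) (w (pair (π 2) (π 3))))
    (h03 : w (pair (π 0) (π 3)) = min (w (pair (π 0) (π 1))) (w (pair (π 1) (π 3)))) :
    ∀ e, (∀ c, pathCoeff π y e c ∈ valRing v) ∧
      ∃ c, pathCoeff π y e c ≠ 0 ∧ realVal v (pathCoeff π y e c) = 0 := by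
  have hzero : ∀ (i j : Fin 4) (c : Fin 3), i < j → ¬(i ≤ c.castSucc ∧ c.castSucc < j) →
      pathCoeff π y (pair (π i) (π j)) c = 0 := by
    intro i j c hij hc
    rw [pathCoeff, diffVec_afterStep _ _ hij.ne]
    have : ((if c.castSucc < j then 1 else 0) - (if c.castSucc < i then 1 else 0) : K) = 0 := by
      split_ifs with h1 h2 h2
      · simp
      · exact absurd ⟨not_lt.1 h2, h1⟩ hc
      · exact absurd (h2.trans hij) h1
      · simp
    rw [this]
    ring
  have hval : ∀ (i j : Fin 4) (c : Fin 3), i ≤ c.castSucc → c.castSucc < j →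
      pathCoeff π y (pair (π i) (π j)) c ≠ 0 ∧
        realVal v (pathCoeff π y (pair (π i) (π j)) c) =
          w (pair (π c.castSucc) (π c.succ)) - w (pair (π i) (π j)) := by
    intro i j c hi hj
    have heq : pathCoeff π y (pair (π i) (π j)) c =
        (y (pair (π i) (π j)) : K)⁻¹ * y (pathEdge π c) * pairSign K (π i) (π j) *
          pairSign K (π c.castSucc) (π c.succ) := by
      rw [pathCoeff, diffVec_afterStep _ _ (hi.trans_lt hj).ne, if_pos hj, if_neg (not_lt.2 hi)]
      ring
    have n1 : (y (pair (π i) (π j)) : K)⁻¹ ≠ 0 := inv_ne_zero (Units.ne_zero _)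
    have n2 : (y (pathEdge π c) : K) ≠ 0 := Units.ne_zero _
    have n3 := mul_ne_zero (mul_ne_zero n1 n2) (pairSign_ne_zero (K := K) (π i) (π j))
    rw [heq]
    refine ⟨mul_ne_zero n3 (pairSign_ne_zero _ _), ?_⟩
    rw [realVal_mul_pairSign, realVal_mul_pairSign,
      realVal_mul v n1 n2, realVal_inv v (Units.ne_zero _), hwy, hwy, pathEdge]
    ring
  -- It suffices that `w` at a pair is at most its values at the consecutive pairs in between, with
  -- equality for one of them.
  have main : ∀ i j : Fin 4, i < j →
      (∀ c : Fin 3, i ≤ c.castSucc → c.castSucc < j →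
        w (pair (π i) (π j)) ≤ w (pair (π c.castSucc) (π c.succ))) →
      (∃ c : Fin 3, i ≤ c.castSucc ∧ c.castSucc < j ∧
        w (pair (π c.castSucc) (π c.succ)) = w (pair (π i) (π j))) →
      (∀ c, pathCoeff π y (pair (π i) (π j)) c ∈ valRing v) ∧
      ∃ c, pathCoeff π y (pair (π i) (π j)) c ≠ 0 ∧
        realVal v (pathCoeff π y (pair (π i) (π j)) c) = 0 := by
    rintro i j hij hle ⟨c, hc1, hc2, hc⟩
    refine ⟨fun c => mem_valRing_of_realVal v ?_, c, (hval i j c hc1 hc2).1, ?_⟩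
    · by_cases h : i ≤ c.castSucc ∧ c.castSucc < j
      · right
        rw [(hval i j c h.1 h.2).2]
        linarith [hle c h.1 h.2]
      · exact Or.inl (hzero i j c hij h)
    · rw [(hval i j c hc1 hc2).2, hc, sub_self]
  have hc0 : ∀ q : Fin 3 → Prop, q 0 → q 1 → q 2 → ∀ c, q c := fun q h0 h1 h2 c => by
    fin_cases c <;> assumption
  rw [forall_pair_iff π]
  refine ⟨main 0 1 (by decide) (hc0 _ ?_ ?_ ?_) ⟨0, by decide, by decide, rfl⟩,
    main 0 2 (by decide) (hc0 _ ?_ ?_ ?_) ?_, main 0 3 (by decide) (hc0 _ ?_ ?_ ?_) ?_,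
    main 1 2 (by decide) (hc0 _ ?_ ?_ ?_) ⟨1, by decide, by decide, rfl⟩,
    main 1 3 (by decide) (hc0 _ ?_ ?_ ?_) ?_,
    main 2 3 (by decide) (hc0 _ ?_ ?_ ?_) ⟨2, by decide, by decide, rfl⟩⟩
  · exact fun _ _ => le_rfl
  · exact fun _ h => absurd h (by decide)
  · exact fun _ h => absurd h (by decide)
  · exact fun _ _ => h02.trans_le (min_le_left _ _)
  · exact fun _ _ => h02.trans_le (min_le_right _ _)
  · exact fun _ h => absurd h (by decide)
  · rcases min_choice (w (pair (π 0) (π 1))) (w (pair (π 1) (π 2))) with h | h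
    · exact ⟨0, by decide, by decide, (h02.trans h).symm⟩
    · exact ⟨1, by decide, by decide, (h02.trans h).symm⟩
  · exact fun _ _ => h03.trans_le (min_le_left _ _)
  · exact fun _ _ => h03.trans_le ((min_le_right _ _).trans (h13.trans_le (min_le_left _ _)))
  · exact fun _ _ => h03.trans_le ((min_le_right _ _).trans (h13.trans_le (min_le_right _ _)))
  · rcases min_choice (w (pair (π 0) (π 1))) (w (pair (π 1) (π 3))) with h | h
    · exact ⟨0, by decide, by decide, (h03.trans h).symm⟩
    · rcases min_choice (w (pair (π 1) (π 2))) (w (pair (π 2) (π 3))) with h' | h'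
      · exact ⟨1, by decide, by decide, (h03.trans (h.trans (h13.trans h'))).symm⟩
      · exact ⟨2, by decide, by decide, (h03.trans (h.trans (h13.trans h'))).symm⟩
  · exact fun h _ => absurd h (by decide)
  · exact fun _ _ => le_rfl
  · exact fun _ h => absurd h (by decide)
  · exact fun h _ => absurd h (by decide)
  · exact fun _ _ => h13.trans_le (min_le_left _ _)
  · exact fun _ _ => h13.trans_le (min_le_right _ _)
  · rcases min_choice (w (pair (π 1) (π 2))) (w (pair (π 2) (π 3))) with h | h
    · exact ⟨1, by decide, by decide, (h13.trans h).symm⟩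
    · exact ⟨2, by decide, by decide, (h13.trans h).symm⟩
  · exact fun h _ => absurd h (by decide)
  · exact fun h _ => absurd h (by decide)
  · exact fun _ _ => le_rfl

/-- All initial degenerations of the variety of lines through the unit point at ultrametrics are
integral and reduced: they are linear spaces. -/
theorem torusMultiplicity_initialIdeal [Infinite K] {y : PluckerIndex 1 3 → Kˣ}
    (hy : IsUltra fun e => realVal v (y e : K)) :
    torusMultiplicity (initialIdeal v (linearSpacesThroughUnit K 1 3) y) = 1 := by
  obtain ⟨π, h02, h13, h03⟩ := hy.exists_order
  have hint := pathCoeff_integral v (π := π) (y := y) (fun _ => rfl) h02 h13 h03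
  let m : PluckerIndex 1 3 → Fin 3 → valRing v := fun e c => ⟨pathCoeff π y e c, (hint e).1 c⟩
  have hmap : ∀ {R : Type _} [CommRing R] (r : valRing v →+* R) (e : PluckerIndex 1 3),
      MvPolynomial.map r (pathForm m e) = pathForm (fun e c => r (m e c)) e := by
    intro R _ r e
    simp [pathForm]
  have hmapk : ∀ e : PluckerIndex 1 3,
      MvPolynomial.map (IsLocalRing.residue (valRing v)) (pathForm m e) =
        pathForm (fun e c => IsLocalRing.residue (valRing v) (m e c)) e := by
    intro e
    simp [pathForm]
  have hK : (fun e => MvPolynomial.map (algebraMap (valRing v) K) (pathForm m e)) =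
      pathForm (pathCoeff π y) := funext fun e => hmap (algebraMap (valRing v) K) e
  have hideal : initialIdeal v (linearSpacesThroughUnit K 1 3) y =
      RingHom.ker (MvPolynomial.aeval fun e =>
        MvPolynomial.map (IsLocalRing.residue (valRing v)) (pathForm m e) :
        MvPolynomial (PluckerIndex 1 3) (ResField v) →ₐ[ResField v]
          MvPolynomial (Fin 3) (ResField v)) := by
    rw [← map_comap_ker_aeval (algebraMap (valRing v) K) Subtype.val_injective
      (IsLocalRing.residue (valRing v)) IsLocalRing.residue_surjective (pathForm m) (pathEdge π) ?_,
      hK, initialIdeal, vanishingIdeal_scaled_eq_ker π y fun e => (hint e).2.imp fun c h => h.1]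
    intro c
    have hm : ∀ c', m (pathEdge π c) c' = if c = c' then 1 else 0 := by
      intro c'
      apply Subtype.ext
      change pathCoeff π y (pathEdge π c) c' = _
      rw [pathCoeff_pathEdge]
      split <;> rfl
    simp [pathForm, hm]
  have hprime : (initialIdeal v (linearSpacesThroughUnit K 1 3) y).IsPrime := by
    rw [hideal]
    exact RingHom.ker_isPrime _
  refine torusMultiplicity_eq_one _ fun e he => ?_
  rw [hideal, RingHom.mem_ker] at he
  obtain ⟨c, hc0, hc⟩ := (hint e).2
  have hres : IsLocalRing.residue (valRing v) (m e c) ≠ 0 := by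
    rw [IsLocalRing.residue_ne_zero_iff_isUnit]
    refine isUnit_iff_exists_inv.2 ⟨⟨(pathCoeff π y e c)⁻¹, mem_valRing_of_realVal v ?_⟩, ?_⟩
    · right
      rw [realVal_inv v hc0, hc, neg_zero]
    · exact Subtype.ext (mul_inv_cancel₀ hc0)
  refine pathForm_ne_zero (m := fun e c => IsLocalRing.residue (valRing v) (m e c)) hres ?_
  rw [← hmapk]
  simpa using he

/-- The cells of a tropicalization of the variety of lines through the unit point have weight one:
near each relative interior point there are points of the cell with coordinates in the value group,
obtained by rounding equal coordinates in the same way. -/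
theorem IsTropicalization.weight_eq_one [IsAlgClosed K] (hv : ∃ x : K, x ≠ 0 ∧ v x ≠ 0)
    {B : WeightedComplex (TropTorus (PluckerIndex 1 3)) 2}
    (hB : IsTropicalization v (linearSpacesThroughUnit K 1 3) B)
    {P : Set (TropTorus (PluckerIndex 1 3))} (hP : P ∈ B.maxCells)
    {x : TropTorus (PluckerIndex 1 3)} (hx : x ∈ relCore P) : B.weight P = 1 := by
  have hPc := WeightedComplex.mem_maxCells.1 hP
  have hultra : ∀ w, toTorus _ w ∈ P → IsUltra w := fun w hw =>
    (toTorus_mem_tropSet v hv).1 (hB.1.subset ⟨P, hPc.1, hw⟩)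
  obtain ⟨g, rfl⟩ := toTorus_surjective x
  have hspan := vectorSpan_eq_tieSpace hultra hPc.2 hx
  have hint := (B.isPolyhedron P hPc.1).relCore_subset_intrinsicInterior continuous_linearMap_torus hx
  obtain ⟨⟨x', hx'⟩, hxi, hxe⟩ := hint
  simp only at hxe
  subst hxe
  obtain ⟨U, hU, hUP⟩ := isOpen_induced_iff.1 (isOpen_interior (s := (Subtype.val ⁻¹' P : Set (affineSpan ℝ P))))
  have hcont : Continuous (toTorus (PluckerIndex 1 3)) := continuous_quot_mk
  obtain ⟨ε, hε, hball⟩ := Metric.mem_nhds_iff.1 (hcont.continuousAt.preimage_mem_nhds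
    (hU.mem_nhds (hUP.symm.subset hxi)))
  have hd := dense_realVal v hv
  have happ : ∀ r : ℝ, ∃ t : Kˣ, dist (realVal v (t : K)) r < ε := by
    intro r
    obtain ⟨_, ⟨t, rfl⟩, ht⟩ := hd.exists_dist_lt r hε
    exact ⟨t, by rw [dist_comm]; exact ht⟩
  choose t ht using happ
  set y : PluckerIndex 1 3 → Kˣ := fun e => t (g e)
  set w : PluckerIndex 1 3 → ℝ := fun e => realVal v (y e : K)
  have hwU : toTorus _ w ∈ U := hball (by
    rw [Metric.mem_ball, dist_pi_lt_iff hε]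
    exact fun e => ht (g e))
  have hwaff : toTorus _ w ∈ affineSpan ℝ P := by
    have h1 : toTorus _ w - toTorus _ g ∈ vectorSpan ℝ P := by
      rw [hspan, ← map_sub, toTorus_mem_tieSpace]
      intro i j k _ _ _ h
      simp [w, y, h]
    have h2 := AffineSubspace.vadd_mem_of_mem_direction
      (by rw [direction_affineSpan]; exact h1) (mem_affineSpan ℝ hx.1)
    simpa using h2
  have hwint : toTorus _ w ∈ intrinsicInterior ℝ P :=
    ⟨⟨toTorus _ w, hwaff⟩, hUP.subset hwU, rfl⟩
  rw [hB.2 P hP y hwint, torusMultiplicity_initialIdeal v (hultra w (intrinsicInterior_subset hwint))]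
  simp

end Multiplicity

/-! ### Minkowski sums near generic points -/

section Generic

variable {V W : Type*} [AddCommGroup V] [Module ℝ V] [AddCommGroup W] [Module ℝ W]

/-- If `x ∈ P`, then `x` can be moved a little inside `P` along all directions in `T`. -/
def Movable (T : Submodule ℝ W) (x : W) (P : Set W) : Prop :=
  x ∈ P → ∀ d ∈ T, ∃ ε > 0, ∀ t : ℝ, |t| ≤ ε → x + t • d ∈ P

theorem Movable.le_vectorSpan {T : Submodule ℝ W} {x : W} {P : Set W} (h : Movable T x P)
    (hx : x ∈ P) : T ≤ vectorSpan ℝ P := by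
  intro d hd
  obtain ⟨ε, hε, hb⟩ := h hx d hd
  have := vsub_mem_vectorSpan ℝ (hb ε (abs_of_pos hε).le) hx
  simp only [vsub_eq_sub, add_sub_cancel_left] at this
  exact (Submodule.smul_mem_iff _ hε.ne').1 this

/-- If a point of `L(σ) + γ`, for `σ` a segment and `γ` a polygon, can be moved in all directions of a
three-dimensional space, then the sum is direct, and the summands of the point are relative interior
points. -/
theorem Movable.sum [FiniteDimensional ℝ V] [FiniteDimensional ℝ W] {T : Submodule ℝ W}
    (hT : Module.finrank ℝ T = 3) {L : V →ₗ[ℝ] W}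
    (hL : Function.Injective L) {σ : Set V} {γ : Set W} (hσ : polyDim σ = 1) (hγ : polyDim γ = 2)
    {p : V} {g : W} (hp : p ∈ σ) (hg : g ∈ γ) (h : Movable T (L p + g) (L '' σ + γ)) :
    vectorSpan ℝ (L '' σ + γ) = T ∧ (vectorSpan ℝ σ).map L ⊔ vectorSpan ℝ γ = T ∧
      Disjoint ((vectorSpan ℝ σ).map L) (vectorSpan ℝ γ) ∧ p ∈ relCore σ ∧ g ∈ relCore γ := by
  have hmem : L p + g ∈ L '' σ + γ := Set.add_mem_add ⟨p, hp, rfl⟩ hg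
  have hsup : vectorSpan ℝ (L '' σ + γ) = (vectorSpan ℝ σ).map L ⊔ vectorSpan ℝ γ := by
    rw [vectorSpan_add_eq_sup (Set.Nonempty.image L ⟨p, hp⟩) ⟨g, hg⟩, vectorSpan_image_linearMap]
  have hmap : Module.finrank ℝ ((vectorSpan ℝ σ).map L) = 1 :=
    (Submodule.equivMapOfInjective L hL _).finrank_eq.symm.trans hσ
  have hdim := Submodule.finrank_sup_add_finrank_inf_eq ((vectorSpan ℝ σ).map L) (vectorSpan ℝ γ)
  have hγ' : Module.finrank ℝ (vectorSpan ℝ γ) = 2 := hγ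
  rw [hmap, hγ'] at hdim
  obtain ⟨hspan, -⟩ := relCore_eq_of_finrank_le hmem (h hmem) (by rw [hsup, hT]; omega)
  have hdisj : Disjoint ((vectorSpan ℝ σ).map L) (vectorSpan ℝ γ) := by
    rw [disjoint_iff, ← Submodule.finrank_eq_zero (R := ℝ)]
    rw [← hsup, hspan, hT] at hdim
    omega
  have hsplit : ∀ a ∈ σ, ∀ b ∈ γ, ∀ d ∈ vectorSpan ℝ σ, ∀ e ∈ vectorSpan ℝ γ,
      L a + b = L p + g + (L d + e) → a = p + d ∧ b = g + e := by
    intro a ha b hb d hd e he hab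
    have h1 : L (a - p - d) ∈ (vectorSpan ℝ σ).map L :=
      Submodule.mem_map_of_mem (Submodule.sub_mem _ (vsub_mem_vectorSpan ℝ ha hp) hd)
    have h2 : g + e - b ∈ vectorSpan ℝ γ := by
      have := Submodule.sub_mem _ he (vsub_mem_vectorSpan ℝ hb hg)
      rw [vsub_eq_sub] at this
      convert this using 1; abel
    have h3 : L (a - p - d) = g + e - b := by
      rw [map_sub, map_sub, sub_sub, sub_eq_sub_iff_add_eq_add, hab]
      abel
    have h4 := Submodule.disjoint_def.1 hdisj _ h1 (h3 ▸ h2)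
    have h5 : a - p - d = 0 := hL (by rw [h4, map_zero])
    refine ⟨?_, ?_⟩
    · rw [sub_sub] at h5
      exact sub_eq_zero.1 h5
    · rw [h3] at h4
      exact (sub_eq_zero.1 h4).symm
  refine ⟨hspan, hsup.symm.trans hspan, hdisj, ⟨hp, fun d hd => ?_⟩, ⟨hg, fun d hd => ?_⟩⟩
  · obtain ⟨ε, hε, hb⟩ := h hmem (L d) (by
      rw [← hspan, hsup]
      exact Submodule.mem_sup_left (Submodule.mem_map_of_mem hd))
    refine ⟨ε, hε, fun t ht => ?_⟩
    obtain ⟨_, ⟨a, ha, rfl⟩, b, hb', hab⟩ := hb t ht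
    have := (hsplit a ha b hb' (t • d) (Submodule.smul_mem _ _ hd) 0 (Submodule.zero_mem _) (by
      rw [map_smul, add_zero]; exact hab)).1
    exact this ▸ ha
  · obtain ⟨ε, hε, hb⟩ := h hmem d (by
      rw [← hspan, hsup]
      exact Submodule.mem_sup_right hd)
    refine ⟨ε, hε, fun t ht => ?_⟩
    obtain ⟨_, ⟨a, ha, rfl⟩, b, hb', hab⟩ := hb t ht
    have := (hsplit a ha b hb' 0 (Submodule.zero_mem _) (t • d) (Submodule.smul_mem _ _ hd) (by
      rw [map_zero, zero_add]; exact hab)).2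
    exact this ▸ hb'

theorem eq_of_disjoint_vectorSpan {L : V →ₗ[ℝ] W} (hL : Function.Injective L) {σ : Set V}
    {γ : Set W} (hdisj : Disjoint ((vectorSpan ℝ σ).map L) (vectorSpan ℝ γ)) {p q : V} {g h : W}
    (hp : p ∈ σ) (hq : q ∈ σ) (hg : g ∈ γ) (hh : h ∈ γ) (heq : L p + g = L q + h) : p = q := by
  have h1 : L (p - q) ∈ (vectorSpan ℝ σ).map L :=
    Submodule.mem_map_of_mem (vsub_mem_vectorSpan ℝ hp hq)
  have h2 : L (p - q) = h - g := by
    rw [map_sub, sub_eq_sub_iff_add_eq_add, heq, add_comm]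
  have h3 := Submodule.disjoint_def.1 hdisj _ h1 (h2 ▸ vsub_mem_vectorSpan ℝ hh hg)
  exact sub_eq_zero.1 (hL (by rw [h3, map_zero]))

open Classical in
/-- The sum of the weights of all the sums `L(σ) + γ` that contain `x`. -/
def minkowskiSumAt {d e : ℕ} (N : AddSubgroup W) (L : V →ₗ[ℝ] W) (A : WeightedComplex V d)
    (B : WeightedComplex W e) (x : W) : ℚ :=
  ∑ σ ∈ A.maxCells, ∑ γ ∈ B.maxCells,
    if x ∈ L '' σ + γ then minkowskiWeight N L d e σ (A.weight σ) γ (B.weight γ) else 0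

variable {d e : ℕ} {N : AddSubgroup W} {L : V →ₗ[ℝ] W} {A A' : WeightedComplex V d}
  {B B' : WeightedComplex W e} {Z Z' : WeightedComplex W (d + e)}

theorem WeightedComplex.mem_maxCells_of_movable [FiniteDimensional ℝ W] {m : ℕ}
    (Z : WeightedComplex W m)
    {T : Submodule ℝ W} (hT : Module.finrank ℝ T = m) {x : W} {τ : Set W} (hτ : τ ∈ Z.cells)
    (hx : x ∈ τ) (hmov : Movable T x τ) :
    τ ∈ Z.maxCells ∧ x ∈ relCore τ := by
  obtain ⟨ρ, hρ, hτρ⟩ := Z.exists_maxCell hτ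
  have hle : Module.finrank ℝ (vectorSpan ℝ τ) ≤ m :=
    (Submodule.finrank_mono (vectorSpan_mono ℝ hτρ)).trans (mem_maxCells.1 hρ).2.le
  obtain ⟨h1, h2⟩ := relCore_eq_of_finrank_le hx (hmov hx) (hT ▸ hle)
  exact ⟨mem_maxCells.2 ⟨hτ, by rw [polyDim, h1, hT]⟩, h2⟩

theorem IsMinkowskiSum.weight_eq [FiniteDimensional ℝ W] (h : IsMinkowskiSum N L A B Z)
    {T : Submodule ℝ W}
    (hT : Module.finrank ℝ T = d + e) {x : W} (hmov : ∀ τ ∈ Z.cells, Movable T x τ) {τ : Set W}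
    (hτ : τ ∈ Z.cells) (hx : x ∈ τ) : Z.weight τ = minkowskiSumAt N L A B x := by
  obtain ⟨hτm, hcore⟩ := Z.mem_maxCells_of_movable hT hτ hx (hmov τ hτ)
  rw [h.2 τ hτm, minkowskiSumAt]
  refine Finset.sum_congr rfl fun σ hσ => Finset.sum_congr rfl fun γ hγ => ?_
  by_cases hdim : polyDim (L '' σ + γ) = d + e
  · have hiff : τ ⊆ L '' σ + γ ↔ x ∈ L '' σ + γ := by
      refine ⟨fun hs => hs hx, fun hxs => ?_⟩
      rw [h.1 σ hσ γ hγ hdim] at hxs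
      obtain ⟨ρ, hρ, hρs, hxρ⟩ := hxs
      exact (Z.subset_of_mem_relCore hτ hρ hcore hxρ).trans hρs
    classical exact if_congr hiff rfl rfl
  · simp [minkowskiWeight, hdim]

theorem IsMinkowskiSum.sumAt_eq_zero (h : IsMinkowskiSum N L A B Z) {x : W}
    (hx : ∀ τ ∈ Z.cells, x ∉ τ) : minkowskiSumAt N L A B x = 0 := by
  refine Finset.sum_eq_zero fun σ hσ => Finset.sum_eq_zero fun γ hγ => ?_
  by_cases hdim : polyDim (L '' σ + γ) = d + e
  · rw [if_neg]
    intro hxs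
    rw [h.1 σ hσ γ hγ hdim] at hxs
    obtain ⟨ρ, hρ, -, hxρ⟩ := hxs
    exact hx ρ hρ hxρ
  · simp [minkowskiWeight, hdim]

/-- If two Minkowski sums agree as weighted complexes, then the weights agree at generic points. -/
theorem WeightedComplex.Same.minkowskiSumAt_eq [FiniteDimensional ℝ W] [TopologicalSpace W]
    (hcont : ∀ l : W →ₗ[ℝ] ℝ, Continuous l) (hZ : Z.Same Z')
    (h : IsMinkowskiSum N L A B Z) (h' : IsMinkowskiSum N L A' B' Z') {T : Submodule ℝ W}
    (hT : Module.finrank ℝ T = d + e) {x : W} (hmov : ∀ τ ∈ Z.cells, Movable T x τ)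
    (hmov' : ∀ τ ∈ Z'.cells, Movable T x τ) :
    minkowskiSumAt N L A B x = minkowskiSumAt N L A' B' x := by
  by_cases hτ : ∃ τ ∈ Z.cells, x ∈ τ <;> by_cases hτ' : ∃ τ ∈ Z'.cells, x ∈ τ
  · obtain ⟨τ, hτ, hx⟩ := hτ
    obtain ⟨τ', hτ', hx'⟩ := hτ'
    obtain ⟨hm, hc⟩ := Z.mem_maxCells_of_movable hT hτ hx (hmov τ hτ)
    obtain ⟨hm', hc'⟩ := Z'.mem_maxCells_of_movable hT hτ' hx' (hmov' τ' hτ')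
    rw [← h.weight_eq hT hmov hτ hx, ← h'.weight_eq hT hmov' hτ' hx']
    exact hZ.2 τ hm τ' hm' ⟨x, (Z.isPolyhedron τ hτ).relCore_subset_intrinsicInterior hcont hc,
      (Z'.isPolyhedron τ' hτ').relCore_subset_intrinsicInterior hcont hc'⟩
  · obtain ⟨τ, hτ, hx⟩ := hτ
    obtain ⟨hm, -⟩ := Z.mem_maxCells_of_movable hT hτ hx (hmov τ hτ)
    rw [← h.weight_eq hT hmov hτ hx, h'.sumAt_eq_zero fun τ h1 h2 => hτ' ⟨τ, h1, h2⟩]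
    by_contra h0
    have : x ∈ Z.support := ⟨τ, hm, h0, hx⟩
    rw [hZ.1] at this
    obtain ⟨ρ, hρ, -, hxρ⟩ := this
    exact hτ' ⟨ρ, (mem_maxCells.1 hρ).1, hxρ⟩
  · obtain ⟨τ, hτ', hx⟩ := hτ'
    obtain ⟨hm, -⟩ := Z'.mem_maxCells_of_movable hT hτ' hx (hmov' τ hτ')
    rw [← h'.weight_eq hT hmov' hτ' hx, h.sumAt_eq_zero fun τ h1 h2 => hτ ⟨τ, h1, h2⟩]
    by_contra h0
    have : x ∈ Z'.support := ⟨τ, hm, Ne.symm h0, hx⟩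
    rw [← hZ.1] at this
    obtain ⟨ρ, hρ, -, hxρ⟩ := this
    exact hτ ⟨ρ, (mem_maxCells.1 hρ).1, hxρ⟩
  · rw [h.sumAt_eq_zero fun τ h1 h2 => hτ ⟨τ, h1, h2⟩,
      h'.sumAt_eq_zero fun τ h1 h2 => hτ' ⟨τ, h1, h2⟩]

end Generic

/-! ### Curves supported on fans -/

section Curves

variable {V : Type*} [AddCommGroup V] [Module ℝ V]

open Classical in
/-- The sum of the weights of the maximal cells that contain `p`. -/
def localWeight (C : WeightedComplex V 1) (p : V) : ℚ :=
  ∑ σ ∈ C.maxCells, if p ∈ σ then C.weight σ else 0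

/-- `p` is a relative interior point of each maximal cell that contains it. -/
def IsRegularAt (C : WeightedComplex V 1) (p : V) : Prop :=
  ∀ σ ∈ C.maxCells, p ∈ σ → p ∈ relCore σ

theorem localWeight_eq [FiniteDimensional ℝ V] {C : WeightedComplex V 1} {p : V} {σ : Set V}
    (hσ : σ ∈ C.maxCells)
    (hp : p ∈ relCore σ) : localWeight C p = C.weight σ := by
  classical
  have hσ' := WeightedComplex.mem_maxCells.1 hσ
  rw [localWeight, Finset.sum_eq_single σ]
  · exact if_pos hp.1
  · intro ρ hρ hne
    have hρ' := WeightedComplex.mem_maxCells.1 hρ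
    refine if_neg fun hpρ => hne ?_
    exact (C.eq_of_mem_relCore hσ'.1 hρ'.1 (hσ'.2.trans hρ'.2.symm) hp hpρ).symm
  · exact fun h => absurd hσ h

theorem exists_of_localWeight_ne_zero {C : WeightedComplex V 1} {p : V} (h : localWeight C p ≠ 0) :
    ∃ σ ∈ C.maxCells, C.weight σ ≠ 0 ∧ p ∈ σ := by
  obtain ⟨σ, hσ, h0⟩ := Finset.exists_ne_zero_of_sum_ne_zero h
  by_cases hp : p ∈ σ
  · exact ⟨σ, hσ, by simpa [hp] using h0, hp⟩
  · simp [hp] at h0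

/-- A cell of nonzero weight in a curve supported on a fan points to the origin: otherwise the
support would contain a two-dimensional cone, which finitely many lines cannot cover. -/
theorem WeightedComplex.SupportIsFan.mem_vectorSpan [FiniteDimensional ℝ V]
    {C : WeightedComplex V 1}
    (hC : C.SupportIsFan) {σ : Set V} (hσ : σ ∈ C.maxCells) (hw : C.weight σ ≠ 0) {p : V}
    (hp : p ∈ σ) : p ∈ vectorSpan ℝ σ := by
  obtain ⟨F, hF, hsupp⟩ := hC
  have hσ' := mem_maxCells.1 hσ
  by_contra hpσ
  have hcone : ∀ q ∈ C.support, ∀ t : ℝ, 0 ≤ t → t • q ∈ C.support := by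
    intro q hq t ht
    rw [hsupp] at hq ⊢
    obtain ⟨P, hP, hqP⟩ := hq
    exact ⟨P, hP, hF P hP q hqP t ht⟩
  obtain ⟨q, hq, hqp⟩ : ∃ q ∈ σ, q ≠ p := by
    by_contra! hall
    have hsub : σ = {p} := Set.eq_singleton_iff_unique_mem.2 ⟨hp, hall⟩
    have := hσ'.2
    rw [polyDim, hsub, vectorSpan_singleton, finrank_bot] at this
    exact zero_ne_one this
  have hd : q - p ∈ vectorSpan ℝ σ := vsub_mem_vectorSpan ℝ hq hp
  have hconv := (C.isPolyhedron σ hσ'.1).convex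
  have hseg : ∀ s ∈ Set.Icc (0 : ℝ) 1, p + s • (q - p) ∈ C.support := fun s hs =>
    ⟨σ, hσ, hw, hconv.add_smul_sub_mem hp hq hs⟩
  -- Each ray from the origin through a point of the segment from `p` to `q` has two points in common
  -- with one of the finitely many cells.
  have hray : ∀ s ∈ Set.Icc (0 : ℝ) 1, ∃ ρ ∈ C.maxCells, p + s • (q - p) ∈ vectorSpan ℝ ρ := by
    intro s hs
    have hm : ∀ n : ℕ, ∃ ρ ∈ C.maxCells, (n : ℝ) • (p + s • (q - p)) ∈ ρ := by
      intro n
      obtain ⟨ρ, hρ, -, h⟩ := hcone _ (hseg s hs) n (Nat.cast_nonneg n)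
      exact ⟨ρ, hρ, h⟩
    choose ρ hρ hmem using hm
    obtain ⟨m, -, n, -, hmn, heq⟩ := Set.infinite_univ.exists_ne_map_eq_of_mapsTo
      (f := ρ) (t := (C.maxCells : Set (Set V))) (fun n _ => hρ n) C.maxCells.finite_toSet
    refine ⟨ρ m, hρ m, ?_⟩
    have h1 := vsub_mem_vectorSpan ℝ (hmem m) (heq ▸ hmem n)
    rw [vsub_eq_sub, ← sub_smul] at h1
    refine (Submodule.smul_mem_iff _ ?_).1 h1
    rw [sub_ne_zero]
    exact_mod_cast hmn
  choose! ρ hρ hmem using hray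
  obtain ⟨s, hs, s', hs', hne, heq⟩ := (Set.Icc_infinite (zero_lt_one' ℝ)).exists_ne_map_eq_of_mapsTo
    (f := ρ) (t := (C.maxCells : Set (Set V))) (fun s hs => hρ s hs) C.maxCells.finite_toSet
  have h1 := hmem s hs
  have h2 : p + s' • (q - p) ∈ vectorSpan ℝ (ρ s) := heq ▸ hmem s' hs'
  have h3 : q - p ∈ vectorSpan ℝ (ρ s) := by
    have := Submodule.sub_mem _ h1 h2
    rw [add_sub_add_left_eq_sub, ← sub_smul] at this
    exact (Submodule.smul_mem_iff _ (sub_ne_zero.2 hne)).1 this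
  have h4 : p ∈ vectorSpan ℝ (ρ s) := by
    have := Submodule.sub_mem _ h1 (Submodule.smul_mem _ s h3)
    rwa [add_sub_cancel_right] at this
  have h5 : ℝ ∙ (q - p) = vectorSpan ℝ (ρ s) := by
    refine Submodule.eq_of_le_of_finrank_eq ((Submodule.span_singleton_le_iff_mem _ _).2 h3) ?_
    rw [finrank_span_singleton (sub_ne_zero.2 hqp)]
    exact (mem_maxCells.1 (hρ s hs)).2.symm
  rw [← h5] at h4
  exact hpσ ((Submodule.span_singleton_le_iff_mem _ _).2 hd h4)

theorem WeightedComplex.SupportIsFan.vectorSpan_eq [FiniteDimensional ℝ V] {C : WeightedComplex V 1}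
    (hC : C.SupportIsFan) {σ : Set V} (hσ : σ ∈ C.maxCells) (hw : C.weight σ ≠ 0) {p : V}
    (hp : p ∈ σ) (h0 : p ≠ 0) : vectorSpan ℝ σ = ℝ ∙ p := by
  refine (Submodule.eq_of_le_of_finrank_eq ((Submodule.span_singleton_le_iff_mem _ _).2
    (hC.mem_vectorSpan hσ hw hp)) ?_).symm
  rw [finrank_span_singleton h0]
  exact (mem_maxCells.1 hσ).2.symm

/-- The local weight of a curve supported on a fan is locally constant along the ray through a
regular point. -/
theorem WeightedComplex.SupportIsFan.eventually_localWeight_eq [FiniteDimensional ℝ V]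
    {C : WeightedComplex V 1}
    (hC : C.SupportIsFan) {p : V} (hp : IsRegularAt C p) :
    ∃ δ > 0, ∀ t : ℝ, |t - 1| < δ → localWeight C (t • p) = localWeight C p := by
  classical
  have key : ∀ σ ∈ C.maxCells, ∀ᶠ t : ℝ in nhds 1,
      (if t • p ∈ σ then C.weight σ else 0) = if p ∈ σ then C.weight σ else 0 := by
    intro σ hσ
    by_cases hw : C.weight σ = 0
    · simp [hw]
    by_cases hpσ : p ∈ σ
    · obtain ⟨ε, hε, hb⟩ := (hp σ hσ hpσ).2 p (hC.mem_vectorSpan hσ hw hpσ)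
      filter_upwards [Metric.ball_mem_nhds (1 : ℝ) hε] with t ht
      rw [Metric.mem_ball, Real.dist_eq] at ht
      have h1 := hb (t - 1) ht.le
      have h2 : p + (t - 1) • p = t • p := by module
      rw [h2] at h1
      rw [if_pos h1, if_pos hpσ]
    · have hcl := (C.isPolyhedron σ (mem_maxCells.1 hσ).1).isClosed_line 0 p
      have : (1 : ℝ) ∈ {t : ℝ | 0 + t • p ∈ σ}ᶜ := by simpa using hpσ
      filter_upwards [hcl.isOpen_compl.mem_nhds this] with t ht
      rw [if_neg hpσ, if_neg]
      simpa using ht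
  obtain ⟨δ, hδ, hb⟩ := Metric.eventually_nhds_iff.1
    ((Filter.eventually_all_finset C.maxCells).2 key)
  refine ⟨δ, hδ, fun t ht => ?_⟩
  exact Finset.sum_congr rfl fun σ hσ => hb (by rwa [Real.dist_eq]) σ hσ

end Curves

/-! ### Rational directions and lattice indices -/

section Rational

/-- A subgroup of `K` that contains the kernel of a functional with integer values on `K` and some
vector outside this kernel has finite index in `K`. -/
theorem relIndex_ne_zero_of_integral {W : Type*} [AddCommGroup W] [Module ℝ W]
    {H K : AddSubgroup W} (l : W →ₗ[ℝ] ℝ) (hint : ∀ x ∈ K, ∃ z : ℤ, l x = z)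
    (hker : ∀ x ∈ K, l x = 0 → x ∈ H) {n : W} (hnH : n ∈ H) (hnK : n ∈ K) (hn : l n ≠ 0) :
    H.relIndex K ≠ 0 := by
  choose! z hz using hint
  have hm : z n ≠ 0 := fun h => hn (by rw [hz n hnK, h, Int.cast_zero])
  have : NeZero (z n).natAbs := ⟨Int.natAbs_ne_zero.2 hm⟩
  -- Two elements of `K` are congruent modulo `H` if their values are congruent modulo the value at
  -- `n`.
  let f : K ⧸ H.addSubgroupOf K → ZMod (z n).natAbs := fun q => (z (q.out : K) : ZMod _)
  have hf : Function.Injective f := by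
    intro q q' hqq
    have h1 : ((z (q.out : K) : ℤ) : ZMod (z n).natAbs) = (z (q'.out : K) : ℤ) := hqq
    rw [ZMod.intCast_eq_intCast_iff, Int.modEq_iff_dvd] at h1
    obtain ⟨c, hc⟩ := (Int.natAbs_dvd.1 h1)
    have h2 : -(q.out : W) + q'.out ∈ H := by
      have h3 : -(q.out : W) + q'.out - c • n ∈ H := by
        apply hker
        · exact K.sub_mem (K.add_mem (K.neg_mem q.out.2) q'.out.2) (K.zsmul_mem hnK c)
        · rw [map_sub, map_add, map_neg, map_zsmul, hz _ q.out.2, hz _ q'.out.2, hz n hnK,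
            zsmul_eq_mul]
          have : ((z (q'.out : K) - z (q.out : K) : ℤ) : ℝ) = ((z n * c : ℤ) : ℝ) := by rw [hc]
          push_cast at this
          linarith
      have := H.add_mem h3 (H.zsmul_mem hnH c)
      rwa [sub_add_cancel] at this
    rw [← QuotientAddGroup.out_eq' q, ← QuotientAddGroup.out_eq' q', QuotientAddGroup.eq]
    exact h2
  have : Finite (K ⧸ H.addSubgroupOf K) := Finite.of_injective f hf
  exact AddSubgroup.index_ne_zero_of_finite

/-- The line parallel to a one-dimensional rational polyhedron contains a nonzero lattice vector. It is
the solution space of a system of linear equations with integer coefficients; applying a `ℚ`-linear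
functional `ℝ → ℚ` to the coordinates of a real solution gives a rational one. -/
theorem IsRationalPolyhedron.exists_lattice_vector {ι : Type*} [Finite ι] {G : Set ℝ}
    {P : Set (TropTorus ι)} (hP : IsRationalPolyhedron (intLattice ι) G P) (hdim : polyDim P = 1) :
    ∃ n ∈ intLattice ι, n ≠ 0 ∧ n ∈ vectorSpan ℝ P := by
  classical
  have := Fintype.ofFinite ι
  obtain ⟨H, hH, hPH⟩ := hP
  obtain ⟨p, hp, q, hq, hqp⟩ : ∃ p ∈ P, ∃ q ∈ P, q ≠ p := by
    by_contra! hall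
    have hsub : P.Subsingleton := fun a ha b hb => hall b hb a ha
    rcases hsub.eq_empty_or_singleton with h | ⟨x, h⟩ <;> rw [h, polyDim] at hdim
    · rw [vectorSpan_empty, finrank_bot] at hdim
      exact zero_ne_one hdim
    · rw [vectorSpan_singleton, finrank_bot] at hdim
      exact zero_ne_one hdim
  have hle : ∀ x ∈ P, ∀ h ∈ H, h.1 x ≤ h.2 := fun x hx => by rw [hPH] at hx; exact hx
  have hker : ∀ y, (∀ h ∈ H, h.1 (q - p) = 0 → h.1 y = 0) → y ∈ vectorSpan ℝ P := by
    intro y hy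
    have hev : ∀ᶠ t : ℝ in nhds 0, ∀ h ∈ H, h.1 p + 2⁻¹ * h.1 (q - p) + t * h.1 y ≤ h.2 := by
      rw [Filter.eventually_all_finset]
      intro h hh
      have h1 := hle p hp h hh
      have h2 := hle q hq h hh
      by_cases h0 : h.1 (q - p) = 0
      · refine Filter.Eventually.of_forall fun t => ?_
        rw [hy h hh h0, h0]
        simpa using h1
      · have hlt : h.1 p + 2⁻¹ * h.1 (q - p) + 0 * h.1 y < h.2 := by
          rw [map_sub] at h0 ⊢
          rcases lt_or_gt_of_ne h0 with h3 | h3 <;> linarith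
        have hc : Continuous fun t : ℝ => h.1 p + 2⁻¹ * h.1 (q - p) + t * h.1 y := by fun_prop
        filter_upwards [hc.continuousAt.eventually_lt continuousAt_const hlt] with t ht using ht.le
    obtain ⟨ε, hε, hb⟩ := Metric.eventually_nhds_iff.1 hev
    have hmem : ∀ t : ℝ, |t| < ε → p + (2⁻¹ : ℝ) • (q - p) + t • y ∈ P := by
      intro t ht
      rw [hPH]
      intro h hh
      have := hb (y := t) (by simpa using ht) h hh
      simpa using this
    have h1 := vsub_mem_vectorSpan ℝ (hmem (ε / 2) (by rw [abs_of_pos (by positivity)]; linarith))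
      (hmem 0 (by simpa using hε))
    simp only [vsub_eq_sub, zero_smul, add_zero, add_sub_cancel_left] at h1
    exact (Submodule.smul_mem_iff _ (by positivity)).1 h1
  obtain ⟨a, ha⟩ := toTorus_surjective (q - p)
  have hd : q - p ≠ 0 := sub_ne_zero.2 hqp
  obtain ⟨i, j, hij⟩ : ∃ i j, a i ≠ a j := by
    by_contra! hall
    apply hd
    rcases isEmpty_or_nonempty ι with hι | hι
    · rw [← ha, Subsingleton.elim a 0, map_zero]
    · rw [← ha, toTorus_eq_zero_iff.2 hall]
  obtain ⟨f, hf⟩ : ∃ f : Module.Dual ℚ ℝ, f (a i - a j) ≠ 0 := by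
    by_contra! hall
    exact sub_ne_zero.2 hij ((Module.forall_dual_apply_eq_zero_iff ℚ (a i - a j)).1 hall)
  have hexp : ∀ (l : TropTorus ι →ₗ[ℝ] ℝ) (w : ι → ℝ),
      l (toTorus ι w) = ∑ c, w c * l (toTorus ι (Pi.single c 1)) := by
    intro l w
    have h := LinearMap.sum_single_apply (fun _ => ℝ) w
    conv_lhs => rw [← Finset.univ_sum_single w]
    rw [map_sum, map_sum]
    refine Finset.sum_congr rfl fun c _ => ?_
    have : Pi.single c (w c) = w c • (Pi.single c 1 : ι → ℝ) := by
      rw [← Pi.single_smul, smul_eq_mul, mul_one]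
    rw [this, map_smul, map_smul, smul_eq_mul]
  have hsol : ∀ h ∈ H, h.1 (q - p) = 0 → ∑ c, ((f (a c) : ℚ) : ℝ) *
      h.1 (toTorus ι (Pi.single c 1)) = 0 := by
    intro h hh h0
    have hz : ∀ c, ∃ z : ℤ, h.1 (toTorus ι (Pi.single c 1)) = z := by
      intro c
      refine (hH h hh).1 _ ⟨Pi.single c 1, ?_⟩
      change toTorus ι (fun i => ((Pi.single c 1 : ι → ℤ) i : ℝ)) = _
      congr 1
      funext i
      by_cases hi : i = c
      · subst hi; simp
      · simp [hi]
    choose z hz using hz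
    rw [← ha, hexp] at h0
    simp only [hz] at h0 ⊢
    have h1 : ∑ c, f (a c) * (z c : ℚ) = 0 := by
      have h2 := congrArg f h0
      rw [map_sum, map_zero] at h2
      rw [← h2]
      refine Finset.sum_congr rfl fun c _ => ?_
      have : a c * (z c : ℝ) = (z c : ℚ) • a c := by
        rw [Rat.smul_def, mul_comm]; push_cast; rfl
      rw [this, map_smul, smul_eq_mul, mul_comm]
    exact_mod_cast h1
  -- Clear denominators.
  let D : ℕ := ∏ c, (f (a c)).den
  have hD : D ≠ 0 := Finset.prod_ne_zero_iff.2 fun c _ => (f (a c)).den_ne_zero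
  have hint : ∀ c, ∃ z : ℤ, (D : ℚ) * f (a c) = z := by
    intro c
    obtain ⟨k, hk⟩ := Finset.dvd_prod_of_mem (fun c => (f (a c)).den) (Finset.mem_univ c)
    refine ⟨k * (f (a c)).num, ?_⟩
    have h1 := Rat.den_mul_eq_num (f (a c))
    have h2 : (D : ℚ) = ((f (a c)).den : ℚ) * k := by exact_mod_cast hk
    rw [h2]
    push_cast
    linear_combination (k : ℚ) * h1
  choose z hz using hint
  have hz' : ∀ c, (z c : ℝ) = (D : ℝ) * ((f (a c) : ℚ) : ℝ) := fun c => by exact_mod_cast (hz c).symm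
  refine ⟨toTorus ι fun c => (z c : ℝ), toTorus_mem_intLattice z, fun h0 => ?_,
    hker _ fun h hh h0 => ?_⟩
  · have : Nonempty ι := ⟨i⟩
    have h1 := toTorus_eq_zero_iff.1 h0 i j
    rw [hz', hz'] at h1
    have h2 : (f (a i) : ℝ) = f (a j) := mul_left_cancel₀ (by exact_mod_cast hD) h1
    apply hf
    rw [map_sub, sub_eq_zero]
    exact_mod_cast h2
  · rw [hexp]
    simp only [hz', mul_assoc]
    rw [← Finset.mul_sum, hsol h hh h0, mul_zero]

theorem phi_mem_intLattice {n : TropTorus (Fin 4)} (hn : n ∈ intLattice (Fin 4)) :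
    phi 1 3 n ∈ intLattice (PluckerIndex 1 3) := by
  obtain ⟨w, rfl⟩ := hn
  refine ⟨fun I => ∑ i ∈ I.1, w i, ?_⟩
  change toTorus _ _ = phi 1 3 (toTorus _ _)
  rw [phi_toTorus]
  congr 1
  funext I
  simp [phiLift]

/-- The lattice index in the weight of the sum of a cell through `p` pointing to the origin and a cell
with tangent space `L`. -/
def crossIndex (p : TropTorus (Fin 4)) (L : Submodule ℝ (TropTorus (PluckerIndex 1 3))) : ℕ :=
  ((intLattice (PluckerIndex 1 3) ⊓ (ℝ ∙ phi 1 3 p).toAddSubgroup) ⊔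
    (intLattice (PluckerIndex 1 3) ⊓ L.toAddSubgroup)).relIndex
      (intLattice (PluckerIndex 1 3) ⊓ ((ℝ ∙ phi 1 3 p) ⊔ L).toAddSubgroup)

theorem crossIndex_ne_zero {p n : TropTorus (Fin 4)} (hn : n ∈ intLattice (Fin 4)) (hn0 : n ≠ 0)
    (hnp : n ∈ ℝ ∙ p) {g : TropTorus (PluckerIndex 1 3)} (hp : phi 1 3 p ∉ tieSpace g) :
    crossIndex p (tieSpace g) ≠ 0 := by
  rw [mem_tieSpace] at hp
  push Not at hp
  obtain ⟨i, j, k, hij, hik, hjk, hg, hpl⟩ := hp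
  obtain ⟨c, rfl⟩ := Submodule.mem_span_singleton.1 hnp
  have hc : c ≠ 0 := fun h => hn0 (by rw [h, zero_smul])
  have hspan : phi 1 3 (c • p) ∈ ℝ ∙ phi 1 3 p := by
    rw [map_smul]
    exact Submodule.smul_mem _ _ (Submodule.mem_span_singleton_self _)
  have hN := phi_mem_intLattice hn
  refine relIndex_ne_zero_of_integral (coordDiff (pair i j) (pair i k))
    (fun x hx => coordDiff_mem_intLattice _ _ hx.1) (fun x hx h0 => ?_) (n := phi 1 3 (c • p))
    (AddSubgroup.mem_sup_left ⟨hN, hspan⟩) ⟨hN, Submodule.mem_sup_left hspan⟩ ?_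
  · obtain ⟨y, hy, t, ht, hyt⟩ := Submodule.mem_sup.1 hx.2
    obtain ⟨b, rfl⟩ := Submodule.mem_span_singleton.1 hy
    have h1 := mem_tieSpace.1 ht i j k hij hik hjk hg
    rw [← hyt, map_add, h1, add_zero, map_smul, smul_eq_mul, mul_eq_zero] at h0
    have hb : b = 0 := h0.resolve_right hpl
    rw [hb, zero_smul, zero_add] at hyt
    exact AddSubgroup.mem_sup_right ⟨hx.1, hyt ▸ ht⟩
  · rw [map_smul, map_smul, smul_eq_mul]
    exact mul_ne_zero hc hpl

end Rational

/-! ### The crossing relation -/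

section Crossing

/-- The space of ultrametrics modulo constants. -/
def ultraSpace : Set (TropTorus (PluckerIndex 1 3)) := toTorus _ '' {w | IsUltra w}

theorem toTorus_mem_ultraSpace {w : PluckerIndex 1 3 → ℝ} :
    toTorus _ w ∈ ultraSpace ↔ IsUltra w := by
  constructor
  · rintro ⟨w', hw', heq⟩
    obtain ⟨c, hc⟩ := toTorus_eq_toTorus_iff.1 heq
    intro i j k hij hik hjk
    have := hw' i j k hij hik hjk
    simpa [MinTwice, hc] using this
  · exact fun h => ⟨w, h, rfl⟩

/-- A polyhedral structure on the space of ultrametrics whose maximal cells have weight one. -/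
structure IsUltraComplex (B : WeightedComplex (TropTorus (PluckerIndex 1 3)) 2) : Prop where
  union_eq : {w | ∃ P ∈ B.cells, w ∈ P} = ultraSpace
  weight_eq : ∀ P ∈ B.maxCells, ∀ x ∈ relCore P, B.weight P = 1

theorem IsTropicalization.isUltraComplex {K : Type*} [Field K] [IsAlgClosed K]
    {v : AddValuation K (WithTop ℝ)} (hv : ∃ x : K, x ≠ 0 ∧ v x ≠ 0)
    {B : WeightedComplex (TropTorus (PluckerIndex 1 3)) 2}
    (hB : IsTropicalization v (linearSpacesThroughUnit K 1 3) B) : IsUltraComplex B := by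
  refine ⟨hB.1.trans ?_, fun P hP x hx => hB.weight_eq_one v hv hP hx⟩
  ext x
  obtain ⟨w, rfl⟩ := toTorus_surjective x
  rw [toTorus_mem_tropSet v hv, toTorus_mem_ultraSpace]

variable {B : WeightedComplex (TropTorus (PluckerIndex 1 3)) 2}

theorem IsUltraComplex.mem_ultraSpace (hB : IsUltraComplex B)
    {γ : Set (TropTorus (PluckerIndex 1 3))} (hγ : γ ∈ B.maxCells)
    {g : TropTorus (PluckerIndex 1 3)} (hg : g ∈ γ) : g ∈ ultraSpace :=
  hB.union_eq.subset ⟨γ, (WeightedComplex.mem_maxCells.1 hγ).1, hg⟩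

theorem IsUltraComplex.exists_maxCell (hB : IsUltraComplex B) {g : TropTorus (PluckerIndex 1 3)}
    (hg : g ∈ ultraSpace) : ∃ γ ∈ B.maxCells, g ∈ γ := by
  obtain ⟨P, hP, hgP⟩ := hB.union_eq.symm.subset hg
  obtain ⟨γ, hγ, hPγ⟩ := B.exists_maxCell hP
  exact ⟨γ, hγ, hPγ hgP⟩

theorem IsUltraComplex.vectorSpan_eq (hB : IsUltraComplex B)
    {γ : Set (TropTorus (PluckerIndex 1 3))} (hγ : γ ∈ B.maxCells)
    {g : TropTorus (PluckerIndex 1 3)} (hg : g ∈ relCore γ) : vectorSpan ℝ γ = tieSpace g :=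
  vectorSpan_eq_tieSpace (fun _ hw => toTorus_mem_ultraSpace.1 (hB.mem_ultraSpace hγ hw))
    (WeightedComplex.mem_maxCells.1 hγ).2 hg

/-- `x` is in general position, relative to the space of directions `T`, to the sums of the cells of
`C` and `B`. -/
structure IsGenericFor (T : Submodule ℝ (TropTorus (PluckerIndex 1 3)))
    (C : WeightedComplex (TropTorus (Fin 4)) 1)
    (B : WeightedComplex (TropTorus (PluckerIndex 1 3)) 2) (x : TropTorus (PluckerIndex 1 3)) :
    Prop where
  sum : ∀ σ ∈ C.maxCells, ∀ γ ∈ B.maxCells, Movable T x (phi 1 3 '' σ + γ)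
  right : ∀ γ ∈ B.maxCells, Movable T x γ

variable {T : Submodule ℝ (TropTorus (PluckerIndex 1 3))}
  {C : WeightedComplex (TropTorus (Fin 4)) 1} {x : TropTorus (PluckerIndex 1 3)}

/-- The points `p` of cells of nonzero weight of `C` that contribute to the weight of the Minkowski sum
at `x`. -/
def crossingSet (C : WeightedComplex (TropTorus (Fin 4)) 1) (x : TropTorus (PluckerIndex 1 3)) :
    Set (TropTorus (Fin 4)) :=
  {p | (∃ σ ∈ C.maxCells, C.weight σ ≠ 0 ∧ p ∈ σ) ∧ x - phi 1 3 p ∈ ultraSpace}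

/-- The local geometry at a crossing in general position. -/
theorem IsGenericFor.crossing (hT : Module.finrank ℝ T = 3) (hx : IsGenericFor T C B x)
    (hB : IsUltraComplex B) {σ : Set (TropTorus (Fin 4))} (hσ : σ ∈ C.maxCells)
    {γ : Set (TropTorus (PluckerIndex 1 3))} (hγ : γ ∈ B.maxCells) {p : TropTorus (Fin 4)}
    (hp : p ∈ σ) (hg : x - phi 1 3 p ∈ γ) :
    p ≠ 0 ∧ p ∈ relCore σ ∧ x - phi 1 3 p ∈ relCore γ ∧
      vectorSpan ℝ γ = tieSpace (x - phi 1 3 p) ∧ vectorSpan ℝ (phi 1 3 '' σ + γ) = T ∧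
      (vectorSpan ℝ σ).map (phi 1 3) ⊔ vectorSpan ℝ γ = T ∧
      Disjoint ((vectorSpan ℝ σ).map (phi 1 3)) (vectorSpan ℝ γ) := by
  have hγ' := WeightedComplex.mem_maxCells.1 hγ
  have hmov := hx.sum σ hσ γ hγ
  rw [← add_sub_cancel (phi 1 3 p) x] at hmov
  obtain ⟨h1, h2, h3, h4, h5⟩ := hmov.sum hT phi_injective
    (WeightedComplex.mem_maxCells.1 hσ).2 hγ'.2 hp hg
  refine ⟨fun h0 => ?_, h4, h5, hB.vectorSpan_eq hγ h5, h1, h2, h3⟩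
  rw [h0, map_zero, sub_zero] at hg
  have hle := Submodule.finrank_mono ((hx.right γ hγ).le_vectorSpan hg)
  have h2 : Module.finrank ℝ (vectorSpan ℝ γ) = 2 := hγ'.2
  omega

theorem IsGenericFor.finite_crossingSet (hT : Module.finrank ℝ T = 3) (hx : IsGenericFor T C B x)
    (hB : IsUltraComplex B) : (crossingSet C x).Finite := by
  have hsub : crossingSet C x ⊆ ⋃ σ ∈ C.maxCells, ⋃ γ ∈ B.maxCells,
      {p | p ∈ σ ∧ x - phi 1 3 p ∈ γ} := by
    rintro p ⟨⟨σ, hσ, -, hp⟩, hg⟩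
    obtain ⟨γ, hγ, hgγ⟩ := hB.exists_maxCell hg
    simp only [Set.mem_iUnion]
    exact ⟨σ, hσ, γ, hγ, hp, hgγ⟩
  refine Set.Finite.subset ?_ hsub
  refine Set.Finite.biUnion C.maxCells.finite_toSet fun σ hσ =>
    Set.Finite.biUnion B.maxCells.finite_toSet fun γ hγ => Set.Subsingleton.finite ?_
  rintro p ⟨hp, hg⟩ q ⟨hq, hh⟩
  obtain ⟨-, -, -, -, -, -, hdisj⟩ := hx.crossing hT hB hσ hγ hp hg
  exact eq_of_disjoint_vectorSpan phi_injective hdisj hp hq hg hh (by abel)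

/-- At a generic point, the weight of the Minkowski sum is a sum over the crossing points that does not
depend on the polyhedral structures. -/
theorem IsGenericFor.minkowskiSumAt_eq (hT : Module.finrank ℝ T = 3) (hx : IsGenericFor T C B x)
    (hB : IsUltraComplex B) (hC : C.SupportIsFan) {S : Finset (TropTorus (Fin 4))}
    (hS : crossingSet C x ⊆ S) (hSx : ∀ p ∈ S, x - phi 1 3 p ∈ ultraSpace) :
    minkowskiSumAt (intLattice (PluckerIndex 1 3)) (phi 1 3) C B x =
      ∑ p ∈ S, localWeight C p * crossIndex p (tieSpace (x - phi 1 3 p)) := by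
  classical
  have hinner : ∀ σ ∈ C.maxCells,
      (∑ γ ∈ B.maxCells, if x ∈ phi 1 3 '' σ + γ then
        minkowskiWeight (intLattice (PluckerIndex 1 3)) (phi 1 3) 1 2 σ (C.weight σ) γ (B.weight γ)
        else 0) =
      ∑ p ∈ S, (if p ∈ σ then C.weight σ else 0) * crossIndex p (tieSpace (x - phi 1 3 p)) := by
    intro σ hσ
    by_cases hw : C.weight σ = 0
    · simp [hw, minkowskiWeight]
    have hγ : ∀ γ ∈ B.maxCells, (if x ∈ phi 1 3 '' σ + γ then
        minkowskiWeight (intLattice (PluckerIndex 1 3)) (phi 1 3) 1 2 σ (C.weight σ) γ (B.weight γ)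
        else 0) = ∑ p ∈ S, if p ∈ σ ∧ x - phi 1 3 p ∈ γ then
          C.weight σ * crossIndex p (tieSpace (x - phi 1 3 p)) else 0 := by
      intro γ hγ
      by_cases hxs : x ∈ phi 1 3 '' σ + γ
      · rw [if_pos hxs]
        obtain ⟨_, ⟨p, hp, rfl⟩, g, hg, hpg⟩ := hxs
        have hpg' : phi 1 3 p + g = x := hpg
        have hg' : x - phi 1 3 p ∈ γ := by
          rw [← hpg', add_sub_cancel_left]; exact hg
        obtain ⟨h0, hpc, hgc, hsp, hspT, hsup, hdisj⟩ := hx.crossing hT hB hσ hγ hp hg'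
        have hpS : p ∈ S := hS ⟨⟨σ, hσ, hw, hp⟩, hB.mem_ultraSpace hγ hg'⟩
        rw [Finset.sum_eq_single_of_mem p hpS, if_pos ⟨hp, hg'⟩]
        · have hσp := hC.vectorSpan_eq hσ hw hp h0
          have hmap : (vectorSpan ℝ σ).map (phi 1 3) = ℝ ∙ phi 1 3 p := by
            rw [hσp, Submodule.map_span, Set.image_singleton]
          have hdim : polyDim (phi 1 3 '' σ + γ) = 1 + 2 := by
            rw [polyDim, hspT, hT]
          rw [minkowskiWeight, if_pos hdim, hB.weight_eq γ hγ _ hgc, mul_one, crossIndex]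
          congr 2
          rw [cellLattice, cellLattice, cellLattice, vectorSpan_image_linearMap, hspT, ← hsup, hmap,
            hsp]
        · intro q _ hqp
          refine if_neg fun hq => hqp ?_
          exact eq_of_disjoint_vectorSpan phi_injective hdisj hq.1 hp hq.2 hg' (by abel)
      · rw [if_neg hxs]
        refine (Finset.sum_eq_zero fun p _ => if_neg fun hp => hxs ?_).symm
        exact ⟨phi 1 3 p, ⟨p, hp.1, rfl⟩, x - phi 1 3 p, hp.2, add_sub_cancel _ _⟩
    rw [Finset.sum_congr rfl hγ, Finset.sum_comm]
    refine Finset.sum_congr rfl fun p hpS => ?_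
    by_cases hp : p ∈ σ
    · obtain ⟨γ, hγ, hg⟩ := hB.exists_maxCell (hSx p hpS)
      have hcore := (hx.crossing hT hB hσ hγ hp hg).2.2.1
      have hγ' := WeightedComplex.mem_maxCells.1 hγ
      rw [Finset.sum_eq_single_of_mem γ hγ, if_pos ⟨hp, hg⟩, if_pos hp]
      intro γ₂ hγ₂ hne
      have hγ₂' := WeightedComplex.mem_maxCells.1 hγ₂
      refine if_neg fun h => hne ?_
      exact (B.eq_of_mem_relCore hγ'.1 hγ₂'.1 (hγ'.2.trans hγ₂'.2.symm) hcore h.2).symm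
    · simp [hp]
  rw [minkowskiSumAt]
  refine (Finset.sum_congr rfl fun σ hσ => ?_).trans ((Finset.sum_congr rfl hinner).trans ?_)
  · exact Finset.sum_congr rfl fun γ _ => by congr
  · rw [Finset.sum_comm]
    refine Finset.sum_congr rfl fun p _ => ?_
    rw [← Finset.sum_mul, localWeight]

/-- The crossing relation at `x`: only finitely many points `p` with `D p ≠ 0` cross at `x`, all in
general position with respect to the directions `T`, and their contributions cancel. -/
structure CrossingRelation (D : TropTorus (Fin 4) → ℚ)
    (T : Submodule ℝ (TropTorus (PluckerIndex 1 3))) (x : TropTorus (PluckerIndex 1 3)) : Prop where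
  finite : {p | D p ≠ 0 ∧ x - phi 1 3 p ∈ ultraSpace}.Finite
  phi_mem : ∀ p, D p ≠ 0 → x - phi 1 3 p ∈ ultraSpace → phi 1 3 p ∈ T
  tieSpace_le : ∀ p, D p ≠ 0 → x - phi 1 3 p ∈ ultraSpace → tieSpace (x - phi 1 3 p) ≤ T
  index_ne_zero : ∀ p, D p ≠ 0 → x - phi 1 3 p ∈ ultraSpace →
    crossIndex p (tieSpace (x - phi 1 3 p)) ≠ 0
  sum_eq_zero : ∑ᶠ p ∈ {p | D p ≠ 0 ∧ x - phi 1 3 p ∈ ultraSpace},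
    D p * crossIndex p (tieSpace (x - phi 1 3 p)) = 0

/-- If the tropical Chow hypersurfaces of two curves agree, the crossing relation holds for the
difference of their local weights, almost everywhere in each three-dimensional space. -/
theorem ae_crossingRelation {C C' : WeightedComplex (TropTorus (Fin 4)) 1}
    {B B' : WeightedComplex (TropTorus (PluckerIndex 1 3)) 2}
    {Z Z' : WeightedComplex (TropTorus (PluckerIndex 1 3)) (1 + 2)} {G : Set ℝ}
    (hCr : C.IsRational (intLattice (Fin 4)) G) (hCr' : C'.IsRational (intLattice (Fin 4)) G)
    (hC : C.SupportIsFan) (hC' : C'.SupportIsFan) (hB : IsUltraComplex B) (hB' : IsUltraComplex B')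
    (hZ : IsMinkowskiSum (intLattice (PluckerIndex 1 3)) (phi 1 3) C B Z)
    (hZ' : IsMinkowskiSum (intLattice (PluckerIndex 1 3)) (phi 1 3) C' B' Z') (h : Z.Same Z')
    (Ψ : (Fin 3 → ℝ) →ₗ[ℝ] TropTorus (PluckerIndex 1 3)) (hΨ : Function.Injective Ψ) :
    ∀ᵐ z, CrossingRelation (fun p => localWeight C p - localWeight C' p)
      (LinearMap.range Ψ) (Ψ z) := by
  classical
  let 𝓒 : Set (Set (TropTorus (Fin 4))) := C.maxCells ∪ C'.maxCells
  let 𝓑 : Set (Set (TropTorus (PluckerIndex 1 3))) := B.maxCells ∪ B'.maxCells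
  let 𝓕 : Set (Set (TropTorus (PluckerIndex 1 3))) :=
    (Z.cells ∪ Z'.cells) ∪ (Set.image2 (fun σ γ => phi 1 3 '' σ + γ) 𝓒 𝓑 ∪ 𝓑)
  have h𝓒fin : 𝓒.Finite := C.maxCells.finite_toSet.union C'.maxCells.finite_toSet
  have h𝓑fin : 𝓑.Finite := B.maxCells.finite_toSet.union B'.maxCells.finite_toSet
  have hfin : 𝓕.Finite := (Z.cells.finite_toSet.union Z'.cells.finite_toSet).union
    ((h𝓒fin.image2 _ h𝓑fin).union h𝓑fin)
  have h𝓒conv : ∀ σ ∈ 𝓒, Convex ℝ σ := by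
    rintro σ (hσ | hσ)
    · exact (C.isPolyhedron σ (WeightedComplex.mem_maxCells.1 hσ).1).convex
    · exact (C'.isPolyhedron σ (WeightedComplex.mem_maxCells.1 hσ).1).convex
  have h𝓑conv : ∀ γ ∈ 𝓑, Convex ℝ γ := by
    rintro γ (hγ | hγ)
    · exact (B.isPolyhedron γ (WeightedComplex.mem_maxCells.1 hγ).1).convex
    · exact (B'.isPolyhedron γ (WeightedComplex.mem_maxCells.1 hγ).1).convex
  have hconv : ∀ P ∈ 𝓕, Convex ℝ P := by
    rintro P ((hP | hP) | (⟨σ, hσ, γ, hγ, rfl⟩ | hP))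
    · exact (Z.isPolyhedron P hP).convex
    · exact (Z'.isPolyhedron P hP).convex
    · exact ((h𝓒conv σ hσ).linear_image (phi 1 3)).add (h𝓑conv γ hγ)
    · exact h𝓑conv P hP
  have hT : Module.finrank ℝ (LinearMap.range Ψ) = 3 := by
    rw [LinearMap.finrank_range_of_inj hΨ, Module.finrank_fin_fun]
  filter_upwards [ae_forall_convex_movable MeasureTheory.volume 0 Ψ hfin hconv] with z hz
  set x := Ψ z
  have hmov : ∀ P ∈ 𝓕, Movable (LinearMap.range Ψ) x P := by
    rintro P hP hx _ ⟨d, rfl⟩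
    simpa using hz P hP (by simpa using hx) d
  have hgen : ∀ {A : WeightedComplex (TropTorus (Fin 4)) 1}
      {E : WeightedComplex (TropTorus (PluckerIndex 1 3)) 2}, (A.maxCells : Set _) ⊆ 𝓒 →
      (E.maxCells : Set _) ⊆ 𝓑 → IsGenericFor (LinearMap.range Ψ) A E x := fun hA hE =>
    ⟨fun σ hσ γ hγ => hmov _ (Or.inr (Or.inl ⟨σ, hA hσ, γ, hE hγ, rfl⟩)),
      fun γ hγ => hmov _ (Or.inr (Or.inr (hE hγ)))⟩
  have g1 : IsGenericFor (LinearMap.range Ψ) C B x :=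
    hgen Set.subset_union_left Set.subset_union_left
  have g2 : IsGenericFor (LinearMap.range Ψ) C' B x :=
    hgen Set.subset_union_right Set.subset_union_left
  have g3 : IsGenericFor (LinearMap.range Ψ) C' B' x :=
    hgen Set.subset_union_right Set.subset_union_right
  have f1 := g1.finite_crossingSet hT hB
  have f2 := g2.finite_crossingSet hT hB
  have hD : ∀ p, localWeight C p - localWeight C' p ≠ 0 →
      localWeight C p ≠ 0 ∨ localWeight C' p ≠ 0 := by
    intro p hp
    by_contra! h0
    exact hp (by rw [h0.1, h0.2, sub_zero])
  have hsub : {p | localWeight C p - localWeight C' p ≠ 0 ∧ x - phi 1 3 p ∈ ultraSpace} ⊆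
      crossingSet C x ∪ crossingSet C' x := by
    rintro p ⟨hp, hx⟩
    rcases hD p hp with h0 | h0
    · exact Or.inl ⟨exists_of_localWeight_ne_zero h0, hx⟩
    · exact Or.inr ⟨exists_of_localWeight_ne_zero h0, hx⟩
  have hfull : ∀ p, localWeight C p - localWeight C' p ≠ 0 → x - phi 1 3 p ∈ ultraSpace →
      phi 1 3 p ∈ LinearMap.range Ψ ∧
        tieSpace (x - phi 1 3 p) ≤ LinearMap.range Ψ ∧
          crossIndex p (tieSpace (x - phi 1 3 p)) ≠ 0 := by
    intro p hp hx
    obtain ⟨γ, hγ, hg⟩ := hB.exists_maxCell hx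
    have key : ∀ A : WeightedComplex (TropTorus (Fin 4)) 1, A.SupportIsFan →
        A.IsRational (intLattice (Fin 4)) G → IsGenericFor (LinearMap.range Ψ) A B x →
        localWeight A p ≠ 0 → phi 1 3 p ∈ LinearMap.range Ψ ∧
        tieSpace (x - phi 1 3 p) ≤ LinearMap.range Ψ ∧
          crossIndex p (tieSpace (x - phi 1 3 p)) ≠ 0 := by
      intro A hA hAr hgA h0
      obtain ⟨σ, hσ, hw, hpσ⟩ := exists_of_localWeight_ne_zero h0
      obtain ⟨h1, -, -, h2, -, h3, h4⟩ := hgA.crossing hT hB hσ hγ hpσ hg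
      have hσ' := WeightedComplex.mem_maxCells.1 hσ
      have hσp := hA.vectorSpan_eq hσ hw hpσ h1
      have hpm : phi 1 3 p ∈ (vectorSpan ℝ σ).map (phi 1 3) :=
        Submodule.mem_map_of_mem (hA.mem_vectorSpan hσ hw hpσ)
      refine ⟨h3 ▸ Submodule.mem_sup_left hpm, ?_, ?_⟩
      · rw [← h2, ← h3]
        exact le_sup_right
      · obtain ⟨n, hn, hn0, hnσ⟩ := (hAr σ hσ'.1).exists_lattice_vector hσ'.2
        refine crossIndex_ne_zero hn hn0 (hσp ▸ hnσ) fun hmem => h1 ?_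
        rw [← h2] at hmem
        have := Submodule.disjoint_def.1 h4 _ hpm hmem
        exact phi_injective (by rw [this, map_zero])
    rcases hD p hp with h0 | h0
    · exact key C hC hCr g1 h0
    · exact key C' hC' hCr' g2 h0
  have hfinD := (f1.union f2).subset hsub
  refine ⟨hfinD, fun p h1 h2 => (hfull p h1 h2).1, fun p h1 h2 => (hfull p h1 h2).2.1,
    fun p h1 h2 => (hfull p h1 h2).2.2, ?_⟩
  have hSx : ∀ p ∈ (f1.union f2).toFinset, x - phi 1 3 p ∈ ultraSpace := by
    intro p hp
    rw [Set.Finite.mem_toFinset] at hp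
    exact hp.elim (fun h => h.2) fun h => h.2
  have e1 := g1.minkowskiSumAt_eq hT hB hC (S := (f1.union f2).toFinset)
    (by rw [Set.Finite.coe_toFinset]; exact Set.subset_union_left) hSx
  have e2 := g3.minkowskiSumAt_eq hT hB' hC' (S := (f1.union f2).toFinset)
    (by rw [Set.Finite.coe_toFinset]; exact Set.subset_union_right) hSx
  have e3 := h.minkowskiSumAt_eq continuous_linearMap_torus hZ hZ' hT
    (fun τ hτ => hmov τ (Or.inl (Or.inl hτ))) (fun τ hτ => hmov τ (Or.inl (Or.inr hτ)))
  rw [e1, e2, ← sub_eq_zero, ← Finset.sum_sub_distrib] at e3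
  rw [finsum_mem_eq_finite_toFinset_sum _ hfinD]
  refine Eq.trans ?_ e3
  refine Finset.sum_subset_zero_on_sdiff (fun p hp => ?_) (fun p hp => ?_) fun p _ => ?_
  · rw [Set.Finite.mem_toFinset] at hp ⊢
    exact hsub hp
  · rw [Finset.mem_sdiff] at hp
    have h0 : localWeight C p - localWeight C' p = 0 := by
      by_contra h0
      exact hp.2 (by rw [Set.Finite.mem_toFinset]; exact ⟨h0, hSx p hp.1⟩)
    rw [← sub_mul, h0, zero_mul]
  · rw [sub_mul]

end Crossing

/-! ### The walls of the crossing relation -/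

section Walls

/-- The image of the standard basis vector `e_i` in `ℝ^ι / ℝ (1, …, 1)`. -/
def basisVec {ι : Type*} [DecidableEq ι] (i : ι) : TropTorus ι := toTorus ι (Pi.single i 1)

theorem coordDiff_basisVec {ι : Type*} [DecidableEq ι] (i j k : ι) :
    coordDiff i j (basisVec k) = (Pi.single k 1 : ι → ℝ) i - (Pi.single k 1 : ι → ℝ) j :=
  coordDiff_toTorus _ _ _

/-- If `w i j` differs from all `w i k` and `w j k`, no tie involves the pair `i, j`. -/
theorem basisVec_mem_tieSpace {w : PluckerIndex 1 3 → ℝ} {i j : Fin 4} (hij : i ≠ j)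
    (h : ∀ k, k ≠ i → k ≠ j → w (pair i j) ≠ w (pair i k) ∧ w (pair i j) ≠ w (pair j k)) :
    basisVec (pair i j) ∈ tieSpace (toTorus _ w) := by
  have key : ∀ a b c : Fin 4, a ≠ b → a ≠ c → b ≠ c → pair a b = pair i j →
      w (pair a b) ≠ w (pair a c) := by
    intro a b c hab hac hbc he
    rcases (pair_inj hab hij).1 he with ⟨rfl, rfl⟩ | ⟨rfl, rfl⟩
    · exact (h c hac.symm hbc.symm).1
    · rw [he]
      exact (h c hbc.symm hac.symm).2
  refine toTorus_mem_tieSpace.2 fun a b c hab hac hbc hw => ?_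
  have h1 : pair a b ≠ pair i j := fun he => key a b c hab hac hbc he hw
  have h2 : pair a c ≠ pair i j := fun he => key a c b hac hab hbc.symm he hw.symm
  rw [Pi.single_eq_of_ne h1, Pi.single_eq_of_ne h2]

theorem pair_perm_ne (π : Equiv.Perm (Fin 4)) {a b c d : Fin 4} (hab : a ≠ b) (hcd : c ≠ d)
    (h : ¬(a = c ∧ b = d ∨ a = d ∧ b = c)) : pair (π a) (π b) ≠ pair (π c) (π d) := by
  rwa [Ne, pair_inj (π.injective.ne hab) (π.injective.ne hcd), π.apply_eq_iff_eq,
    π.apply_eq_iff_eq, π.apply_eq_iff_eq, π.apply_eq_iff_eq]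

theorem phiLift_add_single (π : Equiv.Perm (Fin 4)) (a : Fin 4 → ℝ) (s : ℝ)
    {w : PluckerIndex 1 3 → ℝ} (hw : w = phiLift 1 3 a + s • Pi.single (pair (π 2) (π 3)) 1) :
    w (pair (π 0) (π 1)) = a (π 0) + a (π 1) ∧ w (pair (π 0) (π 2)) = a (π 0) + a (π 2) ∧
    w (pair (π 0) (π 3)) = a (π 0) + a (π 3) ∧ w (pair (π 1) (π 2)) = a (π 1) + a (π 2) ∧
    w (pair (π 1) (π 3)) = a (π 1) + a (π 3) ∧ w (pair (π 2) (π 3)) = a (π 2) + a (π 3) + s := by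
  have h : ∀ b c : Fin 4, b ≠ c → ¬(b = 2 ∧ c = 3 ∨ b = 3 ∧ c = 2) →
      w (pair (π b) (π c)) = a (π b) + a (π c) := by
    intro b c hbc hne
    rw [hw, Pi.add_apply, Pi.smul_apply, phiLift_pair _ (π.injective.ne hbc),
      Pi.single_eq_of_ne (pair_perm_ne π hbc (by decide) hne), smul_zero, add_zero]
  refine ⟨h _ _ (by decide) (by decide), h _ _ (by decide) (by decide),
    h _ _ (by decide) (by decide), h _ _ (by decide) (by decide), h _ _ (by decide) (by decide), ?_⟩
  rw [hw, Pi.add_apply, Pi.smul_apply, phiLift_pair _ (π.injective.ne (by decide)),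
    Pi.single_eq_same, smul_eq_mul, mul_one]

theorem phi_add_smul_basisVec (π : Equiv.Perm (Fin 4)) (a : Fin 4 → ℝ) (s : ℝ) :
    phi 1 3 (toTorus _ a) + s • basisVec (pair (π 2) (π 3)) =
      toTorus _ (phiLift 1 3 a + s • Pi.single (pair (π 2) (π 3)) 1) := by
  rw [map_add, map_smul, phi_toTorus, basisVec]

theorem ultra_walls_aux {a b c d s : ℝ} (hs : 0 < s) (h1 : MinTwice (a + b) (a + c) (b + c))
    (h2 : MinTwice (a + b) (a + d) (b + d)) (h3 : MinTwice (a + c) (a + d) (c + d + s))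
    (h4 : MinTwice (b + c) (b + d) (c + d + s)) :
    (a ≤ b ∧ b = c ∧ b = d) ∨ (b < a ∧ a = c ∧ a = d) ∨ (c < b ∧ c < a ∧ d < b ∧ d < a) := by
  unfold MinTwice at *
  grind (splits := 20)

/-- The ultrametrics of the form `φ(q) + s E_{kl}` with `s > 0`, where `i, j, k, l` are the values of
`π` in this order: either `q` lies on the ray of `-e_i` or on that of `-e_j`, or no tie involves the
pair `i, j`. -/
theorem ultra_walls (π : Equiv.Perm (Fin 4)) {q : TropTorus (Fin 4)} {s : ℝ} (hs : 0 < s)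
    (h : phi 1 3 q + s • basisVec (pair (π 2) (π 3)) ∈ ultraSpace) :
    (∃ b : ℝ, 0 ≤ b ∧ q = -b • basisVec (π 0)) ∨ (∃ b : ℝ, 0 < b ∧ q = -b • basisVec (π 1)) ∨
      basisVec (pair (π 0) (π 1)) ∈ tieSpace (phi 1 3 q + s • basisVec (pair (π 2) (π 3))) := by
  obtain ⟨a, rfl⟩ := toTorus_surjective q
  rw [phi_add_smul_basisVec, toTorus_mem_ultraSpace, isUltra_iff π] at h
  obtain ⟨w01, w02, w03, w12, w13, w23⟩ := phiLift_add_single π a s rfl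
  rw [w01, w02, w03, w12, w13, w23] at h
  have hall : ∀ p : Fin 4 → Prop, p (π 0) → p (π 1) → p (π 2) → p (π 3) → ∀ i, p i := by
    intro p h0 h1 h2 h3 i
    obtain ⟨i, rfl⟩ := π.surjective i
    fin_cases i <;> assumption
  have hne : ∀ i j, i ≠ j → π i ≠ π j := fun i j => π.injective.ne
  rcases ultra_walls_aux hs h.1 h.2.1 h.2.2.1 h.2.2.2 with ⟨h1, h2, h3⟩ | ⟨h1, h2, h3⟩ | h5
  · refine Or.inl ⟨a (π 1) - a (π 0), sub_nonneg.2 h1, ?_⟩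
    rw [basisVec, ← map_smul, toTorus_eq_toTorus_iff]
    refine ⟨a (π 1), hall _ ?_ ?_ ?_ ?_⟩ <;>
      simp [hne _ _, ← h2, ← h3]
  · refine Or.inr (Or.inl ⟨a (π 0) - a (π 1), sub_pos.2 h1, ?_⟩)
    rw [basisVec, ← map_smul, toTorus_eq_toTorus_iff]
    refine ⟨a (π 0), hall _ ?_ ?_ ?_ ?_⟩ <;>
      simp [hne _ _, ← h2, ← h3]
  · refine Or.inr (Or.inr ?_)
    rw [phi_add_smul_basisVec]
    refine basisVec_mem_tieSpace (hne _ _ (by decide)) (hall _ ?_ ?_ ?_ ?_)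
    · exact fun h => absurd rfl h
    · exact fun _ h => absurd rfl h
    · intro _ _
      rw [w01, w02, w12]
      exact ⟨by linarith, by linarith⟩
    · intro _ _
      rw [w01, w03, w13]
      exact ⟨by linarith, by linarith⟩

theorem ray_mem_ultraSpace (π : Equiv.Perm (Fin 4)) {b s : ℝ} (hb : 0 ≤ b) (hs : 0 < s) :
    phi 1 3 (-b • basisVec (π 0)) + s • basisVec (pair (π 2) (π 3)) ∈ ultraSpace := by
  rw [basisVec, ← map_smul, phi_add_smul_basisVec, toTorus_mem_ultraSpace, isUltra_iff π]
  obtain ⟨w01, w02, w03, w12, w13, w23⟩ := phiLift_add_single π (-b • Pi.single (π 0) 1) s rfl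
  rw [w01, w02, w03, w12, w13, w23]
  have hne : ∀ i j, i ≠ j → π i ≠ π j := fun i j => π.injective.ne
  simp [MinTwice, hne _ _, hb, hs.le, (neg_nonpos.2 hb).trans hs.le]

/-- In the interior of the cone spanned by `-φ(e_i)` and `E_{kl}`, the ties do not change. -/
theorem tieSpace_ray (π : Equiv.Perm (Fin 4)) {b s : ℝ} (hb : 0 < b) (hs : 0 < s) :
    tieSpace (phi 1 3 (-b • basisVec (π 0)) + s • basisVec (pair (π 2) (π 3))) =
      tieSpace (phi 1 3 (-basisVec (π 0)) + basisVec (pair (π 2) (π 3))) := by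
  let F : ℝ → ℝ → PluckerIndex 1 3 → ℝ := fun b s =>
    phiLift 1 3 (-b • Pi.single (π 0) 1) + s • Pi.single (pair (π 2) (π 3)) 1
  have key : ∀ b s : ℝ, 0 < b → 0 < s → ∀ i j k : Fin 4, i ≠ j → i ≠ k → j ≠ k →
      (F b s (pair i j) = F b s (pair i k) ↔
      ((π 0 = i ∨ π 0 = j) ↔ (π 0 = i ∨ π 0 = k)) ∧
        (pair i j = pair (π 2) (π 3) ↔ pair i k = pair (π 2) (π 3))) := by
    intro b s hb hs i j k hij hik hjk
    have hval : ∀ i j : Fin 4, i ≠ j → F b s (pair i j) =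
          (if π 0 = i ∨ π 0 = j then -b else 0) + if pair i j = pair (π 2) (π 3) then s else 0 := by
      intro i j hij
      change (phiLift 1 3 _ + _) (pair i j) = _
      rw [Pi.add_apply, phiLift_pair _ hij]
      congr 1
      · by_cases h1 : π 0 = i
        · subst h1; simp [hij.symm]
        · by_cases h2 : π 0 = j
          · subst h2; simp [hij]
          · simp [h1, h2, Ne.symm h1, Ne.symm h2]
      · simp [Pi.single_apply]
    have hex : ∀ i j : Fin 4, i ≠ j → (π 0 = i ∨ π 0 = j) → pair i j ≠ pair (π 2) (π 3) := by
      intro i j hij h0 he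
      rcases (pair_inj hij (π.injective.ne (by decide))).1 he with ⟨rfl, rfl⟩ | ⟨rfl, rfl⟩ <;>
        exact absurd h0 (by simp)
    have h1 := hex i j hij
    have h2 := hex i k hik
    rw [hval i j hij, hval i k hik]
    by_cases h3 : π 0 = i ∨ π 0 = j <;> by_cases h4 : π 0 = i ∨ π 0 = k <;>
      by_cases h5 : pair i j = pair (π 2) (π 3) <;> by_cases h6 : pair i k = pair (π 2) (π 3) <;>
      simp only [h3, h4, h5, h6, if_true, if_false, true_implies, ne_eq, not_true, not_false_iff,
        iff_true, iff_false, and_true, and_false, add_zero, zero_add] at h1 h2 ⊢ <;>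
      grind
  have heq : ∀ b s : ℝ, 0 < b → 0 < s → ∀ h,
      h ∈ tieSpace (phi 1 3 (-b • basisVec (π 0)) + s • basisVec (pair (π 2) (π 3))) ↔
        ∀ i j k : Fin 4, i ≠ j → i ≠ k → j ≠ k →
          ((π 0 = i ∨ π 0 = j) ↔ (π 0 = i ∨ π 0 = k)) ∧
            (pair i j = pair (π 2) (π 3) ↔ pair i k = pair (π 2) (π 3)) →
          coordDiff (pair i j) (pair i k) h = 0 := by
    intro b s hb hs h
    obtain ⟨h, rfl⟩ := toTorus_surjective h
    rw [basisVec, ← map_smul, phi_add_smul_basisVec, toTorus_mem_tieSpace]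
    refine forall₄_congr fun i j k hij => forall₂_congr fun hik hjk => ?_
    rw [← key b s hb hs i j k hij hik hjk, coordDiff_toTorus, sub_eq_zero]
  ext h
  have h1 := heq 1 1 one_pos one_pos h
  rw [neg_one_smul, one_smul] at h1
  rw [heq b s hb hs, h1]

end Walls

/-! ### Isolating a single weight -/

section Jump


/-- The linear map `(α, β, s) ↦ φ(α p + β q) + s E`. -/
def wallMap (p q : TropTorus (Fin 4)) (E : TropTorus (PluckerIndex 1 3)) :
    (Fin 3 → ℝ) →ₗ[ℝ] TropTorus (PluckerIndex 1 3) :=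
  (LinearMap.proj 0).smulRight (phi 1 3 p) + (LinearMap.proj 1).smulRight (phi 1 3 q) +
    (LinearMap.proj 2).smulRight E

theorem wallMap_apply (p q : TropTorus (Fin 4)) (E : TropTorus (PluckerIndex 1 3)) (z : Fin 3 → ℝ) :
    wallMap p q E z = phi 1 3 (z 0 • p + z 1 • q) + z 2 • E := by
  simp [wallMap]

theorem phi_add_smul_injective (π : Equiv.Perm (Fin 4)) {q q' : TropTorus (Fin 4)} {s s' : ℝ}
    (h : phi 1 3 q + s • basisVec (pair (π 2) (π 3)) =
      phi 1 3 q' + s' • basisVec (pair (π 2) (π 3))) : q = q' ∧ s = s' := by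
  obtain ⟨a, rfl⟩ := toTorus_surjective q
  obtain ⟨a', rfl⟩ := toTorus_surjective q'
  have hs : s = s' := by
    have h' := h
    rw [phi_add_smul_basisVec, phi_add_smul_basisVec, toTorus_eq_toTorus_iff] at h'
    obtain ⟨c, hc⟩ := h'
    obtain ⟨w01, w02, w03, w12, w13, w23⟩ := phiLift_add_single π a s rfl
    obtain ⟨v01, v02, v03, v12, v13, v23⟩ := phiLift_add_single π a' s' rfl
    have h01 := hc (pair (π 0) (π 1))
    have h02 := hc (pair (π 0) (π 2))
    have h13 := hc (pair (π 1) (π 3))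
    have h23 := hc (pair (π 2) (π 3))
    linarith
  subst hs
  exact ⟨phi_injective (add_right_cancel h), rfl⟩

theorem phi_basisVec_add_basisVec (π : Equiv.Perm (Fin 4)) :
    phi 1 3 (basisVec (π 0) + basisVec (π 1)) =
      basisVec (pair (π 0) (π 1)) - basisVec (pair (π 2) (π 3)) := by
  rw [basisVec, basisVec, basisVec, basisVec, ← map_add, ← map_sub, phi_toTorus,
    toTorus_eq_toTorus_iff]
  refine ⟨1, (forall_pair_iff π).2 ?_⟩
  have hne : ∀ i j, i ≠ j → π i ≠ π j := fun i j => π.injective.ne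
  have hp : ∀ a b c d : Fin 4, a ≠ b → c ≠ d → ¬(a = c ∧ b = d ∨ a = d ∧ b = c) →
    pair (π a) (π b) ≠ pair (π c) (π d) := fun a b c d => pair_perm_ne π
  simp [phiLift_pair, hne, hp]

/-- A weight function `D`, supported on finitely many lines through the origin and subject to the
crossing relations, vanishes at a point `p₀` with distinct coordinates `k` and `l`: on the two sides of the wall spanned by `φ(p₀)` and `E_{kl}`, in the directions of `φ(e_i)`,
the crossing relations differ only by the term of a positive multiple of `p₀`. -/
theorem eq_zero_of_crossingRelation {D : TropTorus (Fin 4) → ℚ}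
    {𝓛 : Set (Submodule ℝ (TropTorus (Fin 4)))} (h𝓛 : 𝓛.Finite)
    (hD𝓛 : ∀ p, p ≠ 0 → D p ≠ 0 → ℝ ∙ p ∈ 𝓛)
    (hcross : ∀ Ψ : (Fin 3 → ℝ) →ₗ[ℝ] TropTorus (PluckerIndex 1 3), Function.Injective Ψ →
      ∀ᵐ z, CrossingRelation D (LinearMap.range Ψ) (Ψ z))
    (π : Equiv.Perm (Fin 4)) {p₀ : TropTorus (Fin 4)} (hp₀ : coordDiff (π 2) (π 3) p₀ ≠ 0)
    (hloc : ∃ δ > 0, ∀ t : ℝ, |t - 1| < δ → D (t • p₀) = D p₀) : D p₀ = 0 := by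
  by_contra hD₀
  have hne : ∀ i j, i ≠ j → π i ≠ π j := fun i j => π.injective.ne
  set e := basisVec (π 0) with he
  set E := basisVec (pair (π 2) (π 3)) with hE
  set Ψ := wallMap p₀ e E with hΨdef
  -- The plane spanned by `p₀` and `e_i` does not contain `e_j`.
  have hli : ∀ α β γ : ℝ, α • p₀ + β • e = γ • basisVec (π 1) → α = 0 ∧ β = 0 ∧ γ = 0 := by
    intro α β γ h
    have h23 := congrArg (coordDiff (π 2) (π 3)) h
    have h03 := congrArg (coordDiff (π 0) (π 3)) h
    have h13 := congrArg (coordDiff (π 1) (π 3)) h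
    simp only [map_add, map_smul, he, coordDiff_basisVec, smul_eq_mul] at h23 h03 h13
    simp [hne, hp₀] at h23 h03 h13
    subst h23
    simp at h03 h13
    exact ⟨rfl, h03, h13.symm⟩
  have hinj : Function.Injective Ψ := by
    intro z z' h
    rw [hΨdef, wallMap_apply, wallMap_apply] at h
    obtain ⟨h1, h2⟩ := phi_add_smul_injective π h
    have h3 : (z 0 - z' 0) • p₀ + (z 1 - z' 1) • e = (0 : ℝ) • basisVec (π 1) := by
      rw [sub_smul, sub_smul, zero_smul, ← sub_eq_zero.2 h1]
      abel
    obtain ⟨h4, h5, -⟩ := hli _ _ _ h3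
    funext i
    fin_cases i
    · exact sub_eq_zero.1 h4
    · exact sub_eq_zero.1 h5
    · exact h2
  have hrange : ∀ p, phi 1 3 p ∈ LinearMap.range Ψ → ∃ α β : ℝ, p = α • p₀ + β • e := by
    rintro p ⟨z, hz⟩
    rw [hΨdef, wallMap_apply] at hz
    refine ⟨z 0, z 1, (phi_add_smul_injective π (s := z 2) (s' := 0) ?_).1.symm⟩
    rw [hz, zero_smul, add_zero]
  have hEij : basisVec (pair (π 0) (π 1)) ∉ LinearMap.range Ψ := by
    intro h
    have hEr : E ∈ LinearMap.range Ψ := ⟨Pi.single 2 1, by simp [hΨdef, wallMap_apply]⟩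
    have h1 := Submodule.sub_mem _ h hEr
    rw [hE, ← phi_basisVec_add_basisVec] at h1
    obtain ⟨α, β, h2⟩ := hrange _ h1
    refine one_ne_zero (α := ℝ) (hli α (β - 1) 1 ?_).2.2
    rw [sub_smul, one_smul, one_smul, ← add_sub_assoc, ← h2, add_sub_cancel_left]
  have hindep : ∀ {t t' c : ℝ}, p₀ + t • e = c • (p₀ + t' • e) → t = t' := by
    intro t t' c h
    have h3 : (1 - c) • p₀ + (t - c * t') • e = (0 : ℝ) • basisVec (π 1) := by
      rw [smul_add] at h
      rw [sub_smul, sub_smul, zero_smul, mul_smul, one_smul, ← sub_eq_zero.2 h]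
      abel
    obtain ⟨h4, h5, -⟩ := hli _ _ _ h3
    rw [← sub_eq_zero.1 h4, one_mul, sub_eq_zero] at h5
    exact h5
  -- Near the ray of `p₀`, no other ray in this plane carries weight.
  obtain ⟨ε, hε, hεD⟩ : ∃ ε > 0, ∀ α β : ℝ, 0 < α → D (α • p₀ + β • e) ≠ 0 → β ≠ 0 →
      ε * α ≤ |β| := by
    have hfin : {t : ℝ | ℝ ∙ (p₀ + t • e) ∈ 𝓛}.Finite := by
      refine h𝓛.preimage fun t _ t' _ h => ?_
      have h1 : p₀ + t • e ∈ ℝ ∙ (p₀ + t' • e) := h ▸ Submodule.mem_span_singleton_self _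
      obtain ⟨c, hc⟩ := Submodule.mem_span_singleton.1 h1
      exact hindep hc.symm
    have hopen : ({t : ℝ | ℝ ∙ (p₀ + t • e) ∈ 𝓛} \ {0})ᶜ ∈ nhds (0 : ℝ) :=
      (hfin.subset Set.sdiff_subset).isClosed.isOpen_compl.mem_nhds (by simp)
    obtain ⟨ε, hε, hb⟩ := Metric.mem_nhds_iff.1 hopen
    refine ⟨ε, hε, fun α β hα hD hβ => ?_⟩
    by_contra! hlt
    have hmem : β / α ∈ Metric.ball (0 : ℝ) ε := by
      rw [mem_ball_zero_iff, Real.norm_eq_abs, abs_div, abs_of_pos hα, div_lt_iff₀ hα]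
      exact hlt
    have hpt : α • p₀ + β • e = α • (p₀ + (β / α) • e) := by
      rw [smul_add, smul_smul, mul_div_cancel₀ _ hα.ne']
    refine hb hmem ⟨?_, div_ne_zero hβ hα.ne'⟩
    have h0 : α • p₀ + β • e ≠ 0 := by
      intro h0
      exact hα.ne' (hli α β 0 (by rw [h0, zero_smul])).1
    have := hD𝓛 _ h0 hD
    rwa [hpt, Submodule.span_singleton_smul_eq (Ne.isUnit hα.ne')] at this
  obtain ⟨δ, hδ, hDδ⟩ := hloc
  -- The parameters `z` and `z + c` are on the two sides of the wall `z 1 = 0`, so close to it that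
  -- no point of nonzero weight other than `z 0 • p₀` lies between them.
  let c : Fin 3 → ℝ := Pi.single 1 (ε / 4)
  let U : Set (Fin 3 → ℝ) := {z | |z 0 - 1| < min δ (1 / 2) ∧ -(ε / 4) < z 1 ∧ z 1 < 0 ∧ 0 < z 2}
  have hU : IsOpen U := by
    have hc : ∀ i : Fin 3, Continuous fun z : Fin 3 → ℝ => z i := continuous_apply
    exact (isOpen_lt ((hc 0).sub continuous_const).abs continuous_const).inter <|
      (isOpen_lt continuous_const (hc 1)).inter <| (isOpen_lt (hc 1) continuous_const).inter <|
        isOpen_lt continuous_const (hc 2)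
  have hUne : U.Nonempty := by
    refine ⟨![1, -(ε / 8), 1], ?_⟩
    simp [U, hδ, hε]
    linarith
  have hae := hcross Ψ hinj
  have hae' : ∀ᵐ z, CrossingRelation D (LinearMap.range Ψ) (Ψ (z + c)) :=
    (MeasureTheory.measurePreserving_add_right MeasureTheory.volume c).quasiMeasurePreserving.ae hae
  obtain ⟨z, ⟨hz0, hz1, hz1', hz2⟩, hrel, hrel'⟩ :=
    (MeasureTheory.Measure.dense_of_ae (hae.and hae')).inter_open_nonempty U hU hUne
  have hz0' := lt_of_lt_of_le hz0 (min_le_left _ _)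
  have hz0'' := abs_lt.1 (lt_of_lt_of_le hz0 (min_le_right _ _))
  have hz0pos : 1 / 2 < z 0 := by linarith [hz0''.1]
  have hDz : D (z 0 • p₀) ≠ 0 := by rwa [hDδ _ hz0']
  have hsmall : ∀ β : ℝ, β ≠ 0 → D (z 0 • p₀ + β • e) ≠ 0 → ε / 4 < |β| := by
    intro β hβ h
    have := hεD (z 0) β (by linarith) h hβ
    nlinarith
  -- The points crossing at the parameters `y` lie on the ray of direction `e_i`.
  have hS : ∀ y : Fin 3 → ℝ, 0 < y 2 → CrossingRelation D (LinearMap.range Ψ) (Ψ y) →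
      {p | D p ≠ 0 ∧ Ψ y - phi 1 3 p ∈ ultraSpace} =
        {p | D p ≠ 0 ∧ ∃ β, y 1 ≤ β ∧ p = y 0 • p₀ + β • e} := by
    intro y hy hrel
    have hsub : ∀ α β : ℝ, Ψ y - phi 1 3 (α • p₀ + β • e) =
        phi 1 3 ((y 0 - α) • p₀ + (y 1 - β) • e) + y 2 • E := by
      intro α β
      have : (y 0 - α) • p₀ + (y 1 - β) • e = (y 0 • p₀ + y 1 • e) - (α • p₀ + β • e) := by
        module
      rw [this, map_sub, hΨdef, wallMap_apply]
      abel
    ext p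
    refine and_congr_right fun hDp => ⟨fun hp => ?_, ?_⟩
    · obtain ⟨α, β, rfl⟩ := hrange _ (hrel.phi_mem p hDp hp)
      have htie := hrel.tieSpace_le _ hDp hp
      rw [hsub] at hp htie
      rcases ultra_walls π hy hp with ⟨b, hb, h⟩ | ⟨b, hb, h⟩ | h
      · have h3 : (y 0 - α) • p₀ + (y 1 - β + b) • e = (0 : ℝ) • basisVec (π 1) := by
          rw [add_smul, ← add_assoc, h, zero_smul, ← add_smul, neg_add_cancel, zero_smul]
        obtain ⟨h4, h5, -⟩ := hli _ _ _ h3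
        exact ⟨β, by linarith, by rw [sub_eq_zero.1 h4]⟩
      · exact absurd (hli _ _ _ h).2.2 (neg_ne_zero.2 hb.ne')
      · exact absurd (htie h) hEij
    · rintro ⟨β, hβ, rfl⟩
      rw [hsub, sub_self, zero_smul, zero_add, ← neg_sub]
      exact ray_mem_ultraSpace π (sub_nonneg.2 hβ) hy
  have hc0 : (z + c) 0 = z 0 := by simp [c]
  have hc1 : (z + c) 1 = z 1 + ε / 4 := by simp [c]
  have hc2 : (z + c) 2 = z 2 := by simp [c]
  set S : Set (TropTorus (Fin 4)) := {p | D p ≠ 0 ∧ ∃ β, ε / 4 < β ∧ p = z 0 • p₀ + β • e} with hSdef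
  have hSc : {p | D p ≠ 0 ∧ Ψ (z + c) - phi 1 3 p ∈ ultraSpace} = S := by
    rw [hS _ (by rwa [hc2]) hrel', hc0, hc1]
    ext p
    refine and_congr_right fun hDp => exists_congr fun β => ?_
    refine ⟨?_, ?_⟩
    · rintro ⟨hβ, rfl⟩
      have hβ0 : 0 < β := by linarith
      exact ⟨by simpa [abs_of_pos hβ0] using hsmall β hβ0.ne' hDp, rfl⟩
    · rintro ⟨hβ, rfl⟩
      exact ⟨by linarith, rfl⟩
  have hSz : {p | D p ≠ 0 ∧ Ψ z - phi 1 3 p ∈ ultraSpace} = insert (z 0 • p₀) S := by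
    rw [hS _ hz2 hrel]
    ext p
    constructor
    · rintro ⟨hDp, β, hβ, rfl⟩
      by_cases hβ0 : β = 0
      · exact Or.inl (by rw [hβ0, zero_smul, add_zero])
      · have h1 := hsmall β hβ0 hDp
        rcases lt_abs.1 h1 with h2 | h2
        · exact Or.inr ⟨hDp, β, h2, rfl⟩
        · linarith
    · rintro (rfl | ⟨hDp, β, hβ, rfl⟩)
      · exact ⟨hDz, 0, hz1'.le, by rw [zero_smul, add_zero]⟩
      · exact ⟨hDp, β, by linarith, rfl⟩
  have hnot : z 0 • p₀ ∉ S := by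
    rintro ⟨-, β, hβ, h⟩
    have h3 : (0 : ℝ) • p₀ + β • e = (0 : ℝ) • basisVec (π 1) := by
      rw [zero_smul, zero_smul, zero_add]
      exact left_eq_add.1 h
    linarith [(hli _ _ _ h3).2.1]
  have htie : ∀ y : Fin 3 → ℝ, y 0 = z 0 → 0 < y 2 → y 1 ≤ ε / 4 → ∀ p ∈ S,
      tieSpace (Ψ y - phi 1 3 p) = tieSpace (phi 1 3 (-e) + E) := by
    rintro y hy0 hy2 hy1 _ ⟨-, β, hβ, rfl⟩
    rw [← tieSpace_ray π (sub_pos.2 (hy1.trans_lt hβ)) hy2, hΨdef, wallMap_apply, hy0,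
      add_sub_right_comm, ← map_sub, add_sub_add_left_eq_sub, ← sub_smul, neg_sub]
  have hfinS : S.Finite := hSc ▸ hrel'.finite
  have e1 := hrel.sum_eq_zero
  have e2 := hrel'.sum_eq_zero
  rw [hSz, finsum_mem_insert _ hnot hfinS] at e1
  rw [hSc] at e2
  have e3 : ∑ᶠ p ∈ S, D p * crossIndex p (tieSpace (Ψ z - phi 1 3 p)) =
      ∑ᶠ p ∈ S, D p * crossIndex p (tieSpace (Ψ (z + c) - phi 1 3 p)) := by
    refine finsum_mem_congr rfl fun p hp => ?_
    rw [htie z rfl hz2 (by linarith) p hp,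
      htie (z + c) hc0 (by rwa [hc2]) (by rw [hc1]; linarith) p hp]
  rw [e3, e2, add_zero] at e1
  have hmem : z 0 • p₀ ∈ {p | D p ≠ 0 ∧ Ψ z - phi 1 3 p ∈ ultraSpace} := by
    rw [hSz]
    exact Set.mem_insert _ _
  exact (mul_ne_zero hDz (Nat.cast_ne_zero.2 (hrel.index_ne_zero _ hmem.1 hmem.2))) e1

end Jump

/-! ### Recovering the curve from its local weights -/

section Recover

section General

theorem ae_add_smul_ne_zero {V : Type*} [AddCommGroup V] [Module ℝ V] (x : V) {d : V}
    (hd : d ≠ 0) : ∀ᵐ t : ℝ, x + t • d ≠ 0 := by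
  have hsub : {t : ℝ | x + t • d = 0}.Subsingleton := by
    intro t ht t' ht'
    exact smul_left_injective ℝ hd (add_left_cancel (Eq.trans ht (Eq.symm ht')))
  rw [MeasureTheory.ae_iff]
  simpa using hsub.measure_zero MeasureTheory.volume

variable {V : Type*} [AddCommGroup V] [Module ℝ V] [FiniteDimensional ℝ V]
  {C C' : WeightedComplex V 1}

theorem ae_isRegularAt (C : WeightedComplex V 1) (x : V) {d : V} (hd : d ≠ 0) :
    ∀ᵐ t : ℝ, IsRegularAt C (x + t • d) := by
  have hconv : ∀ P ∈ (C.maxCells : Set (Set V)), Convex ℝ P := fun P hP =>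
    (C.isPolyhedron P (WeightedComplex.mem_maxCells.1 hP).1).convex
  filter_upwards [ae_forall_convex_movable MeasureTheory.volume x
    (LinearMap.toSpanSingleton ℝ V d) C.maxCells.finite_toSet hconv] with t ht σ hσ hx
  refine (relCore_eq_of_finrank_le (T := ℝ ∙ d) hx ?_ ?_).2
  · intro d' hd'
    obtain ⟨c, rfl⟩ := Submodule.mem_span_singleton.1 hd'
    exact ht σ hσ hx c
  · rw [finrank_span_singleton hd]
    exact (WeightedComplex.mem_maxCells.1 hσ).2.le

/-- If the local weights of `C` and `C'` agree at the points regular for both, then each point of a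
cell of `C` of nonzero weight lies in a cell of `C'` of the same weight. -/
theorem exists_maxCell_weight_eq
    (h : ∀ p, p ≠ 0 → IsRegularAt C p → IsRegularAt C' p → localWeight C p = localWeight C' p)
    {P : Set V} (hP : P ∈ C.maxCells) (hw : C.weight P ≠ 0) {x : V} (hx : x ∈ P) :
    ∃ Q ∈ C'.maxCells, C'.weight Q = C.weight P ∧ x ∈ Q := by
  classical
  have hP' := WeightedComplex.mem_maxCells.1 hP
  obtain ⟨q, hq, hqx⟩ : ∃ q ∈ P, q ≠ x := by
    by_contra! hall
    have := hP'.2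
    rw [polyDim, Set.eq_singleton_iff_unique_mem.2 ⟨hx, hall⟩, vectorSpan_singleton,
      finrank_bot] at this
    exact zero_ne_one this
  have hd : q - x ≠ 0 := sub_ne_zero.2 hqx
  let F : Set ℝ :=
    ⋃ Q ∈ {Q | Q ∈ C'.maxCells ∧ C'.weight Q = C.weight P}, {t : ℝ | x + t • (q - x) ∈ Q}
  have hF : IsClosed F := by
    refine Set.Finite.isClosed_biUnion (C'.maxCells.finite_toSet.subset fun Q hQ => hQ.1)
      fun Q hQ => ?_
    exact (C'.isPolyhedron Q (WeightedComplex.mem_maxCells.1 hQ.1).1).isClosed_line _ _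
  have hdense := MeasureTheory.Measure.dense_of_ae (((ae_add_smul_ne_zero x hd).and
    (ae_isRegularAt C x hd)).and (ae_isRegularAt C' x hd))
  have hsub := (hdense.open_subset_closure_inter (isOpen_Ioo (a := (0 : ℝ)) (b := 1))).trans
    (hF.closure_subset_iff.2 ?_)
  · have h0 := hF.closure_subset_iff.2 hsub
    rw [closure_Ioo zero_ne_one] at h0
    obtain ⟨Q, hQ, hxQ⟩ := Set.mem_iUnion₂.1 (h0 (Set.left_mem_Icc.2 zero_le_one))
    exact ⟨Q, hQ.1, hQ.2, by simpa using hxQ⟩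
  · rintro t ⟨⟨ht0, ht1⟩, ⟨hne, hr⟩, hr'⟩
    have hmem : x + t • (q - x) ∈ P := (C.isPolyhedron P hP'.1).convex.add_smul_sub_mem hx hq
      ⟨ht0.le, ht1.le⟩
    have heq := h _ hne hr hr'
    rw [localWeight_eq hP (hr P hP hmem)] at heq
    obtain ⟨Q, hQ, -, hxQ⟩ := exists_of_localWeight_ne_zero (heq ▸ hw)
    rw [localWeight_eq hQ (hr' Q hQ hxQ)] at heq
    exact Set.mem_iUnion₂.2 ⟨Q, ⟨hQ, heq.symm⟩, hxQ⟩

theorem WeightedComplex.same_of_localWeight_eq [TopologicalSpace V] [IsTopologicalAddGroup V]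
    [ContinuousSMul ℝ V]
    (h : ∀ p, p ≠ 0 → IsRegularAt C p → IsRegularAt C' p → localWeight C p = localWeight C' p) :
    C.Same C' := by
  have h' : ∀ p, p ≠ 0 → IsRegularAt C' p → IsRegularAt C p → localWeight C' p = localWeight C p :=
    fun p h0 h1 h2 => (h p h0 h2 h1).symm
  refine ⟨Set.Subset.antisymm ?_ ?_, ?_⟩
  · rintro x ⟨P, hP, hw, hx⟩
    obtain ⟨Q, hQ, hQw, hxQ⟩ := exists_maxCell_weight_eq h hP hw hx
    exact ⟨Q, hQ, hQw ▸ hw, hxQ⟩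
  · rintro x ⟨P, hP, hw, hx⟩
    obtain ⟨Q, hQ, hQw, hxQ⟩ := exists_maxCell_weight_eq h' hP hw hx
    exact ⟨Q, hQ, hQw ▸ hw, hxQ⟩
  · rintro P hP Q hQ ⟨x, hxP, hxQ⟩
    have hP' := mem_maxCells.1 hP
    have hQ' := mem_maxCells.1 hQ
    have hxP' := intrinsicInterior_subset_relCore P hxP
    have hxQ' := intrinsicInterior_subset_relCore Q hxQ
    by_cases hw : C.weight P = 0
    · by_contra hne
      obtain ⟨R, hR, hRw, hxR⟩ := exists_maxCell_weight_eq h' hQ (hw ▸ Ne.symm hne) hxQ'.1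
      have hR' := mem_maxCells.1 hR
      rw [← C.eq_of_mem_relCore hP'.1 hR'.1 (hP'.2.trans hR'.2.symm) hxP' hxR] at hRw
      exact hne hRw
    · obtain ⟨R, hR, hRw, hxR⟩ := exists_maxCell_weight_eq h hP hw hxP'.1
      have hR' := mem_maxCells.1 hR
      rw [C'.eq_of_mem_relCore hQ'.1 hR'.1 (hQ'.2.trans hR'.2.symm) hxQ' hxR]
      exact hRw.symm

end General

theorem exists_perm_apply {k l : Fin 4} (h : k ≠ l) :
    ∃ π : Equiv.Perm (Fin 4), π 2 = k ∧ π 3 = l := by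
  have h3 : Equiv.swap 2 k 3 ≠ k := fun h3 =>
    absurd ((Equiv.swap 2 k).injective (h3.trans (Equiv.swap_apply_left 2 k).symm)) (by decide)
  refine ⟨(Equiv.swap 2 k).trans (Equiv.swap (Equiv.swap 2 k 3) l), ?_, ?_⟩
  · rw [Equiv.trans_apply, Equiv.swap_apply_left, Equiv.swap_apply_of_ne_of_ne h3.symm h]
  · rw [Equiv.trans_apply, Equiv.swap_apply_left]

/-- Two curves supported on fans with the same tropical Chow hypersurface have the same local
weights. -/
theorem localWeight_eq_of_same {C C' : WeightedComplex (TropTorus (Fin 4)) 1}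
    {B B' : WeightedComplex (TropTorus (PluckerIndex 1 3)) 2}
    {Z Z' : WeightedComplex (TropTorus (PluckerIndex 1 3)) (1 + 2)} {G : Set ℝ}
    (hCr : C.IsRational (intLattice (Fin 4)) G) (hCr' : C'.IsRational (intLattice (Fin 4)) G)
    (hC : C.SupportIsFan) (hC' : C'.SupportIsFan) (hB : IsUltraComplex B) (hB' : IsUltraComplex B')
    (hZ : IsMinkowskiSum (intLattice (PluckerIndex 1 3)) (phi 1 3) C B Z)
    (hZ' : IsMinkowskiSum (intLattice (PluckerIndex 1 3)) (phi 1 3) C' B' Z') (h : Z.Same Z')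
    {p : TropTorus (Fin 4)} (hp0 : p ≠ 0) (hp : IsRegularAt C p) (hp' : IsRegularAt C' p) :
    localWeight C p = localWeight C' p := by
  obtain ⟨k, l, hkl⟩ : ∃ k l, coordDiff k l p ≠ 0 := by
    by_contra! h0
    exact hp0 (eq_zero_of_coordDiff h0)
  have hne : k ≠ l := by
    rintro rfl
    obtain ⟨a, rfl⟩ := toTorus_surjective p
    simp at hkl
  obtain ⟨π, rfl, rfl⟩ := exists_perm_apply hne
  rw [← sub_eq_zero]
  refine eq_zero_of_crossingRelation (D := fun p => localWeight C p - localWeight C' p)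
    (𝓛 := vectorSpan ℝ '' (C.maxCells ∪ C'.maxCells : Set (Set (TropTorus (Fin 4)))))
    ((C.maxCells.finite_toSet.union C'.maxCells.finite_toSet).image _) ?_
    (ae_crossingRelation hCr hCr' hC hC' hB hB' hZ hZ' h) π hkl ?_
  · intro q hq0 hq
    by_cases hqC : localWeight C q = 0
    · have hqC' : localWeight C' q ≠ 0 := fun h0 => hq (by rw [hqC, h0, sub_zero])
      obtain ⟨σ, hσ, hw, hqσ⟩ := exists_of_localWeight_ne_zero hqC'
      exact ⟨σ, Or.inr hσ, hC'.vectorSpan_eq hσ hw hqσ hq0⟩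
    · obtain ⟨σ, hσ, hw, hqσ⟩ := exists_of_localWeight_ne_zero hqC
      exact ⟨σ, Or.inl hσ, hC.vectorSpan_eq hσ hw hqσ hq0⟩
  · obtain ⟨δ, hδ, hb⟩ := hC.eventually_localWeight_eq hp
    obtain ⟨δ', hδ', hb'⟩ := hC'.eventually_localWeight_eq hp'
    refine ⟨min δ δ', lt_min hδ hδ', fun t ht => ?_⟩
    rw [lt_min_iff] at ht
    rw [hb t ht.1, hb' t ht.2]

end Recover

end TropicalChow

theorem mainTheorem2 {K : Type*} [Field K] [IsAlgClosed K] (v : AddValuation K (WithTop ℝ))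
    (hv : ∃ x : K, x ≠ 0 ∧ v x ≠ 0)
    (C C' : TropicalChow.WeightedComplex (TropicalChow.TropTorus (Fin 4)) 1)
    (hC : C.IsTropicalVariety (TropicalChow.intLattice (Fin 4)) (TropicalChow.valueGroup v))
    (hC' : C'.IsTropicalVariety (TropicalChow.intLattice (Fin 4)) (TropicalChow.valueGroup v))
    (hfan : C.SupportIsFan) (hfan' : C'.SupportIsFan)
    (Z Z' : TropicalChow.WeightedComplex (TropicalChow.TropTorus (TropicalChow.PluckerIndex 1 3)) 3)
    (hZ : TropicalChow.IsTropicalChowHypersurface (k := 1) (n := 3) v C Z)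
    (hZ' : TropicalChow.IsTropicalChowHypersurface (k := 1) (n := 3) v C' Z')
    (h : Z.Same Z') :
    C.Same C' := by
  obtain ⟨B, hB, hsum⟩ := hZ
  obtain ⟨B', hB', hsum'⟩ := hZ'
  exact TropicalChow.WeightedComplex.same_of_localWeight_eq fun p hp0 hp hp' =>
    TropicalChow.localWeight_eq_of_same hC.rational hC'.rational hfan hfan'
      (TropicalChow.IsTropicalization.isUltraComplex hv hB)
      (TropicalChow.IsTropicalization.isUltraComplex hv hB') hsum hsum' h hp0 hp hp'

end
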